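/- A $2$-tree is a finite graph obtained from a single edge by repeatedly choosing an edge of the current graph and adding a new vertex adjacent to exactly the two endpoints of that edge. A planar straight-line drawing places the vertices at distinct points of the Euclidean plane and draws the edges as straight segments, so that no edge passes through a vertex other than its endpoints and distinct edges meet only in common endpoints. The local edge-length ratio of such a drawing is the maximum of $|UV|/|VW|$ over all pairs of edges $UV, VW$ sharing a vertex $V$ (with $U=W$ allowed), and the local edge-length ratio $\rho_l(G)$ of $G$ is the infimum of this quantity over all planar straight-line drawings of $G$. Theorem. Every $2$-tree $G$ satisfies $\rho_l(G)\le 4$. Moreover, there is a real RAM algorithm (unit cost per instruction; exact real arithmetic $+,-,\times,/$ and comparisons; no rounding of reals to integers) that, for every constant $\varepsilon>0$, given $\varepsilon$ and the adjacency lists of an $n$-vertex $2$-tree $G$, computes the vertex coordinates of a planar straight-line drawing of $G$ with local edge-length ratio at most $4+\varepsilon$ in $O(n)$ time, where the constant in $O(n)$ may depend on $\varepsilon$ but not on $n$ or $G$. -/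

import Mathlib

open scoped ENNReal

/-! ### 2-trees -/

/-- `InducesTwoTree G s`: the subgraph of `G` induced by the vertex set `s` is a 2-tree, by the
recursive definition: an edge is a 2-tree, and a 2-tree may be extended by a new vertex that is
adjacent to precisely the two endpoints of one of its edges. -/
inductive InducesTwoTree {V : Type*} [DecidableEq V] (G : SimpleGraph V) : Finset V → Prop
  | edge (u v : V) (h : G.Adj u v) : InducesTwoTree G {u, v}
  | simplicial (s : Finset V) (a b w : V) (hs : InducesTwoTree G s)
      (ha : a ∈ s) (hb : b ∈ s) (hab : G.Adj a b) (hw : w ∉ s)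
      (hN : ∀ x ∈ s, G.Adj w x ↔ x = a ∨ x = b) : InducesTwoTree G (insert w s)

/-- A finite graph is a 2-tree. -/
def IsTwoTree {V : Type*} [Fintype V] [DecidableEq V] (G : SimpleGraph V) : Prop :=
  InducesTwoTree G Finset.univ

/-! ### Planar straight-line drawings and the local edge-length ratio -/

/-- The Euclidean plane. -/
abbrev Plane : Type := EuclideanSpace ℝ (Fin 2)

/-- `f` places the vertices of `G` so that drawing every edge as a straight-line segment gives a
planar drawing: vertices are distinct points, no edge passes through a vertex other than its
endpoints, and two distinct edges meet in common endpoints only. -/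
structure IsPlanarDrawing {V : Type*} (G : SimpleGraph V) (f : V → Plane) : Prop where
  injective : Function.Injective f
  vertex_edge : ∀ u v w : V, G.Adj u v → f w ∈ segment ℝ (f u) (f v) → w = u ∨ w = v
  edge_edge : ∀ u v x y : V, G.Adj u v → G.Adj x y → s(u, v) ≠ s(x, y) →
    ∀ p ∈ segment ℝ (f u) (f v) ∩ segment ℝ (f x) (f y),
      ∃ w : V, (w = u ∨ w = v) ∧ (w = x ∨ w = y) ∧ p = f w

/-- The local edge-length ratio of a drawing: the maximum of `|UV| / |VW|` over all pairs of edges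
`UV`, `VW` with a common vertex (`U = W` is allowed). In a planar drawing all lengths are
positive. -/
noncomputable def drawingLocalRatio {V : Type*} (G : SimpleGraph V) (f : V → Plane) : ℝ≥0∞ :=
  ⨆ (u : V) (v : V) (w : V) (_ : G.Adj u v) (_ : G.Adj v w),
    ENNReal.ofReal (dist (f u) (f v) / dist (f v) (f w))

/-- The local edge-length ratio of a graph: the infimum over all its planar straight-line drawings
(`⊤` if there is none). -/
noncomputable def localEdgeLengthRatio {V : Type*} (G : SimpleGraph V) : ℝ≥0∞ :=
  ⨅ (f : V → Plane) (_ : IsPlanarDrawing G f), drawingLocalRatio G f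

/-! ### The real RAM -/

namespace RealRAM

/-- A configuration of the memory. There are integer cells, used for counting and addressing, and
real cells, each of which holds one exact real number. Both kinds come as directly named registers
and as named arrays with random access; a program mentions only finitely many registers and
arrays. -/
structure Store where
  /-- integer registers -/
  ireg : ℕ → ℕ
  /-- real registers -/
  rreg : ℕ → ℝ
  /-- `iarr k i` is cell `i` of integer array `k` -/
  iarr : ℕ → ℕ → ℕ
  /-- `rarr k i` is cell `i` of real array `k` -/
  rarr : ℕ → ℕ → ℝ

/-- The elementary instructions. On integers there are only constants, copying, successor and
predecessor, so that in `t` steps integers grow by at most `t` beyond the input and the constants of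
the program: with linear time and input labels at most linear in `n` they fit in words of
`O(log n)` bits. On reals there are the four exact arithmetic operations. Real numbers
are never rounded to integers or used as addresses, and the only constants are integers. -/
inductive Instr : Type
  | intConst (d c : ℕ)
  | intCopy (d a : ℕ)
  | intSucc (d : ℕ)
  | intPred (d : ℕ)
  | intLoad (d k a : ℕ)
  | intStore (k a b : ℕ)
  | realConst (d : ℕ) (c : ℤ)
  | realCopy (d a : ℕ)
  | realOfInt (d a : ℕ)
  | realAdd (d a b : ℕ)
  | realSub (d a b : ℕ)
  | realMul (d a b : ℕ)
  | realDiv (d a b : ℕ)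
  | realLoad (d k a : ℕ)
  | realStore (k a b : ℕ)

/-- Assignment to an integer register. -/
def Store.setI (s : Store) (d x : ℕ) : Store := { s with ireg := Function.update s.ireg d x }

/-- Assignment to a real register. -/
def Store.setR (s : Store) (d : ℕ) (x : ℝ) : Store :=
  { s with rreg := Function.update s.rreg d x }

/-- The effect of an instruction; `d` is the destination register, `a`, `b` are operand registers,
and `k` is the name of an array, which is addressed by the content of integer register `a`.
The predecessor of `0` is `0`. Division by `0` gives `0`, which a program could arrange by a test. -/
noncomputable def Instr.apply : Instr → Store → Store
  | intConst d c, s => s.setI d c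
  | intCopy d a, s => s.setI d (s.ireg a)
  | intSucc d, s => s.setI d (s.ireg d + 1)
  | intPred d, s => s.setI d (s.ireg d - 1)
  | intLoad d k a, s => s.setI d (s.iarr k (s.ireg a))
  | intStore k a b, s =>
      { s with iarr := Function.update s.iarr k
                (Function.update (s.iarr k) (s.ireg a) (s.ireg b)) }
  | realConst d c, s => s.setR d (c : ℝ)
  | realCopy d a, s => s.setR d (s.rreg a)
  | realOfInt d a, s => s.setR d (s.ireg a : ℝ)
  | realAdd d a b, s => s.setR d (s.rreg a + s.rreg b)
  | realSub d a b, s => s.setR d (s.rreg a - s.rreg b)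
  | realMul d a b, s => s.setR d (s.rreg a * s.rreg b)
  | realDiv d a b, s => s.setR d (s.rreg a / s.rreg b)
  | realLoad d k a, s => s.setR d (s.rarr k (s.ireg a))
  | realStore k a b, s =>
      { s with rarr := Function.update s.rarr k
                (Function.update (s.rarr k) (s.ireg a) (s.rreg b)) }

/-- The tests on which a program can branch: comparisons of two registers of the same kind. -/
inductive Test : Type
  | intEq (a b : ℕ)
  | intLt (a b : ℕ)
  | realLt (a b : ℕ)

/-- The meaning of a test. -/
def Test.Holds : Test → Store → Prop
  | intEq a b, s => s.ireg a = s.ireg b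
  | intLt a b, s => s.ireg a < s.ireg b
  | realLt a b, s => s.rreg a < s.rreg b

/-- Programs: finite, with structured control flow. -/
inductive Program : Type
  | nop
  | instr (i : Instr)
  | seq (p q : Program)
  | cond (T : Test) (p q : Program)
  | loop (T : Test) (p : Program)

/-- `Runs p s t s'`: started in `s`, the program `p` halts in `s'` after exactly `t` steps. Every
instruction and every evaluation of a test is one step. -/
inductive Runs : Program → Store → ℕ → Store → Prop
  | nop (s : Store) : Runs .nop s 1 s
  | instr (i : Instr) (s : Store) : Runs (.instr i) s 1 (i.apply s)
  | seq {p q : Program} {s s' s'' : Store} {t t' : ℕ}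
      (hp : Runs p s t s') (hq : Runs q s' t' s'') : Runs (.seq p q) s (t + t') s''
  | cond_true {T : Test} {p q : Program} {s s' : Store} {t : ℕ}
      (hT : T.Holds s) (hp : Runs p s t s') : Runs (.cond T p q) s (1 + t) s'
  | cond_false {T : Test} {p q : Program} {s s' : Store} {t : ℕ}
      (hT : ¬ T.Holds s) (hq : Runs q s t s') : Runs (.cond T p q) s (1 + t) s'
  | loop_false {T : Test} {p : Program} {s : Store}
      (hT : ¬ T.Holds s) : Runs (.loop T p) s 1 s
  | loop_true {T : Test} {p : Program} {s s' s'' : Store} {t t' : ℕ}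
      (hT : T.Holds s) (hp : Runs p s t s') (hl : Runs (.loop T p) s' t' s'') :
      Runs (.loop T p) s (1 + t + t') s''

/-- An adjacency-list representation of a graph with vertices `0, …, n - 1`: the neighbours of `v`,
each listed once and in an arbitrary order, are the entries of `target` at the positions
`offset v, …, offset (v + 1) - 1`. -/
structure AdjacencyLists {n : ℕ} (G : SimpleGraph (Fin n)) where
  offset : ℕ → ℕ
  target : ℕ → ℕ
  offset_zero : offset 0 = 0
  offset_le : ∀ v < n, offset v ≤ offset (v + 1)
  target_injOn : ∀ v < n, Set.InjOn target (Set.Ico (offset v) (offset (v + 1)))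
  target_image : ∀ v : Fin n, target '' Set.Ico (offset v) (offset (v + 1)) =
    {w : ℕ | ∃ u : Fin n, G.Adj v u ∧ (u : ℕ) = w}
  offset_unused : ∀ v, n < v → offset v = 0
  target_unused : ∀ j, offset n ≤ j → target j = 0

/-- The initial memory: `n` is in integer register `0`, the number `ε` in real register `0`, and the
adjacency lists are in the integer arrays `0` (offsets) and `1` (targets); all other cells are
`0`. -/
noncomputable def inputStore {n : ℕ} {G : SimpleGraph (Fin n)} (A : AdjacencyLists G) (ε : ℝ) :
    Store where
  ireg := fun i => if i = 0 then n else 0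
  rreg := fun i => if i = 0 then ε else 0
  iarr := fun k => if k = 0 then A.offset else if k = 1 then A.target else fun _ => 0
  rarr := fun _ _ => 0

/-- The output: the coordinates of vertex `v` are in cell `v` of the real arrays `0` and `1`. -/
noncomputable def outputDrawing (n : ℕ) (s : Store) : Fin n → Plane :=
  fun v => !₂[s.rarr 0 v, s.rarr 1 v]

end RealRAM

/-! Planarity: every edge of the drawing owns an open triangle based on it, disjoint from the other
triangles and from the drawing. A new vertex is placed inside the triangle of its parent edge and
splits it into three triangles, in which the old edge and the two new edges find their own regions
(`PlanarRegions.insert_of_triangle`). So a vertex can always be added, and only lengths need care.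

Lengths: every vertex `x` gets a scale `λ x`, and all edges at `x` are kept, up to a relative error
`σ`, between `λ x` and `4 λ x` in length; this gives the ratio 4. The triangles are so thin that the
picture is almost one-dimensional, and two types of edges `ab` with apex `q` suffice (`IsScaled`).
In the first type the length is `4 λ b = 2 λ a` and `q` is almost at `b`. A new vertex `w` goes near
the midpoint with `λ w = λ b / 2`; then `ab` and `bw` are of the first type, while `aw` has length
`λ a = 4 λ w` and its apex at twice that distance from `a`, which is the second type. In the second
type the length is `4 λ b = λ a` and `b` is almost the midpoint of `aq`. Here `w` goes near `q` with
`λ w = 2 λ b`; `ab` keeps its type and `aw`, `wb` are of the first type. Thus the two types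
reproduce themselves (`IsScaled.insert_false`, `IsScaled.insert_true`). Each insertion adds `12τ` to
the error, where `τ` measures the thinness, so `τ` of order `ε / n` is enough
(`Extensible.drawingLocalRatio_le`).

Algorithm: vertices of degree at most two are removed through a queue. Any vertex of degree two may
go first, since the rest is again a 2-tree (`InducesTwoTree.erase_of_card_nbrsIn`). For each removed
vertex the positions of its remaining neighbours in its list are recorded, and the vertices are then
reinserted in reverse order. An edge is numbered by its position in the list of its end that was
removed first, so a parent edge is found by checking at most two recorded positions
(`Eliminated.position`). Since the lists have total length at most `4n`, the potentials given to
`Ensures.loop` add up to linear time. -/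

/-! ### Combinatorics of 2-trees: degrees and removal of vertices. -/

section TwoTrees

variable {V : Type*} {G : SimpleGraph V}

open Classical in
/-- The neighbours of `v` within the vertex set `s`. -/
noncomputable def nbrsIn (G : SimpleGraph V) (s : Finset V) (v : V) : Finset V :=
  s.filter fun x => G.Adj v x

theorem mem_nbrsIn {s : Finset V} {v x : V} : x ∈ nbrsIn G s v ↔ x ∈ s ∧ G.Adj v x := by
  simp [nbrsIn]

theorem two_le_card_of_mem {t : Finset V} {a b : V} (ha : a ∈ t) (hb : b ∈ t) (hab : a ≠ b) :
    2 ≤ t.card :=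
  Finset.one_lt_card.2 ⟨a, ha, b, hb, hab⟩

variable [DecidableEq V]

theorem InducesTwoTree.two_le_card {s : Finset V} (h : InducesTwoTree G s) : 2 ≤ s.card := by
  induction h with
  | edge u v h => rw [Finset.card_pair h.ne]
  | simplicial s a b w hs ha hb hab hw hN ih =>
    rw [Finset.card_insert_of_notMem hw]; omega

theorem eq_pair_of_card_two {s : Finset V} {a b : V} (hs : s.card ≤ 2) (ha : a ∈ s) (hb : b ∈ s)
    (hab : a ≠ b) : s = {a, b} := by
  symm
  apply Finset.eq_of_subset_of_card_le
  · intro x hx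
    simp only [Finset.mem_insert, Finset.mem_singleton] at hx
    rcases hx with rfl | rfl <;> assumption
  · rw [Finset.card_pair hab]; exact hs

theorem InducesTwoTree.two_le_card_nbrsIn {s : Finset V} (h : InducesTwoTree G s)
    (hc : 3 ≤ s.card) : ∀ v ∈ s, 2 ≤ (nbrsIn G s v).card := by
  induction h with
  | edge u v h => rw [Finset.card_pair h.ne] at hc; omega
  | simplicial s a b w hs ha hb hab hw hN ih =>
    have hwa := (hN a ha).2 (Or.inl rfl)
    have hwb := (hN b hb).2 (Or.inr rfl)
    intro v hv
    rcases Finset.mem_insert.1 hv with rfl | hv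
    · exact two_le_card_of_mem (a := a) (b := b) (by simp [mem_nbrsIn, ha, hwa])
        (by simp [mem_nbrsIn, hb, hwb]) hab.ne
    · by_cases h3 : 3 ≤ s.card
      · refine (ih h3 v hv).trans (Finset.card_le_card ?_)
        intro x hx
        rw [mem_nbrsIn] at hx ⊢
        exact ⟨Finset.mem_insert_of_mem hx.1, hx.2⟩
      -- The 2-tree before the extension is a single edge, whose ends have degree one; `w` supplies
      -- the second neighbour.
      · have hs' := eq_pair_of_card_two (by omega) ha hb hab.ne
        rw [hs'] at hv
        simp only [Finset.mem_insert, Finset.mem_singleton] at hv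
        rcases hv with rfl | rfl
        · exact two_le_card_of_mem (a := b) (b := w) (by simp [mem_nbrsIn, hb, hab])
            (by simp [mem_nbrsIn, hwa.symm]) hwb.ne'
        · exact two_le_card_of_mem (a := a) (b := w) (by simp [mem_nbrsIn, ha, hab.symm])
            (by simp [mem_nbrsIn, hwb.symm]) hwa.ne'

/-- The vertex added last has only the two ends of its parent edge as neighbours. -/
theorem InducesTwoTree.exists_card_nbrsIn_eq_two {s : Finset V} (h : InducesTwoTree G s)
    (hc : 3 ≤ s.card) : ∃ v ∈ s, (nbrsIn G s v).card = 2 := by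
  cases h with
  | edge u v h => rw [Finset.card_pair h.ne] at hc; omega
  | simplicial s a b w hs ha hb hab hw hN =>
    refine ⟨w, Finset.mem_insert_self _ _, ?_⟩
    have : nbrsIn G (insert w s) w = {a, b} := by
      ext x
      rw [mem_nbrsIn]
      simp only [Finset.mem_insert, Finset.mem_singleton]
      constructor
      · rintro ⟨rfl | hx, h⟩
        · exact absurd h (G.irrefl)
        · exact (hN x hx).1 h
      · rintro (rfl | rfl)
        · exact ⟨Or.inr ha, (hN _ ha).2 (Or.inl rfl)⟩
        · exact ⟨Or.inr hb, (hN _ hb).2 (Or.inr rfl)⟩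
    rw [this, Finset.card_pair hab.ne]

/-- Removing a vertex of degree two from a 2-tree leaves a 2-tree, and the two neighbours of the
removed vertex are adjacent. -/
theorem InducesTwoTree.erase_of_card_nbrsIn {s : Finset V} (h : InducesTwoTree G s)
    (hc : 3 ≤ s.card) : ∀ v ∈ s, (nbrsIn G s v).card = 2 →
      InducesTwoTree G (s.erase v) ∧ ∃ a b, G.Adj a b ∧ nbrsIn G s v = {a, b} := by
  induction h with
  | edge u v h => rw [Finset.card_pair h.ne] at hc; omega
  | simplicial s a b w hs ha hb hab hw hN ih =>
    have hwa := (hN a ha).2 (Or.inl rfl)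
    have hwb := (hN b hb).2 (Or.inr rfl)
    -- The case that an end of the parent edge of `w` is removed. If `s` has three or more vertices,
    -- that end already has degree two in `s`, and `w` makes it three. So the graph is a triangle,
    -- and an edge remains.
    have key : ∀ a b : V, a ∈ s → b ∈ s → G.Adj a b → G.Adj w a → G.Adj w b →
        (nbrsIn G (insert w s) a).card = 2 →
        InducesTwoTree G ((insert w s).erase a) ∧
          ∃ a' b', G.Adj a' b' ∧ nbrsIn G (insert w s) a = {a', b'} := by
      intro a b ha hb hab hwa hwb hv2
      have hn : nbrsIn G (insert w s) a = {b, w} :=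
        eq_pair_of_card_two hv2.le (by simp [mem_nbrsIn, hb, hab])
          (by simp [mem_nbrsIn, hwa.symm]) hwb.ne'
      by_cases h3 : 3 ≤ s.card
      · exfalso
        have h2 := hs.two_le_card_nbrsIn h3 a ha
        have hlt : nbrsIn G s a ⊂ nbrsIn G (insert w s) a := by
          refine Finset.ssubset_iff_subset_ne.2 ⟨?_, ?_⟩
          · intro x hx
            rw [mem_nbrsIn] at hx ⊢
            exact ⟨Finset.mem_insert_of_mem hx.1, hx.2⟩
          · intro h
            have : w ∈ nbrsIn G s a := by rw [h]; simp [mem_nbrsIn, hwa.symm]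
            exact hw (mem_nbrsIn.1 this).1
        have := Finset.card_lt_card hlt
        omega
      · have hs' := eq_pair_of_card_two (by omega) ha hb hab.ne
        refine ⟨?_, b, w, hwb.symm, hn⟩
        have : (insert w s).erase a = {w, b} := by
          rw [hs']
          ext x
          simp only [Finset.mem_erase, Finset.mem_insert, Finset.mem_singleton]
          constructor
          · tauto
          · rintro (rfl | rfl)
            · exact ⟨hwa.ne, Or.inl rfl⟩
            · exact ⟨hab.ne', by tauto⟩
        rw [this]
        exact .edge w b hwb
    intro v hv hv2
    rcases Finset.mem_insert.1 hv with rfl | hvs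
    · refine ⟨by rwa [Finset.erase_insert hw], a, b, hab, ?_⟩
      exact eq_pair_of_card_two hv2.le (by simp [mem_nbrsIn, ha, hwa])
        (by simp [mem_nbrsIn, hb, hwb]) hab.ne
    · have hvw : v ≠ w := fun h => hw (h ▸ hvs)
      by_cases hva : v = a
      · subst hva; exact key v b ha hb hab hwa hwb hv2
      by_cases hvb : v = b
      · subst hvb; exact key v a hb ha hab.symm hwb hwa hv2
      have h3 : 3 ≤ s.card := by
        by_contra h3
        rw [eq_pair_of_card_two (by omega) ha hb hab.ne] at hvs
        simp [hva, hvb] at hvs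
      have hn : nbrsIn G (insert w s) v = nbrsIn G s v := by
        ext x
        simp only [mem_nbrsIn, Finset.mem_insert]
        constructor
        · rintro ⟨rfl | hx, h⟩
          · rcases (hN v hvs).1 h.symm with h | h <;> tauto
          · exact ⟨hx, h⟩
        · tauto
      rw [hn] at hv2 ⊢
      obtain ⟨h1, h2⟩ := ih h3 v hvs hv2
      refine ⟨?_, h2⟩
      -- The removal commutes with the addition of `w`, because both ends of the parent edge of `w`
      -- survive.
      rw [Finset.erase_insert_of_ne hvw.symm]
      exact .simplicial _ a b w h1 (Finset.mem_erase.2 ⟨Ne.symm hva, ha⟩)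
        (Finset.mem_erase.2 ⟨Ne.symm hvb, hb⟩) hab
        (fun h => hw (Finset.mem_of_mem_erase h))
        (fun x hx => hN x (Finset.mem_of_mem_erase hx))

/-- Each added vertex brings two edges and so adds four to the degree sum. This makes the total
length of the adjacency lists linear. -/
theorem InducesTwoTree.sum_card_nbrsIn_le {s : Finset V} (h : InducesTwoTree G s) :
    ∑ v ∈ s, (nbrsIn G s v).card ≤ 4 * s.card := by
  classical
  induction h with
  | edge u v h =>
    rw [Finset.sum_pair h.ne, Finset.card_pair h.ne]
    have h1 : (nbrsIn G {u, v} u).card ≤ 2 :=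
      (Finset.card_le_card (Finset.filter_subset _ _)).trans Finset.card_le_two
    have h2 : (nbrsIn G {u, v} v).card ≤ 2 :=
      (Finset.card_le_card (Finset.filter_subset _ _)).trans Finset.card_le_two
    omega
  | simplicial s a b w hs ha hb hab hw hN ih =>
    rw [Finset.sum_insert hw, Finset.card_insert_of_notMem hw]
    have h1 : (nbrsIn G (insert w s) w).card ≤ 2 := by
      refine (Finset.card_le_card (t := {a, b}) ?_).trans Finset.card_le_two
      intro x hx
      obtain ⟨hx1, hx2⟩ := mem_nbrsIn.1 hx
      rcases Finset.mem_insert.1 hx1 with rfl | hx1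
      · exact absurd hx2 G.irrefl
      · simpa using (hN x hx1).1 hx2
    have h2 : ∑ v ∈ s, (nbrsIn G (insert w s) v).card ≤
        ∑ v ∈ s, ((nbrsIn G s v).card + if v ∈ ({a, b} : Finset V) then 1 else 0) := by
      refine Finset.sum_le_sum fun v hv => ?_
      split_ifs with hvab
      · refine (Finset.card_le_card (t := insert w (nbrsIn G s v)) ?_).trans
          (Finset.card_insert_le _ _)
        intro x hx
        simp only [mem_nbrsIn, Finset.mem_insert] at hx ⊢
        tauto
      · refine Finset.card_le_card ?_
        intro x hx
        simp only [mem_nbrsIn, Finset.mem_insert] at hx ⊢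
        rcases hx with ⟨rfl | hx, h⟩
        · exact absurd (by simpa using (hN v hv).1 h.symm) hvab
        · exact ⟨hx, h⟩
    have h3 : ∑ v ∈ s, (if v ∈ ({a, b} : Finset V) then 1 else 0) ≤ 2 := by
      rw [← Finset.sum_filter, Finset.sum_const, smul_eq_mul, mul_one]
      refine (Finset.card_le_card (t := {a, b}) ?_).trans Finset.card_le_two
      intro x hx
      exact (Finset.mem_filter.1 hx).2
    rw [Finset.sum_add_distrib] at h2
    omega

theorem InducesTwoTree.map {W : Type*} [DecidableEq W] (i : V ↪ W) {s : Finset V}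
    (h : InducesTwoTree G s) : InducesTwoTree (G.map i) (s.map i) := by
  induction h with
  | edge u v h =>
    have := InducesTwoTree.edge (G := G.map i) (i u) (i v) (by simpa using h)
    simpa [Finset.map_insert] using this
  | simplicial s a b w hs ha hb hab hw hN ih =>
    rw [Finset.map_insert]
    refine .simplicial _ (i a) (i b) (i w) ih (by simpa using ha) (by simpa using hb)
      (by simpa using hab) (by simpa using hw) ?_
    intro x hx
    obtain ⟨y, hy, rfl⟩ := Finset.mem_map.1 hx
    simpa using hN y hy

end TwoTrees

/-! ### Drawings with a region reserved for every edge. -/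

section PlanarRegions

variable {V : Type*}

/-- The straight-line segment that represents an edge. -/
def edgeSegment (f : V → Plane) : Sym2 V → Set Plane :=
  Sym2.lift ⟨fun x y => segment ℝ (f x) (f y), fun _ _ => segment_symm _ _ _⟩

theorem edgeSegment_mk (f : V → Plane) (x y : V) :
    edgeSegment f s(x, y) = segment ℝ (f x) (f y) := rfl

theorem edgeSegment_congr {f g : V → Plane} {e : Sym2 V} (h : ∀ x ∈ e, f x = g x) :
    edgeSegment f e = edgeSegment g e := by
  induction e using Sym2.ind with
  | _ x y => rw [edgeSegment_mk, edgeSegment_mk, h x (by simp), h y (by simp)]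

/-- The edges of the subgraph induced by `s`. -/
def edgesIn (G : SimpleGraph V) (s : Finset V) : Set (Sym2 V) :=
  {e | e ∈ G.edgeSet ∧ ∀ x ∈ e, x ∈ s}

theorem mk_mem_edgesIn {G : SimpleGraph V} {s : Finset V} {x y : V} :
    s(x, y) ∈ edgesIn G s ↔ G.Adj x y ∧ x ∈ s ∧ y ∈ s := by
  simp [edgesIn]

/-- A planar straight-line drawing of the subgraph induced by `s`, with a region reserved for each
edge: the regions are disjoint from each other and from the drawing. -/
structure PlanarRegions (G : SimpleGraph V) (s : Finset V) (f : V → Plane)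
    (R : Sym2 V → Set Plane) : Prop where
  injOn : Set.InjOn f s
  vertex_edge : ∀ e ∈ edgesIn G s, ∀ z ∈ s, f z ∈ edgeSegment f e → z ∈ e
  edge_edge : ∀ e ∈ edgesIn G s, ∀ e' ∈ edgesIn G s, e ≠ e' →
    ∀ p ∈ edgeSegment f e, p ∈ edgeSegment f e' → ∃ z ∈ e, z ∈ e' ∧ p = f z
  region_region : ∀ e ∈ edgesIn G s, ∀ e' ∈ edgesIn G s, e ≠ e' → Disjoint (R e) (R e')
  region_edge : ∀ e ∈ edgesIn G s, ∀ e' ∈ edgesIn G s, Disjoint (R e) (edgeSegment f e')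
  region_vertex : ∀ e ∈ edgesIn G s, ∀ z ∈ s, f z ∉ R e

variable [DecidableEq V]

theorem edgesIn_insert {G : SimpleGraph V} {s : Finset V} {a b w : V} (ha : a ∈ s) (hb : b ∈ s)
    (hN : ∀ x ∈ s, G.Adj w x ↔ x = a ∨ x = b) {e : Sym2 V} :
    e ∈ edgesIn G (insert w s) ↔ e ∈ edgesIn G s ∨ e = s(a, w) ∨ e = s(b, w) := by
  have hwa := (hN a ha).2 (Or.inl rfl)
  have hwb := (hN b hb).2 (Or.inr rfl)
  induction e using Sym2.ind with
  | _ x y =>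
    simp only [mk_mem_edgesIn, Finset.mem_insert]
    constructor
    · rintro ⟨h, rfl | hx, rfl | hy⟩
      · exact absurd h G.irrefl
      · right
        rcases (hN y hy).1 h with rfl | rfl
        · left; exact Sym2.eq_swap
        · right; exact Sym2.eq_swap
      · right
        rcases (hN x hx).1 h.symm with rfl | rfl
        · left; rfl
        · right; rfl
      · exact Or.inl ⟨h, hx, hy⟩
    · rintro (⟨h, hx, hy⟩ | h | h)
      · exact ⟨h, Or.inr hx, Or.inr hy⟩
      · rcases Sym2.eq_iff.1 h with ⟨rfl, rfl⟩ | ⟨rfl, rfl⟩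
        · exact ⟨hwa.symm, Or.inr ha, Or.inl rfl⟩
        · exact ⟨hwa, Or.inl rfl, Or.inr ha⟩
      · rcases Sym2.eq_iff.1 h with ⟨rfl, rfl⟩ | ⟨rfl, rfl⟩
        · exact ⟨hwb.symm, Or.inr hb, Or.inl rfl⟩
        · exact ⟨hwb, Or.inl rfl, Or.inr hb⟩

/-- A new vertex `w` adjacent to the ends `a`, `b` of an edge may be drawn in the region of that
edge. -/
theorem PlanarRegions.insert {G : SimpleGraph V} {s : Finset V} {f : V → Plane}
    {R R' : Sym2 V → Set Plane} (h : PlanarRegions G s f R) {a b w : V} (ha : a ∈ s) (hb : b ∈ s)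
    (hab : G.Adj a b) (hw : w ∉ s) (hN : ∀ x ∈ s, G.Adj w x ↔ x = a ∨ x = b) {P : Plane}
    (hP : P ∈ R s(a, b))
    (hPa : segment ℝ (f a) P ⊆ Set.insert (f a) (R s(a, b)))
    (hPb : segment ℝ (f b) P ⊆ Set.insert (f b) (R s(a, b)))
    (hPP : ∀ p ∈ segment ℝ (f a) P, p ∈ segment ℝ (f b) P → p = P)
    (hR : ∀ e ∈ edgesIn G s, e ≠ s(a, b) → R' e = R e)
    (hR0 : R' s(a, b) ⊆ R s(a, b)) (hR1 : R' s(a, w) ⊆ R s(a, b)) (hR2 : R' s(b, w) ⊆ R s(a, b))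
    (h01 : Disjoint (R' s(a, b)) (R' s(a, w))) (h02 : Disjoint (R' s(a, b)) (R' s(b, w)))
    (h12 : Disjoint (R' s(a, w)) (R' s(b, w)))
    (h0a : Disjoint (R' s(a, b)) (segment ℝ (f a) P))
    (h0b : Disjoint (R' s(a, b)) (segment ℝ (f b) P))
    (h1a : Disjoint (R' s(a, w)) (segment ℝ (f a) P))
    (h1b : Disjoint (R' s(a, w)) (segment ℝ (f b) P))
    (h2a : Disjoint (R' s(b, w)) (segment ℝ (f a) P))
    (h2b : Disjoint (R' s(b, w)) (segment ℝ (f b) P)) :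
    PlanarRegions G (insert w s) (Function.update f w P) R' := by
  set g := Function.update f w P with hg
  have hgw : g w = P := by simp [hg]
  have hgs : ∀ x ∈ s, g x = f x := fun x hx => by
    rw [hg, Function.update_of_ne (by rintro rfl; exact hw hx)]
  have he : s(a, b) ∈ edgesIn G s := mk_mem_edgesIn.2 ⟨hab, ha, hb⟩
  have hold : ∀ e ∈ edgesIn G s, edgeSegment g e = edgeSegment f e := fun e he =>
    edgeSegment_congr fun x hx => hgs x (he.2 x hx)
  have hsa : edgeSegment g s(a, w) = segment ℝ (f a) P := by
    rw [edgeSegment_mk, hgw, hgs a ha]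
  have hsb : edgeSegment g s(b, w) = segment ℝ (f b) P := by
    rw [edgeSegment_mk, hgw, hgs b hb]
  -- the new edges, treated alike
  have new_pt : ∀ c, c = a ∨ c = b → ∀ p ∈ segment ℝ (f c) P, p ∈ R s(a, b) ∨ p = f c := by
    rintro c (rfl | rfl) p hp
    · exact (hPa hp).symm
    · exact (hPb hp).symm
  have cs : ∀ c, c = a ∨ c = b → c ∈ s := by rintro c (rfl | rfl) <;> assumption
  have ends : ∀ e, e ∈ edgesIn G (Insert.insert w s) →
      e ∈ edgesIn G s ∨ ∃ c, (c = a ∨ c = b) ∧ e = s(c, w) := by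
    intro e h
    rcases (edgesIn_insert ha hb hN).1 h with h | h | h
    · exact Or.inl h
    · exact Or.inr ⟨a, Or.inl rfl, h⟩
    · exact Or.inr ⟨b, Or.inr rfl, h⟩
  have hsc : ∀ c, c = a ∨ c = b → edgeSegment g s(c, w) = segment ℝ (f c) P := by
    rintro c (rfl | rfl) <;> assumption
  have old_region : ∀ e ∈ edgesIn G s, R' e ⊆ R e := by
    intro e h'
    by_cases h : e = s(a, b)
    · rw [h]; exact hR0
    · rw [hR e h' h]
  have new_region : ∀ c, c = a ∨ c = b → R' s(c, w) ⊆ R s(a, b) := by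
    rintro c (rfl | rfl) <;> assumption
  have hPout : ∀ e ∈ edgesIn G s, P ∉ edgeSegment f e := fun e h1 h2 =>
    Set.disjoint_left.1 (h.region_edge _ he e h1) hP h2
  -- Apart from its old end, a new edge lies in the region of the parent edge, which avoids the old
  -- drawing; so it can meet an old edge only in that end.
  have hmeet : ∀ c, c = a ∨ c = b → ∀ e ∈ edgesIn G s, ∀ p ∈ segment ℝ (f c) P,
      p ∈ edgeSegment f e → c ∈ e ∧ p = f c := by
    intro c hc e he' p hp hpe
    rcases new_pt c hc p hp with hp' | rfl
    · exact absurd hpe (Set.disjoint_left.1 (h.region_edge _ he e he') hp')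
    · exact ⟨h.vertex_edge e he' c (cs c hc) hpe, rfl⟩
  refine ⟨?_, ?_, ?_, ?_, ?_, ?_⟩
  · have hne : ∀ x ∈ s, f x ≠ P := fun x hx hxP => h.region_vertex _ he x hx (hxP ▸ hP)
    intro x hx' y hy' hxy
    rcases Finset.mem_insert.1 (Finset.mem_coe.1 hx') with rfl | hx <;>
      rcases Finset.mem_insert.1 (Finset.mem_coe.1 hy') with rfl | hy
    · rfl
    · rw [hgw, hgs y hy] at hxy; exact absurd hxy.symm (hne y hy)
    · rw [hgw, hgs x hx] at hxy; exact absurd hxy (hne x hx)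
    · rw [hgs x hx, hgs y hy] at hxy; exact h.injOn hx hy hxy
  · intro e he' z hz hze
    rcases ends e he' with h1 | ⟨c, hc, rfl⟩
    · rw [hold e h1] at hze
      rcases Finset.mem_insert.1 hz with rfl | hz
      · rw [hgw] at hze; exact absurd hze (hPout e h1)
      · rw [hgs z hz] at hze; exact h.vertex_edge e h1 z hz hze
    · rcases Finset.mem_insert.1 hz with rfl | hz
      · simp
      · rw [hsc c hc, hgs z hz] at hze
        rcases new_pt c hc _ hze with h2 | h2
        · exact absurd h2 (h.region_vertex _ he z hz)
        · rw [h.injOn hz (cs c hc) h2]; simp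
  · intro e he1 e' he2 hne p hp hp'
    rcases ends e he1 with h1 | ⟨c, hc, rfl⟩ <;> rcases ends e' he2 with h2 | ⟨c', hc', rfl⟩
    · rw [hold e h1] at hp
      rw [hold e' h2] at hp'
      obtain ⟨z, hz, hz', rfl⟩ := h.edge_edge e h1 e' h2 hne p hp hp'
      exact ⟨z, hz, hz', (hgs z (h1.2 z hz)).symm⟩
    · rw [hold e h1] at hp
      rw [hsc c' hc'] at hp'
      obtain ⟨h3, rfl⟩ := hmeet c' hc' e h1 p hp' hp
      exact ⟨c', h3, by simp, (hgs _ (cs _ hc')).symm⟩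
    · rw [hold e' h2] at hp'
      rw [hsc c hc] at hp
      obtain ⟨h3, rfl⟩ := hmeet c hc e' h2 p hp hp'
      exact ⟨c, by simp, h3, (hgs _ (cs _ hc)).symm⟩
    · rw [hsc c hc] at hp
      rw [hsc c' hc'] at hp'
      refine ⟨w, by simp, by simp, ?_⟩
      rw [hgw]
      rcases hc with rfl | rfl <;> rcases hc' with rfl | rfl
      · exact absurd rfl hne
      · exact hPP p hp hp'
      · exact hPP p hp' hp
      · exact absurd rfl hne
  · have key : ∀ e ∈ edgesIn G s, ∀ c, c = a ∨ c = b → Disjoint (R' e) (R' s(c, w)) := by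
      intro e he' c hc
      by_cases h1 : e = s(a, b)
      · subst h1
        rcases hc with rfl | rfl <;> assumption
      · rw [hR e he' h1]
        exact (h.region_region e he' _ he h1).mono_right (new_region c hc)
    intro e he1 e' he2 hne
    rcases ends e he1 with h1 | ⟨c, hc, rfl⟩ <;> rcases ends e' he2 with h2 | ⟨c', hc', rfl⟩
    · exact (h.region_region e h1 e' h2 hne).mono (old_region e h1) (old_region e' h2)
    · exact key e h1 c' hc'
    · exact (key e' h2 c hc).symm
    · rcases hc with rfl | rfl <;> rcases hc' with rfl | rfl
      · exact absurd rfl hne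
      · exact h12
      · exact h12.symm
      · exact absurd rfl hne
  · intro e he1 e' he2
    rcases ends e he1 with h1 | ⟨c, hc, rfl⟩ <;> rcases ends e' he2 with h2 | ⟨c', hc', rfl⟩
    · rw [hold e' h2]
      exact (h.region_edge e h1 e' h2).mono_left (old_region e h1)
    · rw [hsc c' hc']
      by_cases h3 : e = s(a, b)
      · subst h3
        rcases hc' with rfl | rfl <;> assumption
      · rw [hR e h1 h3, Set.disjoint_left]
        intro p hp hp'
        rcases new_pt c' hc' p hp' with h4 | rfl
        · exact Set.disjoint_left.1 (h.region_region e h1 _ he h3) hp h4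
        · exact h.region_vertex e h1 _ (cs _ hc') hp
    · rw [hold e' h2]
      exact (h.region_edge _ he e' h2).mono_left (new_region c hc)
    · rw [hsc c' hc']
      rcases hc with rfl | rfl <;> rcases hc' with rfl | rfl <;> assumption
  · intro e he1 z hz hze
    have hsub : R' e ⊆ R s(a, b) ∨ (e ∈ edgesIn G s ∧ R' e ⊆ R e) := by
      rcases ends e he1 with h1 | ⟨c, hc, rfl⟩
      · exact Or.inr ⟨h1, old_region e h1⟩
      · exact Or.inl (new_region c hc)
    rcases Finset.mem_insert.1 hz with rfl | hz
    · rw [hgw] at hze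
      rcases ends e he1 with h1 | ⟨c, hc, rfl⟩
      · by_cases h3 : e = s(a, b)
        · subst h3
          exact Set.disjoint_left.1 h0a hze (right_mem_segment ℝ _ _)
        · rw [hR e h1 h3] at hze
          exact Set.disjoint_left.1 (h.region_region e h1 _ he h3) hze hP
      · rcases hc with rfl | rfl
        · exact Set.disjoint_left.1 h1a hze (right_mem_segment ℝ _ _)
        · exact Set.disjoint_left.1 h2a hze (right_mem_segment ℝ _ _)
    · rw [hgs z hz] at hze
      rcases hsub with h1 | ⟨h1, h2⟩
      · exact h.region_vertex _ he z hz (h1 hze)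
      · exact h.region_vertex e h1 z hz (h2 hze)

end PlanarRegions

/-! ### Affine geometry of triangles in barycentric coordinates. -/

section Triangles

variable {E : Type*} [AddCommGroup E] [Module ℝ E]

/-- The open triangle with the given corners. -/
def openTriangle (a b c : E) : Set E :=
  {x | ∃ α β γ : ℝ, 0 < α ∧ 0 < β ∧ 0 < γ ∧ α + β + γ = 1 ∧ x = α • a + β • b + γ • c}

/-- The three points are not collinear. -/
def Nondegenerate (a b c : E) : Prop :=
  ∀ α β γ : ℝ, α + β + γ = 0 → α • a + β • b + γ • c = 0 → α = 0 ∧ β = 0 ∧ γ = 0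

theorem Nondegenerate.rotate {a b c : E} (h : Nondegenerate a b c) : Nondegenerate b c a := by
  intro α β γ h1 h2
  obtain ⟨h3, h4, h5⟩ := h γ α β (by linarith) (by rw [← h2]; module)
  exact ⟨h4, h5, h3⟩

theorem Nondegenerate.swap {a b c : E} (h : Nondegenerate a b c) : Nondegenerate b a c := by
  intro α β γ h1 h2
  obtain ⟨h3, h4, h5⟩ := h β α γ (by linarith) (by rw [← h2]; module)
  exact ⟨h4, h3, h5⟩

theorem openTriangle_rotate (a b c : E) : openTriangle a b c = openTriangle b c a := by
  ext x
  constructor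
  · rintro ⟨α, β, γ, hα, hβ, hγ, h, rfl⟩
    exact ⟨β, γ, α, hβ, hγ, hα, by linarith, by module⟩
  · rintro ⟨α, β, γ, hα, hβ, hγ, h, rfl⟩
    exact ⟨γ, α, β, hγ, hα, hβ, by linarith, by module⟩

theorem openTriangle_swap (a b c : E) : openTriangle a b c = openTriangle b a c := by
  ext x
  constructor
  · rintro ⟨α, β, γ, hα, hβ, hγ, h, rfl⟩
    exact ⟨β, α, γ, hβ, hα, hγ, by linarith, by module⟩
  · rintro ⟨α, β, γ, hα, hβ, hγ, h, rfl⟩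
    exact ⟨β, α, γ, hβ, hα, hγ, by linarith, by module⟩

/-- Barycentric coordinates are unique. -/
theorem Nondegenerate.coords_unique {a b c : E} (h : Nondegenerate a b c) {α β γ α' β' γ' : ℝ}
    (h1 : α + β + γ = α' + β' + γ')
    (h2 : α • a + β • b + γ • c = α' • a + β' • b + γ' • c) : α = α' ∧ β = β' ∧ γ = γ' := by
  obtain ⟨h3, h4, h5⟩ := h (α - α') (β - β') (γ - γ') (by linarith) (by
    rw [← sub_eq_zero] at h2; rw [← h2]; module)
  exact ⟨by linarith, by linarith, by linarith⟩

/-- The coordinate of `w` at `c` is positive, so a relation between `a`, `b`, `w` expands to one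
between `a`, `b`, `c` that forces the coefficient of `w` to vanish. -/
theorem Nondegenerate.of_mem {a b c w : E} (h : Nondegenerate a b c) (hw : w ∈ openTriangle a b c) :
    Nondegenerate a b w := by
  obtain ⟨α₀, β₀, γ₀, hα, hβ, hγ, h0, rfl⟩ := hw
  intro α β γ h1 h2
  obtain ⟨h3, h4, h5⟩ := h (α + γ * α₀) (β + γ * β₀) (γ * γ₀)
    (by linear_combination h1 + γ * h0) (by rw [← h2]; module)
  have h6 : γ = 0 := by
    rcases mul_eq_zero.1 h5 with h | h
    · exact h
    · exact absurd h hγ.ne'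
  subst h6
  exact ⟨by linarith, by linarith, rfl⟩

theorem openTriangle_subset {a b c w : E} (hw : w ∈ openTriangle a b c) :
    openTriangle a b w ⊆ openTriangle a b c := by
  obtain ⟨α₀, β₀, γ₀, hα₀, hβ₀, hγ₀, h0, rfl⟩ := hw
  rintro x ⟨α, β, γ, hα, hβ, hγ, h1, rfl⟩
  exact ⟨α + γ * α₀, β + γ * β₀, γ * γ₀, by positivity, by positivity, by positivity,
    by linear_combination h1 + γ * h0, by module⟩

theorem Nondegenerate.lerp {a b c : E} (h : Nondegenerate a b c) {τ : ℝ} (hτ : τ ≠ 0) :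
    Nondegenerate a b (b + τ • (c - b)) := by
  intro α β γ h1 h2
  obtain ⟨h3, h4, h5⟩ := h α (β + γ * (1 - τ)) (γ * τ) (by linear_combination h1)
    (by rw [← h2]; module)
  have h6 : γ = 0 := by
    rcases mul_eq_zero.1 h5 with h | h
    · exact h
    · exact absurd h hτ
  subst h6
  exact ⟨h3, by linarith, rfl⟩

/-- Used to bring the apex of a region close to one end of its edge: it slides along a side while
the base stays. -/
theorem openTriangle_lerp_subset {a b c : E} {τ : ℝ} (h0 : 0 < τ) (h1 : τ ≤ 1) :
    openTriangle a b (b + τ • (c - b)) ⊆ openTriangle a b c := by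
  rintro x ⟨α, β, γ, hα, hβ, hγ, h, rfl⟩
  have : 0 ≤ γ * (1 - τ) := mul_nonneg hγ.le (by linarith)
  exact ⟨α, β + γ * (1 - τ), γ * τ, hα, by linarith, by positivity, by linear_combination h,
    by module⟩

/-- An interior point splits a triangle into disjoint triangles. -/
theorem disjoint_openTriangle {a b c w : E} (h : Nondegenerate a b c)
    (hw : w ∈ openTriangle a b c) : Disjoint (openTriangle a b w) (openTriangle a c w) := by
  obtain ⟨α₀, β₀, γ₀, hα₀, hβ₀, hγ₀, h0, rfl⟩ := hw
  rw [Set.disjoint_left]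
  rintro x ⟨α, β, γ, hα, hβ, hγ, h1, rfl⟩ ⟨α', γ', β', hα', hγ', hβ', h1', h2⟩
  obtain ⟨h3, h4, h5⟩ := h.coords_unique
    (α := α + γ * α₀) (β := β + γ * β₀) (γ := γ * γ₀)
    (α' := α' + β' * α₀) (β' := β' * β₀) (γ' := γ' + β' * γ₀)
    (by linear_combination h1 + γ * h0 - h1' - β' * h0) (by
      calc _ = α • a + β • b + γ • (α₀ • a + β₀ • b + γ₀ • c) := by module
        _ = _ := by rw [h2]; module)
  -- The form `γ₀ · (coordinate at b) - β₀ · (coordinate at c)` vanishes on the line `aw` and has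
  -- opposite signs on the two triangles.
  have h6 : β * γ₀ + γ' * β₀ = 0 := by linear_combination γ₀ * h4 - β₀ * h5
  have : 0 < β * γ₀ + γ' * β₀ := by positivity
  linarith

theorem disjoint_openTriangle_side {a b c : E} (h : Nondegenerate a b c) :
    Disjoint (openTriangle a b c) (segment ℝ a c) := by
  rw [Set.disjoint_left]
  rintro x ⟨α, β, γ, hα, hβ, hγ, h1, rfl⟩ ⟨s, t, hs, ht, hst, h2⟩
  obtain ⟨_, h3, _⟩ := h.coords_unique (α := α) (β := β) (γ := γ) (α' := s) (β' := 0) (γ' := t)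
    (by linarith) (by rw [← h2]; module)
  linarith

/-- Compare the coordinates at `a` and `b`: `α₀ · (coordinate at b)` is at least `β₀ · (coordinate
at a)` on the segment, and strictly smaller in the triangle. -/
theorem disjoint_openTriangle_segment {a b c w : E} (h : Nondegenerate a b c)
    (hw : w ∈ openTriangle a b c) : Disjoint (openTriangle a c w) (segment ℝ b w) := by
  obtain ⟨α₀, β₀, γ₀, hα₀, hβ₀, hγ₀, h0, rfl⟩ := hw
  rw [Set.disjoint_left]
  rintro x ⟨α, γ, δ, hα, hγ, hδ, h1, rfl⟩ ⟨s, t, hs, ht, hst, h2⟩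
  obtain ⟨h3, h4, h5⟩ := h.coords_unique
    (α := α + δ * α₀) (β := δ * β₀) (γ := γ + δ * γ₀)
    (α' := t * α₀) (β' := s + t * β₀) (γ' := t * γ₀)
    (by linear_combination h1 + δ * h0 - hst - t * h0) (by
      calc _ = α • a + γ • c + δ • (α₀ • a + β₀ • b + γ₀ • c) := by module
        _ = _ := by rw [← h2]; module)
  have h6 : t ≤ δ := by
    by_contra h7
    push Not at h7
    have : δ * β₀ < t * β₀ := mul_lt_mul_of_pos_right h7 hβ₀
    linarith
  have : t * α₀ ≤ δ * α₀ := mul_le_mul_of_nonneg_right h6 hα₀.le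
  linarith

theorem segment_subset_insert_openTriangle {a b c w : E} (hw : w ∈ openTriangle a b c) :
    segment ℝ a w ⊆ Set.insert a (openTriangle a b c) := by
  obtain ⟨α₀, β₀, γ₀, hα₀, hβ₀, hγ₀, h0, rfl⟩ := hw
  rintro x ⟨s, t, hs, ht, hst, rfl⟩
  rcases ht.eq_or_lt with rfl | ht
  · left
    have : s = 1 := by linarith
    subst this
    module
  · right
    exact ⟨s + t * α₀, t * β₀, t * γ₀, by positivity, by positivity, by positivity,
      by linear_combination hst + t * h0, by module⟩

theorem eq_of_mem_segment_of_mem_segment {a b c : E} (h : Nondegenerate a b c) {p : E}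
    (h1 : p ∈ segment ℝ a c) (h2 : p ∈ segment ℝ b c) : p = c := by
  obtain ⟨s, t, hs, ht, hst, rfl⟩ := h1
  obtain ⟨s', t', hs', ht', hst', h3⟩ := h2
  obtain ⟨h4, h5, h6⟩ := h.coords_unique (α := s) (β := 0) (γ := t) (α' := 0) (β' := s')
    (γ' := t') (by linarith) (by
      calc _ = s • a + t • c := by module
        _ = _ := by rw [← h3]; module)
  have : t = 1 := by linarith
  subst h4 this
  module

end Triangles

/-! ### Subdivision of a triangular region by a new vertex. -/

section Subdivision

variable {V : Type*} [DecidableEq V]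

/-- The point `P` cuts the region into triangles on `ab`, `aP` and `bP`, the last two sharing the
side `qP`. The new regions need only be contained in them, which leaves freedom to move the apices
as the length conditions require. -/
theorem PlanarRegions.insert_of_triangle {G : SimpleGraph V} {s : Finset V} {f : V → Plane}
    {R R' : Sym2 V → Set Plane} (h : PlanarRegions G s f R) {a b w : V} (ha : a ∈ s) (hb : b ∈ s)
    (hab : G.Adj a b) (hw : w ∉ s) (hN : ∀ x ∈ s, G.Adj w x ↔ x = a ∨ x = b) {P q : Plane}
    (hq : Nondegenerate (f a) (f b) q) (hRab : R s(a, b) = openTriangle (f a) (f b) q)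
    (hP : P ∈ openTriangle (f a) (f b) q)
    (hR : ∀ e ∈ edgesIn G s, e ≠ s(a, b) → R' e = R e)
    (h0 : R' s(a, b) ⊆ openTriangle (f a) (f b) P) (h1 : R' s(a, w) ⊆ openTriangle (f a) q P)
    (h2 : R' s(b, w) ⊆ openTriangle (f b) q P) :
    PlanarRegions G (Insert.insert w s) (Function.update f w P) R' := by
  have hP' : P ∈ openTriangle (f b) (f a) q := by rwa [openTriangle_swap]
  have hPq : P ∈ openTriangle (f a) q (f b) := by rwa [← openTriangle_rotate, openTriangle_swap]
  have hPq' : P ∈ openTriangle (f b) q (f a) := by rwa [← openTriangle_rotate]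
  have hPr : P ∈ openTriangle q (f a) (f b) := by rwa [openTriangle_rotate]
  have hq' := hq.swap
  have hqr : Nondegenerate q (f a) (f b) := hq.rotate.rotate
  have haq : Nondegenerate (f a) q (f b) := hqr.swap
  have hn := hq.of_mem hP
  have h0P : openTriangle (f a) (f b) P ⊆ openTriangle (f a) (f b) q := openTriangle_subset hP
  have h1P : openTriangle (f a) q P ⊆ openTriangle (f a) (f b) q := by
    refine (openTriangle_subset hPq).trans_eq ?_
    rw [openTriangle_swap, openTriangle_rotate]
  have h2P : openTriangle (f b) q P ⊆ openTriangle (f a) (f b) q := by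
    refine (openTriangle_subset hPq').trans_eq ?_
    rw [← openTriangle_rotate]
  have d01 : Disjoint (openTriangle (f a) (f b) P) (openTriangle (f a) q P) :=
    disjoint_openTriangle hq hP
  have d02 : Disjoint (openTriangle (f a) (f b) P) (openTriangle (f b) q P) := by
    rw [openTriangle_swap (f a)]
    exact disjoint_openTriangle hq' hP'
  have d12 : Disjoint (openTriangle (f a) q P) (openTriangle (f b) q P) := by
    rw [openTriangle_swap (f a), openTriangle_swap (f b)]
    exact disjoint_openTriangle hqr hPr
  refine h.insert ha hb hab hw hN (P := P) (by rwa [hRab]) ?_ ?_ ?_ hR ?_ ?_ ?_ ?_ ?_ ?_ ?_ ?_ ?_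
    ?_ ?_ ?_
  · rw [hRab]; exact segment_subset_insert_openTriangle hP
  · rw [hRab, openTriangle_swap]; exact segment_subset_insert_openTriangle hP'
  · intro p; exact eq_of_mem_segment_of_mem_segment hn
  · rw [hRab]; exact h0.trans h0P
  · rw [hRab]; exact h1.trans h1P
  · rw [hRab]; exact h2.trans h2P
  · exact d01.mono h0 h1
  · exact d02.mono h0 h2
  · exact d12.mono h1 h2
  · exact (disjoint_openTriangle_side hn).mono_left h0
  · refine Disjoint.mono_left h0 ?_
    rw [openTriangle_swap]
    exact disjoint_openTriangle_side hn.swap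
  · exact (disjoint_openTriangle_side (haq.of_mem hPq)).mono_left h1
  · exact (disjoint_openTriangle_segment hq hP).mono_left h1
  · exact (disjoint_openTriangle_segment hq' hP').mono_left h2
  · exact (disjoint_openTriangle_side (hq.rotate.of_mem hPq')).mono_left h2

end Subdivision

/-! ### The two types of edges and their lengths under insertion. -/

section Metric

/-- The shape of an edge from `a` to `b` with apex `q`, where `la`, `lb` are the scales of its
ends and `σ` is the relative error. In the first case the apex is close to `b`; in the second case
it is opposite to `a`. -/
def IsScaled (τ σ : ℝ) (a b q : Plane) (la lb : ℝ) : Bool → Prop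
  | false => la = 2 * lb ∧ |dist a b - 4 * lb| ≤ σ * (4 * lb) ∧ dist q b ≤ 4 * τ * (4 * lb)
  | true => la = 4 * lb ∧ |dist a b - 4 * lb| ≤ σ * (4 * lb) ∧ |dist q a - 8 * lb| ≤ σ * (8 * lb) ∧
      |dist q b - 4 * lb| ≤ σ * (4 * lb)

/-- The interpolation parameter of a new vertex. -/
def insertWeight (τ : ℝ) (k : Bool) : ℝ := bif k then 1 - τ else τ

/-- The position of a new vertex. -/
noncomputable def insertPoint (γ : ℝ) (a b q : Plane) : Plane :=
  (1 / 2 : ℝ) • (a + b) + γ • (q - (1 / 2 : ℝ) • (a + b))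

theorem insertPoint_mem {γ : ℝ} (h0 : 0 < γ) (h1 : γ < 1) (a b q : Plane) :
    insertPoint γ a b q ∈ openTriangle a b q :=
  ⟨(1 - γ) / 2, (1 - γ) / 2, γ, by linarith, by linarith, h0, by ring, by
    rw [insertPoint]; module⟩

theorem insertWeight_pos {τ : ℝ} (h0 : 0 < τ) (h1 : τ < 1) (k : Bool) : 0 < insertWeight τ k := by
  cases k <;> simp [insertWeight] <;> linarith

theorem insertWeight_lt {τ : ℝ} (h0 : 0 < τ) (h1 : τ < 1) (k : Bool) : insertWeight τ k < 1 := by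
  cases k <;> simp [insertWeight] <;> linarith

theorem dist_lerp {E : Type*} [NormedAddCommGroup E] [NormedSpace ℝ E] {τ : ℝ} (h : 0 ≤ τ)
    (a b : E) : dist (a + τ • (b - a)) a = τ * dist b a := by
  rw [dist_eq_norm, add_sub_cancel_left, norm_smul, Real.norm_of_nonneg h, dist_eq_norm]

theorem dist_half_add_left (a b : Plane) : dist ((1 / 2 : ℝ) • (a + b)) a = dist a b / 2 := by
  rw [dist_eq_norm, show (1 / 2 : ℝ) • (a + b) - a = (1 / 2 : ℝ) • (b - a) by module, norm_smul,
    dist_comm, dist_eq_norm, Real.norm_of_nonneg (by norm_num)]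
  ring

theorem IsScaled.mono {τ σ σ' : ℝ} (h : σ ≤ σ') {a b q : Plane} {la lb : ℝ} (hb : 0 < lb)
    {k : Bool} (hs : IsScaled τ σ a b q la lb k) : IsScaled τ σ' a b q la lb k := by
  have h4 : σ * (4 * lb) ≤ σ' * (4 * lb) := by gcongr
  have h8 : σ * (8 * lb) ≤ σ' * (8 * lb) := by gcongr
  cases k
  · exact ⟨hs.1, hs.2.1.trans h4, hs.2.2⟩
  · exact ⟨hs.1, hs.2.1.trans h4, hs.2.2.1.trans h8, hs.2.2.2.trans h4⟩

/-- In the limit `q = b` and `w` is the midpoint of `ab`, so that all the lengths are exact with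
scale `lb / 2` at `w`. The rest is the triangle inequality: `q` is within `16τ · lb` of `b`, and `w`
within `8τ · lb` of the midpoint. -/
theorem IsScaled.insert_false {τ σ : ℝ} {a b q : Plane} {la lb : ℝ}
    (h : IsScaled τ σ a b q la lb false) (hb : 0 < lb) (hτ : 0 < τ) (hσ : 0 ≤ σ)
    (hσ' : σ + 12 * τ ≤ 1) {w : Plane} (hw : w = insertPoint τ a b q) :
    IsScaled τ (σ + 12 * τ) a b (b + τ • (w - b)) la lb false ∧
    IsScaled τ (σ + 12 * τ) a w q la (lb / 2) true ∧
    IsScaled τ (σ + 12 * τ) b w (w + τ • (q - w)) lb (lb / 2) false := by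
  obtain ⟨h1, h2, h3⟩ := h
  set m := (1 / 2 : ℝ) • (a + b) with hm
  have hma : dist m a = dist a b / 2 := dist_half_add_left a b
  have hmb : dist m b = dist a b / 2 := by
    rw [hm, add_comm, dist_half_add_left, dist_comm]
  have hwm : dist w m = τ * dist q m := by rw [hw, insertPoint, dist_lerp hτ.le]
  have h4 := dist_triangle q b m
  rw [dist_comm b m] at h4
  rw [abs_le] at h2
  have hp : 0 < τ * lb := by positivity
  have hq1 : 0 ≤ σ * lb := by positivity
  have hq2 : σ * lb + 12 * (τ * lb) ≤ lb := by nlinarith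
  have hwm' : dist w m ≤ 8 * (τ * lb) := by
    rw [hwm]
    have : dist q m ≤ 8 * lb := by linarith
    nlinarith
  have e1 := dist_triangle w m a
  have e2 := dist_triangle m w a
  have e3 := dist_triangle w m b
  have e4 := dist_triangle m w b
  have e5 := dist_triangle q b a
  have e6 := dist_triangle b q a
  have e7 := dist_triangle q b w
  have e8 := dist_triangle b q w
  rw [dist_comm m w] at e2 e4
  rw [dist_comm b q] at e6 e8
  rw [dist_comm b a] at e5 e6
  rw [dist_comm b w] at e7 e8
  have hl : ∀ c : ℝ, (σ + 12 * τ) * (c * lb) = c * (σ * lb) + 12 * c * (τ * lb) := fun c => by ring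
  have hl' : ∀ c : ℝ, (σ + 12 * τ) * (c * (lb / 2)) = c / 2 * (σ * lb) + 6 * c * (τ * lb) :=
    fun c => by ring
  refine ⟨⟨h1, ?_, ?_⟩, ⟨by linarith, ?_, ?_, ?_⟩, ⟨by linarith, ?_, ?_⟩⟩
  · rw [abs_le, hl]; constructor <;> linarith
  · rw [dist_lerp hτ.le]
    have : dist w b ≤ 16 * lb := by linarith
    nlinarith
  · rw [abs_le, hl', dist_comm a w]; constructor <;> linarith
  · rw [abs_le, hl']; constructor <;> linarith
  -- This estimate determines the constant 12: the displacements of `q` and `w` add up to `24τ ·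
  -- lb`, which is `12τ` times the intended length `2 · lb`.
  · rw [abs_le, hl']; constructor <;> linarith
  · rw [abs_le, hl', dist_comm b w]; constructor <;> linarith
  · rw [dist_lerp hτ.le]
    have : dist q w ≤ 8 * lb := by linarith
    nlinarith

/-- In the limit `w = q`, with `b` the midpoint of `aq`, and the scale of `w` is `2 * lb`. The
actual `w` is within `12τ · lb` of `q`, so it inherits the distances of `q` from `a` and `b`. -/
theorem IsScaled.insert_true {τ σ : ℝ} {a b q : Plane} {la lb : ℝ}
    (h : IsScaled τ σ a b q la lb true) (hb : 0 < lb) (hτ : 0 < τ) (hσ : 0 ≤ σ)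
    (hσ' : σ + 12 * τ ≤ 1) {w : Plane} (hw : w = insertPoint (1 - τ) a b q) :
    IsScaled τ (σ + 12 * τ) a b w la lb true ∧
    IsScaled τ (σ + 12 * τ) a w q la (2 * lb) false ∧
    IsScaled τ (σ + 12 * τ) w b (b + τ • (q - b)) (2 * lb) lb false := by
  obtain ⟨h1, h2, h3, h4⟩ := h
  set m := (1 / 2 : ℝ) • (a + b) with hm
  have hmb : dist m b = dist a b / 2 := by
    rw [hm, add_comm, dist_half_add_left, dist_comm]
  have hwq : dist w q = τ * dist m q := by
    rw [hw, insertPoint, ← hm, show m + (1 - τ) • (q - m) = q + τ • (m - q) by module,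
      dist_lerp hτ.le]
  have h5 := dist_triangle m b q
  rw [dist_comm b q] at h5
  rw [abs_le] at h2 h3 h4
  have hp : 0 < τ * lb := by positivity
  have hq1 : 0 ≤ σ * lb := by positivity
  have hq2 : σ * lb + 12 * (τ * lb) ≤ lb := by nlinarith
  have hwq' : dist w q ≤ 12 * (τ * lb) := by
    rw [hwq]
    have : dist m q ≤ 12 * lb := by linarith
    nlinarith
  have e1 := dist_triangle w q a
  have e2 := dist_triangle q w a
  have e3 := dist_triangle w q b
  have e4 := dist_triangle q w b
  rw [dist_comm q w] at e2 e4
  have hl : ∀ c : ℝ, (σ + 12 * τ) * (c * lb) = c * (σ * lb) + 12 * c * (τ * lb) := fun c => by ring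
  refine ⟨⟨h1, ?_, ?_, ?_⟩, ⟨by linarith, ?_, ?_⟩, ⟨by linarith, ?_, ?_⟩⟩
  · rw [abs_le, hl]; constructor <;> linarith
  · rw [abs_le, hl]; constructor <;> linarith
  · rw [abs_le, hl]; constructor <;> linarith
  · rw [abs_le, dist_comm a w]; constructor <;> linarith
  · rw [dist_comm q w]; linarith
  · rw [abs_le, hl]; constructor <;> linarith
  · rw [dist_lerp hτ.le]
    have : dist q b ≤ 8 * lb := by linarith
    nlinarith

/-- The length is about `4 * lb`, which is `2 * la` or `la` according to the type. With
`IsScaled.le_length` this puts it between one and four times the scale at either end, up to the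
error `σ`. -/
theorem IsScaled.length_le {τ σ : ℝ} {a b q : Plane} {la lb : ℝ} {k : Bool}
    (h : IsScaled τ σ a b q la lb k) (hb : 0 < lb) (hσ : 0 ≤ σ) :
    (1 + σ) * lb * 4 ≥ dist a b ∧ (1 + σ) * la * 4 ≥ dist a b := by
  have : 0 ≤ σ * lb := by positivity
  cases k
  · obtain ⟨rfl, h2, -⟩ := h
    rw [abs_le] at h2
    constructor <;> nlinarith
  · obtain ⟨rfl, h2, -⟩ := h
    rw [abs_le] at h2
    constructor <;> nlinarith

theorem IsScaled.le_length {τ σ : ℝ} {a b q : Plane} {la lb : ℝ} {k : Bool}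
    (h : IsScaled τ σ a b q la lb k) (hb : 0 < lb) (hσ : σ ≤ 1) :
    (1 - σ) * lb ≤ dist a b ∧ (1 - σ) * la ≤ dist a b := by
  have : 0 ≤ (1 - σ) * lb := mul_nonneg (by linarith) hb.le
  cases k
  · obtain ⟨rfl, h2, -⟩ := h
    rw [abs_le] at h2
    constructor <;> nlinarith
  · obtain ⟨rfl, h2, -⟩ := h
    rw [abs_le] at h2
    constructor <;> nlinarith

end Metric

/-! ### Drawings that can be extended, and the insertion of a vertex. -/

section Drawings

/-- The data kept for an edge `u v` in the construction of a drawing. -/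
structure EdgeData (V : Type*) where
  u : V
  v : V
  ext : Bool
  q : Plane

/-- The region of an edge. -/
def EdgeData.region {V : Type*} (r : EdgeData V) (f : V → Plane) : Set Plane :=
  openTriangle (f r.u) (f r.v) r.q

variable {V : Type*}

/-- A drawing of the subgraph induced by `s` to which vertices can be added. -/
structure Extensible (G : SimpleGraph V) (τ σ : ℝ) (s : Finset V) (f : V → Plane) (lam : V → ℝ)
    (D : Sym2 V → EdgeData V) : Prop where
  regions : PlanarRegions G s f fun e => (D e).region f
  ends : ∀ e ∈ edgesIn G s, s((D e).u, (D e).v) = e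
  nondegenerate : ∀ e ∈ edgesIn G s, Nondegenerate (f (D e).u) (f (D e).v) (D e).q
  scaled : ∀ e ∈ edgesIn G s,
    IsScaled τ σ (f (D e).u) (f (D e).v) (D e).q (lam (D e).u) (lam (D e).v) (D e).ext
  pos : ∀ x ∈ s, 0 < lam x

theorem Extensible.of_agree {G : SimpleGraph V} {τ σ : ℝ} {s : Finset V} {f : V → Plane}
    {lam : V → ℝ} {D : Sym2 V → EdgeData V} (h : Extensible G τ σ s f lam D) {u v : V}
    (he : s(u, v) ∈ edgesIn G s) : (D s(u, v)).u ∈ s ∧ (D s(u, v)).v ∈ s ∧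
      ((D s(u, v)).u = u ∧ (D s(u, v)).v = v ∨ (D s(u, v)).u = v ∧ (D s(u, v)).v = u) := by
  have h1 := Sym2.eq_iff.1 (h.ends _ he)
  obtain ⟨-, hu, hv⟩ := mk_mem_edgesIn.1 he
  rcases h1 with ⟨h1, h2⟩ | ⟨h1, h2⟩ <;> rw [h1, h2]
  · exact ⟨hu, hv, by simp⟩
  · exact ⟨hv, hu, by simp⟩

/-- The new data of the edge in whose region a vertex is inserted. -/
noncomputable def EdgeData.base (τ : ℝ) (r : EdgeData V) (b w : Plane) : EdgeData V :=
  ⟨r.u, r.v, r.ext, bif r.ext then w else b + τ • (w - b)⟩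

/-- The data of the new edge at the first end. -/
def EdgeData.left (r : EdgeData V) (w : V) : EdgeData V := ⟨r.u, w, !r.ext, r.q⟩

/-- The data of the new edge at the second end. -/
noncomputable def EdgeData.right (τ : ℝ) (r : EdgeData V) (b p : Plane) (w : V) : EdgeData V :=
  bif r.ext then ⟨w, r.v, false, b + τ • (r.q - b)⟩ else ⟨r.v, w, false, p + τ • (r.q - p)⟩

variable [DecidableEq V]

/-- Insertion of a vertex. -/
theorem Extensible.insert {G : SimpleGraph V} {τ σ : ℝ} {s : Finset V} {f : V → Plane}
    {lam : V → ℝ} {D : Sym2 V → EdgeData V} (h : Extensible G τ σ s f lam D) (hτ : 0 < τ)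
    (hσ : 0 ≤ σ) (hσ' : σ + 12 * τ ≤ 1) {r : EdgeData V} (hr : D s(r.u, r.v) = r)
    {w : V} (hu : r.u ∈ s) (hv : r.v ∈ s) (huv : G.Adj r.u r.v) (hw : w ∉ s)
    (hN : ∀ x ∈ s, G.Adj w x ↔ x = r.u ∨ x = r.v) {P : Plane}
    (hP : P = insertPoint (insertWeight τ r.ext) (f r.u) (f r.v) r.q)
    {D' : Sym2 V → EdgeData V} (h0 : D' s(r.u, r.v) = r.base τ (f r.v) P)
    (h1 : D' s(r.u, w) = r.left w) (h2 : D' s(r.v, w) = r.right τ (f r.v) P w)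
    (hD : ∀ e ∈ edgesIn G s, e ≠ s(r.u, r.v) → D' e = D e) :
    ∃ lam', Extensible G τ (σ + 12 * τ) (Insert.insert w s) (Function.update f w P) lam' D' := by
  obtain ⟨u, v, k, q⟩ := r
  dsimp only at *
  have he : s(u, v) ∈ edgesIn G s := mk_mem_edgesIn.2 ⟨huv, hu, hv⟩
  have hτ1 : τ < 1 := by linarith
  have hnd := h.nondegenerate _ he
  have hsc := h.scaled _ he
  rw [hr] at hnd hsc
  dsimp only at hnd hsc
  have hPm : P ∈ openTriangle (f u) (f v) q := by
    rw [hP]; exact insertPoint_mem (insertWeight_pos hτ hτ1 k) (insertWeight_lt hτ hτ1 k) _ _ _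
  have huw : u ≠ w := by rintro rfl; exact hw hu
  have hvw : v ≠ w := by rintro rfl; exact hw hv
  have hgs : ∀ x ∈ s, Function.update f w P x = f x := fun x hx => by
    rw [Function.update_of_ne (by rintro rfl; exact hw hx)]
  have hgw : Function.update f w P w = P := by simp
  have hgu := hgs u hu
  have hgv := hgs v hv
  have hold : ∀ e ∈ edgesIn G s, (D e).u ∈ s ∧ (D e).v ∈ s := by
    intro e he
    have h1 := h.ends e he
    have h2 := Sym2.mem_mk_left (D e).u (D e).v
    have h3 := Sym2.mem_mk_right (D e).u (D e).v
    rw [h1] at h2 h3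
    exact ⟨he.2 _ h2, he.2 _ h3⟩
  have hPuv := hnd.of_mem hPm
  have hPuq : Nondegenerate (f u) q P :=
    (hnd.rotate.rotate.swap).of_mem (by rwa [← openTriangle_rotate, openTriangle_swap])
  have hPvq : Nondegenerate (f v) q P := hnd.rotate.of_mem (by rwa [← openTriangle_rotate])
  have hlv := h.pos v hv
  -- The scale of the new vertex relative to that of `v`, as `IsScaled.insert_true` and
  -- `IsScaled.insert_false` demand.
  set c : ℝ := bif k then 2 else 1 / 2 with hc
  have hcpos : 0 < c := by cases k <;> simp [hc]
  have hls : ∀ x ∈ s, Function.update lam w (c * lam v) x = lam x := fun x hx => by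
    rw [Function.update_of_ne (by rintro rfl; exact hw hx)]
  have hlw : Function.update lam w (c * lam v) w = c * lam v := by simp
  have hlu' := hls u hu
  have hlv' := hls v hv
  -- the three affected edges
  have hthree : ∀ e, e = s(u, v) ∨ e = s(u, w) ∨ e = s(v, w) →
      s((D' e).u, (D' e).v) = e ∧
      Nondegenerate (Function.update f w P (D' e).u) (Function.update f w P (D' e).v) (D' e).q ∧
      IsScaled τ (σ + 12 * τ) (Function.update f w P (D' e).u) (Function.update f w P (D' e).v)
        (D' e).q (Function.update lam w (c * lam v) (D' e).u)
        (Function.update lam w (c * lam v) (D' e).v) (D' e).ext := by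
    cases k
    · obtain ⟨m0, m1, m2⟩ := hsc.insert_false hlv hτ hσ hσ' hP
      simp only [hc, cond_false] at hlw hlu' hlv' ⊢
      have hh : 1 / 2 * lam v = lam v / 2 := by ring
      simp only [hh] at hlw hlu' hlv' ⊢
      rintro e (rfl | rfl | rfl)
      · rw [h0]
        simp only [EdgeData.base, cond_false, hgu, hgv, hlu', hlv']
        exact ⟨trivial, hPuv.lerp hτ.ne', m0⟩
      · rw [h1]
        simp only [EdgeData.left, hgu, hgw, hlu', hlw, Bool.not_false]
        exact ⟨trivial, hPuq.rotate.rotate.swap, m1⟩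
      · rw [h2]
        simp only [EdgeData.right, cond_false, hgv, hgw, hlv', hlw]
        exact ⟨trivial, hPvq.rotate.rotate.swap.lerp hτ.ne', m2⟩
    · obtain ⟨m0, m1, m2⟩ := hsc.insert_true hlv hτ hσ hσ' hP
      simp only [hc, cond_true] at hlw hlu' hlv' ⊢
      rintro e (rfl | rfl | rfl)
      · rw [h0]
        simp only [EdgeData.base, cond_true, hgu, hgv, hlu', hlv']
        exact ⟨trivial, hPuv, m0⟩
      · rw [h1]
        simp only [EdgeData.left, hgu, hgw, hlu', hlw, Bool.not_true]
        exact ⟨trivial, hPuq.rotate.rotate.swap, m1⟩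
      · rw [h2]
        simp only [EdgeData.right, cond_true, hgv, hgw, hlv', hlw]
        exact ⟨Sym2.eq_swap, hPvq.rotate.rotate.lerp hτ.ne', m2⟩
  have cases3 : ∀ e ∈ edgesIn G (Insert.insert w s),
      (e ∈ edgesIn G s ∧ e ≠ s(u, v)) ∨ (e = s(u, v) ∨ e = s(u, w) ∨ e = s(v, w)) := by
    intro e he
    by_cases h3 : e = s(u, v)
    · exact Or.inr (Or.inl h3)
    · rcases (edgesIn_insert hu hv hN).1 he with h | h | h
      · exact Or.inl ⟨h, h3⟩
      · exact Or.inr (Or.inr (Or.inl h))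
      · exact Or.inr (Or.inr (Or.inr h))
  refine ⟨Function.update lam w (c * lam v), ?_, ?_, ?_, ?_, ?_⟩
  · refine h.regions.insert_of_triangle hu hv huv hw hN hnd ?_ hPm ?_ ?_ ?_ ?_
    · simp only [hr, EdgeData.region]
    · intro e he hne
      rw [hD e he hne, EdgeData.region, EdgeData.region, hgs _ (hold e he).1, hgs _ (hold e he).2]
    · simp only [h0, EdgeData.region, EdgeData.base, hgu, hgv]
      cases k
      · exact openTriangle_lerp_subset hτ hτ1.le
      · exact subset_rfl
    · simp only [h1, EdgeData.region, EdgeData.left, hgu, hgw]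
      rw [openTriangle_rotate, openTriangle_swap, openTriangle_rotate, openTriangle_rotate]
    · simp only [h2, EdgeData.region, EdgeData.right]
      cases k
      · simp only [cond_false, hgv, hgw]
        refine (openTriangle_lerp_subset hτ hτ1.le).trans_eq ?_
        rw [openTriangle_swap, ← openTriangle_rotate, openTriangle_swap, openTriangle_swap,
          ← openTriangle_rotate, openTriangle_swap]
      · simp only [cond_true, hgv, hgw]
        refine (openTriangle_lerp_subset hτ hτ1.le).trans_eq ?_
        rw [openTriangle_rotate]
  · intro e he
    rcases cases3 e he with ⟨h3, h4⟩ | h3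
    · rw [hD e h3 h4]; exact h.ends e h3
    · exact (hthree e h3).1
  · intro e he
    rcases cases3 e he with ⟨h3, h4⟩ | h3
    · rw [hD e h3 h4, hgs _ (hold e h3).1, hgs _ (hold e h3).2]; exact h.nondegenerate e h3
    · exact (hthree e h3).2.1
  · intro e he
    rcases cases3 e he with ⟨h3, h4⟩ | h3
    · rw [hD e h3 h4, hgs _ (hold e h3).1, hgs _ (hold e h3).2, hls _ (hold e h3).1,
        hls _ (hold e h3).2]
      exact (h.scaled e h3).mono (by linarith) (h.pos _ (hold e h3).2)
    · exact (hthree e h3).2.2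
  · intro x hx
    rcases Finset.mem_insert.1 hx with rfl | hx
    · rw [hlw]; positivity
    · rw [hls x hx]; exact h.pos x hx

/-- Insertion of a vertex, with the new data given as an update of the old. -/
theorem Extensible.insert_update {G : SimpleGraph V} {τ σ : ℝ} {s : Finset V} {f : V → Plane}
    {lam : V → ℝ} {D : Sym2 V → EdgeData V} (h : Extensible G τ σ s f lam D) (hτ : 0 < τ)
    (hσ : 0 ≤ σ) (hσ' : σ + 12 * τ ≤ 1) {a b w : V} (ha : a ∈ s) (hb : b ∈ s) (hab : G.Adj a b)
    (hw : w ∉ s) (hN : ∀ x ∈ s, G.Adj w x ↔ x = a ∨ x = b) {r : EdgeData V} (hr : D s(a, b) = r)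
    {P : Plane} (hP : P = insertPoint (insertWeight τ r.ext) (f r.u) (f r.v) r.q) :
    ∃ lam', Extensible G τ (σ + 12 * τ) (Insert.insert w s) (Function.update f w P) lam'
      (Function.update (Function.update (Function.update D s(a, b) (r.base τ (f r.v) P))
        s(r.u, w) (r.left w)) s(r.v, w) (r.right τ (f r.v) P w)) := by
  have he : s(a, b) ∈ edgesIn G s := mk_mem_edgesIn.2 ⟨hab, ha, hb⟩
  obtain ⟨hu, hv, huv⟩ := h.of_agree he
  have hends := h.ends _ he
  rw [hr] at hu hv huv hends
  have hadj : G.Adj r.u r.v := by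
    rw [← SimpleGraph.mem_edgeSet, hends]; exact hab
  have hN' : ∀ x ∈ s, G.Adj w x ↔ x = r.u ∨ x = r.v := by
    intro x hx
    rw [hN x hx]
    rcases huv with ⟨h1, h2⟩ | ⟨h1, h2⟩ <;> rw [h1, h2]
    exact or_comm
  have huw : r.u ≠ w := fun h1 => hw (h1 ▸ hu)
  have hvw : r.v ≠ w := fun h1 => hw (h1 ▸ hv)
  rw [← hends] at hr ⊢
  refine h.insert hτ hσ hσ' hr hu hv hadj hw hN' hP ?_ ?_ ?_ ?_
  · rw [Function.update_of_ne, Function.update_of_ne, Function.update_self]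
    · simp [huw, hvw]
    · simp [huw, hvw]
  · rw [Function.update_of_ne, Function.update_self]
    simp [huw, hadj.ne]
  · rw [Function.update_self]
  · intro e he hne
    have hwe : ∀ c, e ≠ s(c, w) := by
      rintro c rfl
      exact hw (mk_mem_edgesIn.1 he).2.2
    rw [Function.update_of_ne (hwe _), Function.update_of_ne (hwe _), Function.update_of_ne hne]

end Drawings

/-! ### The initial edge, and the bound for the local edge-length ratio. -/

section BaseAndResult

variable {V : Type*}

theorem edgesIn_pair [DecidableEq V] {G : SimpleGraph V} {y z : V} {e : Sym2 V}
    (he : e ∈ edgesIn G {y, z}) : e = s(y, z) := by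
  induction e using Sym2.ind with
  | _ a b =>
    obtain ⟨h, ha, hb⟩ := mk_mem_edgesIn.1 he
    simp only [Finset.mem_insert, Finset.mem_singleton] at ha hb
    rcases ha with rfl | rfl <;> rcases hb with rfl | rfl
    · exact absurd h G.irrefl
    · rfl
    · exact Sym2.eq_swap
    · exact absurd h G.irrefl

theorem nondegenerate_base {τ : ℝ} (hτ : 0 < τ) :
    Nondegenerate (!₂[0, 0] : Plane) !₂[1, 0] !₂[1, τ] := by
  intro α β γ h1 h2
  have e0 := congrArg (fun p : Plane => p 0) h2
  have e1 := congrArg (fun p : Plane => p 1) h2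
  simp at e0 e1
  rcases e1 with rfl | h
  · exact ⟨by linarith, by linarith, rfl⟩
  · exact absurd h hτ.ne'

/-- The drawing of a single edge. -/
theorem Extensible.base [DecidableEq V] {G : SimpleGraph V} {τ : ℝ} (hτ : 0 < τ) {y z : V}
    (hyz : G.Adj y z) {f : V → Plane} (hy : f y = !₂[0, 0]) (hz : f z = !₂[1, 0])
    {D : Sym2 V → EdgeData V} (hD : D s(y, z) = ⟨y, z, false, !₂[1, τ]⟩) :
    ∃ lam, Extensible G τ 0 {y, z} f lam D := by
  have hnd := nondegenerate_base hτ
  have hne := hyz.ne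
  have hdyz : dist (f y) (f z) = 1 := by
    rw [hy, hz, EuclideanSpace.dist_eq]
    simp [Fin.sum_univ_two, Real.dist_eq]
  have hdq : dist (!₂[1, τ] : Plane) (f z) = τ := by
    rw [hz, EuclideanSpace.dist_eq]
    simp [Fin.sum_univ_two, Real.dist_eq, Real.sqrt_sq hτ.le]
  have hfne : f y ≠ f z := by
    rw [← dist_pos, hdyz]; norm_num
  have hreg : Disjoint ((D s(y, z)).region f) (edgeSegment f s(y, z)) := by
    rw [hD, edgeSegment_mk]
    change Disjoint (openTriangle (f y) (f z) !₂[1, τ]) _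
    rw [hy, hz, openTriangle_rotate, openTriangle_rotate, openTriangle_swap]
    exact disjoint_openTriangle_side hnd.rotate.rotate.swap
  -- The unit edge is of the first type exactly: its length is four times the scale of `z` and twice
  -- that of `y`. The apex may be `4τ` away from `z` and is `τ` away.
  refine ⟨fun x => if x = z then 1 / 4 else 1 / 2, ⟨?_, ?_, ?_, ?_, ?_, ?_⟩, ?_, ?_, ?_, ?_⟩
  · intro a ha b hb hab
    simp only [Finset.coe_insert, Finset.coe_singleton, Set.mem_insert_iff,
      Set.mem_singleton_iff] at ha hb
    rcases ha with rfl | rfl <;> rcases hb with rfl | rfl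
    · rfl
    · exact absurd hab hfne
    · exact absurd hab hfne.symm
    · rfl
  · intro e he x hx _
    rw [edgesIn_pair he]
    simpa using hx
  · intro e he e' he' h
    exact absurd ((edgesIn_pair he).trans (edgesIn_pair he').symm) h
  · intro e he e' he' h
    exact absurd ((edgesIn_pair he).trans (edgesIn_pair he').symm) h
  · intro e he e' he'
    rw [edgesIn_pair he, edgesIn_pair he']
    exact hreg
  · intro e he x hx hxe
    rw [edgesIn_pair he] at hxe
    refine Set.disjoint_left.1 hreg hxe ?_
    rw [edgeSegment_mk]
    simp only [Finset.mem_insert, Finset.mem_singleton] at hx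
    rcases hx with rfl | rfl
    · exact left_mem_segment ℝ _ _
    · exact right_mem_segment ℝ _ _
  · intro e he
    rw [edgesIn_pair he, hD]
  · intro e he
    rw [edgesIn_pair he, hD, hy, hz]
    exact hnd
  · intro e he
    rw [edgesIn_pair he, hD]
    refine ⟨?_, ?_, ?_⟩
    · simp [hne]; norm_num
    · simp [hdyz]
    · simp [hdq]; linarith
  · intro x _
    split_ifs <;> norm_num

variable {W : Type*} {G : SimpleGraph V} {H : SimpleGraph W} {τ σ : ℝ} {s : Finset W}
  {f : W → Plane} {lam : W → ℝ} {D : Sym2 W → EdgeData W}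

/-- The embedding `i` serves the algorithm, whose vertices are natural numbers in memory; for the
bound on the ratio it is the identity. -/
theorem Extensible.isPlanarDrawing (h : Extensible H τ σ s f lam D) (i : V ↪ W)
    (hs : ∀ x, i x ∈ s) (hG : ∀ x y, G.Adj x y → H.Adj (i x) (i y)) :
    IsPlanarDrawing G fun x => f (i x) := by
  have he : ∀ u v, G.Adj u v → s(i u, i v) ∈ edgesIn H s := fun u v huv =>
    mk_mem_edgesIn.2 ⟨hG u v huv, hs u, hs v⟩
  refine ⟨?_, ?_, ?_⟩
  · intro x y hxy
    exact i.injective (h.regions.injOn (hs x) (hs y) hxy)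
  · intro u v w huv hw
    simpa using h.regions.vertex_edge _ (he u v huv) (i w) (hs w) hw
  · rintro u v x y huv hxy hne p ⟨hp, hp'⟩
    have hne' : s(i u, i v) ≠ s(i x, i y) := fun h1 =>
      hne (Sym2.map.injective i.injective (by simpa using h1))
    obtain ⟨z, hz, hz', rfl⟩ := h.regions.edge_edge _ (he u v huv) _ (he x y hxy) hne' p hp hp'
    rw [Sym2.mem_iff] at hz hz'
    rcases hz with rfl | rfl
    · exact ⟨u, Or.inl rfl, by simpa using hz', rfl⟩
    · exact ⟨v, Or.inr rfl, by simpa using hz', rfl⟩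

theorem Extensible.length_bounds (h : Extensible H τ σ s f lam D) (hσ : 0 ≤ σ) (hσ1 : σ ≤ 1)
    {u v : W} (hu : u ∈ s) (hv : v ∈ s) (huv : H.Adj u v) :
    dist (f u) (f v) ≤ (1 + σ) * lam v * 4 ∧ (1 - σ) * lam v ≤ dist (f u) (f v) := by
  have he : s(u, v) ∈ edgesIn H s := mk_mem_edgesIn.2 ⟨huv, hu, hv⟩
  have hsc := h.scaled _ he
  obtain ⟨-, h2, h3⟩ := h.of_agree he
  have hp := h.pos _ h2
  obtain ⟨a1, a2⟩ := hsc.length_le hp hσ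
  obtain ⟨b1, b2⟩ := hsc.le_length hp hσ1
  rcases h3 with ⟨h3, h4⟩ | ⟨h3, h4⟩
  · rw [h3, h4] at a1 b1
    exact ⟨a1, b1⟩
  · rw [h3, h4] at a2 b2
    rw [dist_comm]
    exact ⟨a2, b2⟩

/-- Edges that share a vertex are compared through the scale of that vertex, so their ratio is at
most `4(1 + σ) / (1 - σ)`. The condition `hσ'` says precisely that this is at most `4 + ε`. -/
theorem Extensible.drawingLocalRatio_le (h : Extensible H τ σ s f lam D) (i : V ↪ W)
    (hs : ∀ x, i x ∈ s) (hG : ∀ x y, G.Adj x y → H.Adj (i x) (i y)) {ε : ℝ} (hε : 0 < ε)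
    (hσ : 0 ≤ σ) (hσ' : σ * (8 + ε) ≤ ε) :
    drawingLocalRatio G (fun x => f (i x)) ≤ ENNReal.ofReal (4 + ε) := by
  have hσ1 : σ < 1 := by
    by_contra h1
    push Not at h1
    nlinarith
  refine iSup_le fun u => iSup_le fun v => iSup_le fun w => iSup_le fun huv => iSup_le fun hvw => ?_
  refine ENNReal.ofReal_le_ofReal ?_
  have hl := h.pos _ (hs v)
  obtain ⟨h1, -⟩ := h.length_bounds hσ hσ1.le (hs u) (hs v) (hG u v huv)
  obtain ⟨-, h2⟩ := h.length_bounds hσ hσ1.le (hs w) (hs v) (hG w v hvw.symm)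
  rw [dist_comm (f (i v)) (f (i w))]
  have h3 : 0 < (1 - σ) * lam (i v) := mul_pos (by linarith) hl
  rw [div_le_iff₀ (h3.trans_le h2)]
  calc dist (f (i u)) (f (i v)) ≤ (1 + σ) * 4 * lam (i v) := by linarith
    _ ≤ (4 + ε) * (1 - σ) * lam (i v) := by
      refine mul_le_mul_of_nonneg_right ?_ hl.le
      linarith
    _ ≤ (4 + ε) * dist (f (i w)) (f (i v)) := by
      rw [mul_assoc]
      exact mul_le_mul_of_nonneg_left h2 (by linarith)

/-- The initial edge is drawn without error, and each of the `s.card - 2` further vertices costs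
`12τ`. -/
theorem InducesTwoTree.exists_extensible [DecidableEq V] {s : Finset V}
    (h : InducesTwoTree G s) (hτ : 0 < τ) (hτs : 12 * τ * s.card ≤ 1) :
    ∃ f lam D, Extensible G τ (12 * τ * (s.card - 2)) s f lam D := by
  induction h with
  | edge u v h =>
    obtain ⟨lam, hl⟩ := Extensible.base hτ h (f := fun x => if x = u then !₂[0, 0] else !₂[1, 0])
      (by simp) (by simp [h.ne']) (D := fun _ => ⟨u, v, false, !₂[1, τ]⟩) rfl
    have h0 : 12 * τ * ((({u, v} : Finset V).card : ℝ) - 2) = 0 := by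
      rw [Finset.card_pair h.ne]; norm_num
    exact ⟨_, lam, _, h0.symm ▸ hl⟩
  | simplicial s a b w hs ha hb hab hw hN ih =>
    rw [Finset.card_insert_of_notMem hw] at hτs ⊢
    push_cast at hτs ⊢
    have h2 : (2 : ℝ) ≤ s.card := by exact_mod_cast hs.two_le_card
    obtain ⟨f, lam, D, h⟩ := ih (by linarith)
    have hσ : 0 ≤ 12 * τ * ((s.card : ℝ) - 2) := mul_nonneg (by linarith) (by linarith)
    obtain ⟨lam', h'⟩ := h.insert_update hτ hσ (by linarith) ha hb hab hw hN rfl rfl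
    have hstep : 12 * τ * ((s.card : ℝ) + 1 - 2) = 12 * τ * ((s.card : ℝ) - 2) + 12 * τ := by ring
    exact ⟨_, lam', _, hstep.symm ▸ h'⟩

theorem IsTwoTree.localEdgeLengthRatio_le [Fintype V] [DecidableEq V] (h : IsTwoTree G) :
    localEdgeLengthRatio G ≤ 4 := by
  have hn : (2 : ℝ) ≤ (Finset.univ : Finset V).card := by exact_mod_cast h.two_le_card
  set n : ℝ := ((Finset.univ : Finset V).card : ℝ) with hn'
  have key : ∀ ε : ℝ, 0 < ε → localEdgeLengthRatio G ≤ ENNReal.ofReal (4 + ε) := by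
    intro ε hε
    have hpos : 0 < 12 * n * (8 + ε) := by positivity
    -- Chosen so that `12τn = ε / (8 + ε)`, the largest error that the ratio `4 + ε` tolerates.
    set τ := ε / (12 * n * (8 + ε)) with hτ
    have hτ0 : 0 < τ := by positivity
    have hτ1 : 12 * τ * n * (8 + ε) = ε := by rw [hτ]; field_simp
    have hτ2 : 12 * τ * n ≤ 1 := by
      have : 0 < 12 * τ * n := by positivity
      nlinarith
    obtain ⟨f, lam, D, hE⟩ := InducesTwoTree.exists_extensible h hτ0 hτ2
    refine (iInf₂_le f (hE.isPlanarDrawing (.refl V) (fun x => Finset.mem_univ x)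
      fun x y h => h)).trans ?_
    refine hE.drawingLocalRatio_le (.refl V) (fun x => Finset.mem_univ x) (fun x y h => h) hε ?_ ?_
    · exact mul_nonneg (by linarith) (by linarith)
    · rw [← hn']
      calc _ ≤ 12 * τ * n * (8 + ε) := by gcongr; linarith
        _ ≤ _ := hτ1.le
  refine ENNReal.le_of_forall_pos_le_add fun ε hε _ => ?_
  refine (key ε (by exact_mod_cast hε)).trans ?_
  rw [ENNReal.ofReal_add (by norm_num) (by positivity)]
  simp

end BaseAndResult

/-! ### Reasoning about programs and their running time. -/

namespace RealRAM

/-- A straight-line program. -/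
def block : List Instr → Program
  | [] => .nop
  | i :: l => .seq (.instr i) (block l)

/-- The effect of a straight-line program. -/
noncomputable def exec : List Instr → Store → Store
  | [], s => s
  | i :: l, s => exec l (i.apply s)

/-- The extra step is the `nop` that ends each block. -/
theorem runs_block : ∀ (l : List Instr) (s : Store), Runs (block l) s (l.length + 1) (exec l s)
  | [], s => Runs.nop s
  | i :: l, s => by
    rw [List.length_cons, show l.length + 1 + 1 = 1 + (l.length + 1) by ring]
    exact Runs.seq (Runs.instr i s) (runs_block l (i.apply s))

/-- Started in `s`, the program `p` halts after at most `B` steps in a store that satisfies `Q`. -/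
def Ensures (p : Program) (s : Store) (B : ℕ) (Q : Store → Prop) : Prop :=
  ∃ t s', Runs p s t s' ∧ t ≤ B ∧ Q s'

theorem Ensures.mono {p : Program} {s : Store} {B B' : ℕ} {Q Q' : Store → Prop}
    (h : Ensures p s B Q) (hB : B ≤ B') (hQ : ∀ s, Q s → Q' s) : Ensures p s B' Q' := by
  obtain ⟨t, s', h1, h2, h3⟩ := h
  exact ⟨t, s', h1, h2.trans hB, hQ _ h3⟩

theorem Ensures.block {l : List Instr} {s : Store} {Q : Store → Prop} (h : Q (exec l s)) :
    Ensures (block l) s (l.length + 1) Q :=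
  ⟨_, _, runs_block l s, le_rfl, h⟩

theorem Ensures.seq {p q : Program} {s : Store} {B B' : ℕ} {Q Q' : Store → Prop}
    (h : Ensures p s B Q) (h' : ∀ s', Q s' → Ensures q s' B' Q') :
    Ensures (.seq p q) s (B + B') Q' := by
  obtain ⟨t, s', h1, h2, h3⟩ := h
  obtain ⟨t', s'', h1', h2', h3'⟩ := h' s' h3
  exact ⟨_, _, Runs.seq h1 h1', by omega, h3'⟩

theorem Ensures.block_seq {l : List Instr} {q : Program} {s : Store} {B : ℕ} {Q : Store → Prop}
    (h : Ensures q (exec l s) B Q) : Ensures (.seq (RealRAM.block l) q) s (l.length + 1 + B) Q :=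
  Ensures.seq (Q := fun s' => s' = exec l s) (Ensures.block rfl) (by rintro _ rfl; exact h)

theorem Ensures.cond {T : Test} {p q : Program} {s : Store} {B : ℕ} {Q : Store → Prop}
    (h : T.Holds s → Ensures p s B Q) (h' : ¬ T.Holds s → Ensures q s B Q) :
    Ensures (.cond T p q) s (1 + B) Q := by
  by_cases hT : T.Holds s
  · obtain ⟨t, s', h1, h2, h3⟩ := h hT
    exact ⟨_, _, Runs.cond_true hT h1, by omega, h3⟩
  · obtain ⟨t, s', h1, h2, h3⟩ := h' hT
    exact ⟨_, _, Runs.cond_false hT h1, by omega, h3⟩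

/-- The rule for loops with a potential `Φ` that pays for the iterations. -/
theorem Ensures.loop {T : Test} {p : Program} {α : Type*} (I : α → Store → Prop) (Φ : α → ℕ)
    (step : ∀ a s, I a s → T.Holds s → ∃ a' B, B + 1 + Φ a' ≤ Φ a ∧ Ensures p s B (I a')) :
    ∀ a s, I a s → Ensures (.loop T p) s (Φ a + 1) fun s' => ∃ a', I a' s' ∧ ¬ T.Holds s' := by
  -- Induction on a bound for the potential. An iteration costs at least its test, so the potential
  -- decreases strictly and termination comes with the time bound.
  suffices h : ∀ m a s, Φ a ≤ m → I a s →
      Ensures (.loop T p) s (Φ a + 1) fun s' => ∃ a', I a' s' ∧ ¬ T.Holds s' from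
    fun a s => h (Φ a) a s le_rfl
  intro m
  induction m with
  | zero =>
    intro a s hm hI
    by_cases hT : T.Holds s
    · obtain ⟨a', B, h1, -⟩ := step a s hI hT
      omega
    · exact ⟨_, _, Runs.loop_false hT, by omega, a, hI, hT⟩
  | succ m ih =>
    intro a s hm hI
    by_cases hT : T.Holds s
    · obtain ⟨a', B, h1, t, s', h2, h3, h4⟩ := step a s hI hT
      obtain ⟨t', s'', h5, h6, h7⟩ := ih a' s' (by omega) h4
      exact ⟨_, _, Runs.loop_true hT h2 h5, by omega, h7⟩
    · exact ⟨_, _, Runs.loop_false hT, by omega, a, hI, hT⟩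

/-! ### Adjacency lists as arrays of numbers. -/

/-- Adjacency lists of a graph whose vertices are the numbers below `n`. -/
structure ListsFor (n : ℕ) (H : SimpleGraph ℕ) (off tgt : ℕ → ℕ) : Prop where
  off_zero : off 0 = 0
  off_le : ∀ v < n, off v ≤ off (v + 1)
  inj : ∀ v < n, Set.InjOn tgt (Set.Ico (off v) (off (v + 1)))
  adj : ∀ v < n, ∀ w, H.Adj v w ↔ ∃ j, off v ≤ j ∧ j < off (v + 1) ∧ tgt j = w
  lt : ∀ v w, H.Adj v w → v < n

/-- Memory cells contain natural numbers, so the graph is transported to `ℕ`, where the numbers from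
`n` on are isolated vertices. -/
theorem AdjacencyLists.listsFor {n : ℕ} {G : SimpleGraph (Fin n)} (A : AdjacencyLists G) :
    ListsFor n (G.map Fin.valEmbedding) A.offset A.target where
  off_zero := A.offset_zero
  off_le := A.offset_le
  inj := A.target_injOn
  adj := by
    intro v hv w
    have h := Set.ext_iff.1 (A.target_image ⟨v, hv⟩) w
    simp only [Set.mem_image, Set.mem_Ico, Set.mem_ofPred_eq] at h
    rw [SimpleGraph.map_adj]
    constructor
    · rintro ⟨a, b, hab, rfl, rfl⟩
      obtain ⟨j, hj, hjb⟩ := h.2 ⟨b, hab, rfl⟩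
      exact ⟨j, hj.1, hj.2, hjb⟩
    · rintro ⟨j, hj1, hj2, hj3⟩
      obtain ⟨u, hu, huw⟩ := h.1 ⟨j, ⟨hj1, hj2⟩, hj3⟩
      exact ⟨⟨v, hv⟩, u, hu, rfl, huw⟩
  lt := by
    rintro v w h
    obtain ⟨a, b, -, rfl, -⟩ := (SimpleGraph.map_adj _ _ _ _).1 h
    exact a.2

section Lists

variable {n : ℕ} {H : SimpleGraph ℕ} {off tgt : ℕ → ℕ}

theorem ListsFor.mono (L : ListsFor n H off tgt) {v w : ℕ} (hvw : v ≤ w) (hw : w ≤ n) :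
    off v ≤ off w := by
  induction w, hvw using Nat.le_induction with
  | base => exact le_rfl
  | succ w hvw ih => exact (ih (by omega)).trans (L.off_le w (by omega))

/-- A position belongs to the list of one vertex only. -/
theorem ListsFor.owner_unique (L : ListsFor n H off tgt) {v w j : ℕ} (hv : v < n) (hw : w < n)
    (h1 : off v ≤ j) (h2 : j < off (v + 1)) (h3 : off w ≤ j) (h4 : j < off (w + 1)) : v = w := by
  rcases lt_trichotomy v w with h | h | h
  · have := L.mono (show v + 1 ≤ w by omega) (by omega)
    omega
  · exact h
  · have := L.mono (show w + 1 ≤ v by omega) (by omega)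
    omega

theorem ListsFor.target_lt (L : ListsFor n H off tgt) {v j : ℕ} (hv : v < n) (h1 : off v ≤ j)
    (h2 : j < off (v + 1)) : H.Adj v (tgt j) ∧ tgt j < n := by
  have h := (L.adj v hv (tgt j)).2 ⟨j, h1, h2, rfl⟩
  exact ⟨h, L.lt _ _ h.symm⟩

/-- The number of positions with target in `R` is the degree into `R`. -/
theorem ListsFor.card_filter (L : ListsFor n H off tgt) {v : ℕ} (hv : v < n) (R : Finset ℕ) :
    ((Finset.Ico (off v) (off (v + 1))).filter fun j => tgt j ∈ R).card =
      (nbrsIn H R v).card := by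
  refine Finset.card_bij (fun j _ => tgt j) ?_ ?_ ?_
  · intro j hj
    rw [Finset.mem_filter, Finset.mem_Ico] at hj
    exact mem_nbrsIn.2 ⟨hj.2, (L.target_lt hv hj.1.1 hj.1.2).1⟩
  · intro i hi j hj hij
    rw [Finset.mem_filter, Finset.mem_Ico] at hi hj
    exact L.inj v hv hi.1 hj.1 hij
  · intro x hx
    obtain ⟨h1, h2⟩ := mem_nbrsIn.1 hx
    obtain ⟨j, h3, h4, rfl⟩ := (L.adj v hv x).1 h2
    exact ⟨j, Finset.mem_filter.2 ⟨Finset.mem_Ico.2 ⟨h3, h4⟩, h1⟩, rfl⟩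

theorem ListsFor.card_nbrsIn_range (L : ListsFor n H off tgt) {v : ℕ} (hv : v < n) :
    (nbrsIn H (Finset.range n) v).card = off (v + 1) - off v := by
  rw [← L.card_filter hv, Finset.filter_true_of_mem, Nat.card_Ico]
  intro j hj
  rw [Finset.mem_Ico] at hj
  exact Finset.mem_range.2 (L.target_lt hv hj.1 hj.2).2

theorem ListsFor.sum_len (L : ListsFor n H off tgt) :
    ∑ v ∈ Finset.range n, (off (v + 1) - off v) = off n := by
  suffices h : ∀ m ≤ n, ∑ v ∈ Finset.range m, (off (v + 1) - off v) = off m from h n le_rfl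
  intro m
  induction m with
  | zero => intro; simp [L.off_zero]
  | succ m ih =>
    intro hm
    rw [Finset.sum_range_succ, ih (by omega)]
    have := L.off_le m (by omega)
    omega

theorem ListsFor.off_le_four_mul (L : ListsFor n H off tgt)
    (hH : InducesTwoTree H (Finset.range n)) : off n ≤ 4 * n := by
  have h := hH.sum_card_nbrsIn_le
  rw [Finset.card_range] at h
  rw [← L.sum_len]
  refine le_trans (le_of_eq ?_) h
  exact Finset.sum_congr rfl fun v hv => (L.card_nbrsIn_range (Finset.mem_range.1 hv)).symm

end Lists

/-- The part of the memory that holds the input. -/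
def HoldsInput (n : ℕ) (off tgt : ℕ → ℕ) (ε : ℝ) (s : Store) : Prop :=
  s.ireg 0 = n ∧ s.iarr 0 = off ∧ s.iarr 1 = tgt ∧ s.rreg 0 = ε

/-! ### Computation of the degrees and of the initial queue. -/

section Degrees

/-- Count the length of the current list, that of vertex number `ireg 1`. -/
def countLoop : Program := .loop (.intLt 2 4) (block [.intSucc 5, .intSucc 2])

/-- Compute all degrees, and collect the vertices of degree less than three in array `3`. -/
def degreeBody : Program :=
  .seq (block [.intCopy 7 1, .intSucc 7, .intLoad 4 0 7, .intConst 5 0])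
  (.seq countLoop
  (.seq (block [.intStore 2 1 5])
  (.seq (.cond (.intLt 5 6) (block [.intStore 3 3 1, .intSucc 3]) (block []))
    (block [.intSucc 1]))))

def degreePhase : Program :=
  .seq (block [.intConst 1 0, .intConst 2 0, .intConst 3 0, .intConst 6 3])
    (.loop (.intLt 1 0) degreeBody)

/-- The array `ord` lists the vertices in `S`, each once, at positions below `tail`. -/
def Enumerates (ord : ℕ → ℕ) (lo tail : ℕ) (S : Set ℕ) : Prop :=
  lo ≤ tail ∧ Set.BijOn ord (Set.Ico lo tail) S

theorem Enumerates.push {ord : ℕ → ℕ} {lo tail : ℕ} {S : Set ℕ} (h : Enumerates ord lo tail S)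
    {u : ℕ} (hu : u ∉ S) : Enumerates (Function.update ord tail u) lo (tail + 1) (insert u S) := by
  obtain ⟨h0, h1, h2, h3⟩ := h
  have he : ∀ k ∈ Set.Ico lo tail, Function.update ord tail u k = ord k := fun k hk =>
    Function.update_of_ne (ne_of_lt hk.2) _ _
  have hc : ∀ k ∈ Set.Ico lo (tail + 1), k ∈ Set.Ico lo tail ∨ k = tail := by
    intro k hk
    rcases Nat.lt_succ_iff_lt_or_eq.1 hk.2 with h | h
    · exact Or.inl ⟨hk.1, h⟩
    · exact Or.inr h
  refine ⟨by omega, ?_, ?_, ?_⟩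
  · intro k hk
    rcases hc k hk with hk | rfl
    · rw [he k hk]; exact Or.inr (h1 hk)
    · rw [Function.update_self]; exact Or.inl rfl
  · intro k hk l hl hkl
    rcases hc k hk with hk | rfl <;> rcases hc l hl with hl | rfl
    · rw [he k hk, he l hl] at hkl; exact h2 hk hl hkl
    · rw [he k hk, Function.update_self] at hkl; exact absurd (hkl ▸ h1 hk) hu
    · rw [he l hl, Function.update_self] at hkl; exact absurd (hkl ▸ h1 hl) hu
    · rfl
  · rintro x (rfl | hx)
    · exact ⟨tail, ⟨h0, by omega⟩, Function.update_self _ _ _⟩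
    · obtain ⟨k, hk, rfl⟩ := h3 hx
      exact ⟨k, ⟨hk.1, by have := hk.2; omega⟩, he k hk⟩

/-- Integers cannot be subtracted by the machine, so a degree is counted by walking through the
list. Register 2 ends at the beginning of the next list and need not be reloaded. -/
theorem countLoop_ensures (s : Store) (h : s.ireg 2 ≤ s.ireg 4) (h5 : s.ireg 5 = 0) :
    Ensures countLoop s (4 * (s.ireg 4 - s.ireg 2) + 1) fun s' =>
      s'.iarr = s.iarr ∧ s'.rreg = s.rreg ∧ s'.ireg 2 = s.ireg 4 ∧
      s'.ireg 5 = s.ireg 4 - s.ireg 2 ∧ s'.ireg 0 = s.ireg 0 ∧ s'.ireg 1 = s.ireg 1 ∧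
      s'.ireg 3 = s.ireg 3 ∧ s'.ireg 6 = s.ireg 6 := by
  refine (Ensures.loop (fun (a : ℕ) s' => s'.iarr = s.iarr ∧ s'.rreg = s.rreg ∧
    s'.ireg 2 + a = s.ireg 4 ∧ s'.ireg 5 + a = s.ireg 4 - s.ireg 2 ∧ s'.ireg 0 = s.ireg 0 ∧
    s'.ireg 1 = s.ireg 1 ∧ s'.ireg 3 = s.ireg 3 ∧ s'.ireg 6 = s.ireg 6 ∧ s'.ireg 4 = s.ireg 4)
    (fun a => 4 * a) ?_ (s.ireg 4 - s.ireg 2) s ?_).mono le_rfl ?_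
  · rintro a s' ⟨h1, h2, h3, h4, h5, h6, h7, h8, h9⟩ hT
    simp only [Test.Holds] at hT
    refine ⟨a - 1, 3, by omega, Ensures.block ?_⟩
    simp [exec, Instr.apply, Store.setI, *]
    omega
  · simp [h5]; omega
  · rintro s' ⟨a, ⟨h1, h2, h3, h4, h5, h6, h7, h8, h9⟩, hT⟩
    simp only [Test.Holds] at hT
    refine ⟨h1, h2, ?_, ?_, h5, h6, h7, h8⟩ <;> omega

theorem degreePhase_ensures {n : ℕ} {H : SimpleGraph ℕ} {off tgt : ℕ → ℕ}
    (L : ListsFor n H off tgt) {ε : ℝ} {s : Store} (hs : HoldsInput n off tgt ε s) :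
    Ensures degreePhase s (20 * n + 4 * off n + 6) fun s' => HoldsInput n off tgt ε s' ∧
      (∀ x < n, s'.iarr 2 x = off (x + 1) - off x) ∧
      Enumerates (s'.iarr 3) 0 (s'.ireg 3) {x | x < n ∧ off (x + 1) - off x < 3} := by
  obtain ⟨i1, i2, i3, i4⟩ := hs
  have main := Ensures.loop (T := .intLt 1 0) (p := degreeBody)
    (fun (v : ℕ) s' => HoldsInput n off tgt ε s' ∧ v ≤ n ∧ s'.ireg 1 = v ∧ s'.ireg 2 = off v ∧
      s'.ireg 6 = 3 ∧ (∀ x < v, s'.iarr 2 x = off (x + 1) - off x) ∧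
      Enumerates (s'.iarr 3) 0 (s'.ireg 3) {x | x < v ∧ off (x + 1) - off x < 3})
    -- The potential: a constant for every vertex left, and for every list entry left the cost of
    -- one round of `countLoop`.
    (fun v => 20 * (n - v) + 4 * (off n - off v)) (by
    rintro v s' ⟨⟨h0, h1, h2, h3⟩, h4, h5, h6, h7, h8, h9⟩ hT
    simp only [Test.Holds, h0, h5] at hT
    have hle := L.off_le v hT
    have hle' := L.mono (show v + 1 ≤ n from hT) le_rfl
    refine ⟨v + 1, 5 + (4 * (off (v + 1) - off v) + 1 + (2 + (1 + 3 + 2))), by omega, ?_⟩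
    refine Ensures.block_seq ?_
    set s₁ := exec [.intCopy 7 1, .intSucc 7, .intLoad 4 0 7, .intConst 5 0] s' with hs₁
    have a0 : s₁.iarr = s'.iarr := by simp [hs₁, exec, Instr.apply, Store.setI]
    have a1 : s₁.rreg = s'.rreg := by simp [hs₁, exec, Instr.apply, Store.setI]
    have a2 : s₁.ireg 0 = n ∧ s₁.ireg 1 = v ∧ s₁.ireg 2 = off v ∧ s₁.ireg 3 = s'.ireg 3 ∧
        s₁.ireg 4 = off (v + 1) ∧ s₁.ireg 5 = 0 ∧ s₁.ireg 6 = 3 := by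
      simp [exec, Instr.apply, Store.setI, *]
    obtain ⟨a2, a3, a4, a5, a6, a7, a8⟩ := a2
    have hc := countLoop_ensures s₁ (by omega) a7
    rw [a6, a4] at hc
    refine hc.seq ?_
    rintro s₂ ⟨b0, b1, b2, b3, b4, b5, b6, b7⟩
    rw [a0] at b0
    rw [a1] at b1
    rw [a2] at b4
    rw [a3] at b5
    rw [a5] at b6
    rw [a8] at b7
    refine Ensures.block_seq ?_
    set s₃ := exec [.intStore 2 1 5] s₂ with hs₃
    have c0 : s₃.ireg = s₂.ireg := by simp [hs₃, exec, Instr.apply]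
    have c1 : s₃.rreg 0 = ε := by simp [hs₃, exec, Instr.apply, b1, h3]
    have c2 : s₃.iarr 0 = off ∧ s₃.iarr 1 = tgt ∧ s₃.iarr 3 = s'.iarr 3 := by
      simp [exec, Instr.apply, *]
    obtain ⟨c2, c3, c4⟩ := c2
    have c5 : ∀ x < v + 1, s₃.iarr 2 x = off (x + 1) - off x := by
      intro x hx
      simp only [hs₃, exec, Instr.apply, Function.update_self, b0, b5, b3]
      by_cases h : x = v
      · subst h; simp
      · rw [Function.update_of_ne h]; exact h8 x (by omega)
    have d1 : s₃.ireg 5 = off (v + 1) - off v := by rw [c0, b3]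
    have d2 : s₃.ireg 6 = 3 := by rw [c0, b7]
    have d3 : s₃.ireg 1 = v := by rw [c0, b5]
    have d4 : s₃.ireg 3 = s'.ireg 3 := by rw [c0, b6]
    have d5 : s₃.ireg 0 = n := by rw [c0, b4]
    have d6 : s₃.ireg 2 = off (v + 1) := by rw [c0, b2]
    refine Ensures.seq (Q := fun s₄ => (s₄.ireg 0 = n ∧ s₄.ireg 1 = v ∧ s₄.ireg 2 = off (v + 1) ∧
      s₄.ireg 6 = 3) ∧ s₄.rreg 0 = ε ∧ (s₄.iarr 0 = off ∧ s₄.iarr 1 = tgt) ∧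
      (∀ x < v + 1, s₄.iarr 2 x = off (x + 1) - off x) ∧
      Enumerates (s₄.iarr 3) 0 (s₄.ireg 3) {x | x < v + 1 ∧ off (x + 1) - off x < 3})
      (Ensures.cond ?_ ?_) ?_
    · intro hT
      simp only [Test.Holds, d1, d2] at hT
      refine Ensures.block ?_
      refine ⟨?_, ?_, ?_, ?_, ?_⟩
      · simp [exec, Instr.apply, Store.setI, *]
      · simp [exec, Instr.apply, Store.setI, c1]
      · simp [exec, Instr.apply, Store.setI, c2, c3]
      · simpa [exec, Instr.apply, Store.setI] using c5
      · have hp := h9.push (u := v) (by simp)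
        simp only [exec, Instr.apply, Store.setI, Function.update_self, d3, d4, c4]
        convert hp using 1
        ext x
        simp only [Set.mem_ofPred_eq, Set.mem_insert_iff]
        constructor
        · rintro ⟨h1, h2⟩
          by_cases h : x = v
          · exact Or.inl h
          · exact Or.inr ⟨by omega, h2⟩
        · rintro (rfl | ⟨h1, h2⟩)
          · exact ⟨by omega, hT⟩
          · exact ⟨by omega, h2⟩
    · intro hT
      simp only [Test.Holds, d1, d2] at hT
      refine (Ensures.block (l := []) (Q := _) ?_).mono (by simp) fun _ h => h
      refine ⟨⟨d5, d3, d6, d2⟩, c1, ⟨c2, c3⟩, c5, ?_⟩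
      simp only [exec, c4, d4]
      convert h9 using 1
      ext x
      simp only [Set.mem_ofPred_eq]
      constructor
      · rintro ⟨h1, h2⟩
        refine ⟨?_, h2⟩
        by_contra h
        have : x = v := by omega
        subst this
        exact hT h2
      · rintro ⟨h1, h2⟩
        exact ⟨by omega, h2⟩
    · rintro s₄ ⟨⟨g0, g1, g2, g3⟩, g4, ⟨g5, g6⟩, g7, g8⟩
      refine Ensures.block ?_
      simp only [HoldsInput, exec, Instr.apply, Store.setI]
      refine ⟨⟨?_, g5, g6, g4⟩, hT, ?_, ?_, ?_, g7, ?_⟩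
      · simp [g0]
      · simp [g1]
      · simp [g2]
      · simp [g3]
      · simpa using g8)
  have h5 : 20 * n + 4 * off n + 6 = 5 + (20 * (n - 0) + 4 * (off n - off 0) + 1) := by
    rw [L.off_zero]; omega
  rw [h5]
  refine Ensures.block_seq (l := [.intConst 1 0, .intConst 2 0, .intConst 3 0, .intConst 6 3]) ?_
  refine (main 0 _ ?_).mono le_rfl ?_
  · refine ⟨?_, by omega, ?_, ?_, ?_, by simp, ?_⟩
    · simp [HoldsInput, exec, Instr.apply, Store.setI, *]
    · simp [exec, Instr.apply, Store.setI]
    · simp [exec, Instr.apply, Store.setI, L.off_zero]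
    · simp [exec, Instr.apply, Store.setI]
    · simp [exec, Instr.apply, Store.setI, Enumerates]
  · rintro s' ⟨v, ⟨h0, h4, h5, h6, h7, h8, h9⟩, hT⟩
    simp only [Test.Holds, h5, h0.1] at hT
    have : v = n := by omega
    subst this
    exact ⟨h0, h8, h9⟩

end Degrees

end RealRAM

namespace RealRAM

/-! ### Elimination of vertices of degree at most two: invariants. -/

section Elimination

/-- The vertices below `n` that are not among the first `h` entries of `ord`. -/
def rest (ord : ℕ → ℕ) (n h : ℕ) : Finset ℕ :=
  (Finset.range n).filter fun x => ∀ k < h, ord k ≠ x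

theorem mem_rest {ord : ℕ → ℕ} {n h x : ℕ} : x ∈ rest ord n h ↔ x < n ∧ ∀ k < h, ord k ≠ x := by
  simp [rest]

theorem rest_zero (ord : ℕ → ℕ) (n : ℕ) : rest ord n 0 = Finset.range n := by
  ext x; simp [mem_rest]

theorem rest_succ (ord : ℕ → ℕ) (n h : ℕ) : rest ord n (h + 1) = (rest ord n h).erase (ord h) := by
  ext x
  simp only [mem_rest, Finset.mem_erase, Nat.lt_succ_iff_lt_or_eq]
  constructor
  · rintro ⟨h1, h2⟩
    exact ⟨fun h3 => h2 h (Or.inr rfl) h3.symm, h1, fun k hk => h2 k (Or.inl hk)⟩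
  · rintro ⟨h1, h2, h3⟩
    refine ⟨h2, ?_⟩
    rintro k (hk | rfl)
    · exact h3 k hk
    · exact Ne.symm h1

theorem rest_congr {ord ord' : ℕ → ℕ} {n h : ℕ} (hk : ∀ k < h, ord' k = ord k) :
    rest ord' n h = rest ord n h := by
  ext x
  simp only [mem_rest]
  refine and_congr_right fun _ => forall_congr' fun k => forall_congr' fun h => ?_
  rw [hk k h]

theorem card_rest {ord : ℕ → ℕ} {n : ℕ} : ∀ {h : ℕ}, (∀ k < h, ord k ∈ rest ord n k) →
    (rest ord n h).card + h = n
  | 0, _ => by simp [rest_zero]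
  | h + 1, hk => by
    have h1 := card_rest (h := h) fun k hkh => hk k (by omega)
    rw [rest_succ, Finset.card_erase_of_mem (hk h (by omega))]
    have : 0 < (rest ord n h).card := Finset.card_pos.2 ⟨_, hk h (by omega)⟩
    omega

variable {n : ℕ} {H : SimpleGraph ℕ} {off tgt : ℕ → ℕ}

open Classical in
/-- The state of the scan of the list of `w` at position `j`; `R` is the set of the remaining
vertices other than `w`. -/
structure ScanState (H : SimpleGraph ℕ) (n : ℕ) (off tgt : ℕ → ℕ) (w h : ℕ) (R : Finset ℕ)
    (deg ord e₀ e₁ : ℕ → ℕ) (tail j : ℕ) : Prop where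
  le : off w ≤ j
  deg_mem : ∀ x ∈ R, deg x = (nbrsIn H R x).card +
    if ∃ i, j ≤ i ∧ i < off (w + 1) ∧ tgt i = x then 1 else 0
  deg_notMem : ∀ x < n, x ∉ R → deg x = 0
  queue : Enumerates ord (h + 1) tail {x | x ∈ R ∧ deg x < 3}
  found : ((Finset.Ico (off w) j).filter fun i => tgt i ∈ R) = ∅ ∨
    ((Finset.Ico (off w) j).filter fun i => tgt i ∈ R) = {e₀ w} ∨
    (e₀ w ≠ e₁ w ∧ e₀ w ∈ ((Finset.Ico (off w) j).filter fun i => tgt i ∈ R) ∧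
      e₁ w ∈ ((Finset.Ico (off w) j).filter fun i => tgt i ∈ R))

variable {w h : ℕ} {R : Finset ℕ} {deg ord e₀ e₁ : ℕ → ℕ} {tail j : ℕ}

theorem ScanState.skip (hS : ScanState H n off tgt w h R deg ord e₀ e₁ tail j)
    (hu : tgt j ∉ R) : ScanState H n off tgt w h R deg ord e₀ e₁ tail (j + 1) := by
  have hF : ((Finset.Ico (off w) (j + 1)).filter fun i => tgt i ∈ R) =
      (Finset.Ico (off w) j).filter fun i => tgt i ∈ R := by
    rw [← Finset.insert_Ico_right_eq_Ico_add_one hS.le, Finset.filter_insert, if_neg hu]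
  refine ⟨hS.le.trans (Nat.le_succ j), ?_, hS.deg_notMem, hS.queue, ?_⟩
  · intro x hx
    rw [hS.deg_mem x hx]
    congr 2
    apply propext
    constructor
    · rintro ⟨i, h1, h2, rfl⟩
      refine ⟨i, ?_, h2, rfl⟩
      by_contra h3
      have : i = j := by omega
      subst this
      exact hu hx
    · rintro ⟨i, h1, h2, h3⟩
      exact ⟨i, by omega, h2, h3⟩
  · rw [hF]; exact hS.found

/-- The removed vertex `w` is still counted until its entry is treated. So the stored degree is
positive, which distinguishes a remaining neighbour from a removed one, whose stored degree is zero.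
-/
theorem ScanState.deg_target (hS : ScanState H n off tgt w h R deg ord e₀ e₁ tail j)
    (hj : j < off (w + 1)) (hu : tgt j ∈ R) :
    deg (tgt j) = (nbrsIn H R (tgt j)).card + 1 := by
  rw [hS.deg_mem _ hu, if_pos ⟨j, le_rfl, hj, rfl⟩]

/-- Recording `j` shifts the previous entry from `e₀` to `e₁`, so these hold the last two remaining
neighbours found. The queue is a hypothesis because it changes in one of two cases only. -/
theorem ScanState.step (hS : ScanState H n off tgt w h R deg ord e₀ e₁ tail j)
    (L : ListsFor n H off tgt) (hw : w < n) (hj : j < off (w + 1)) (hu : tgt j ∈ R) {ord' : ℕ → ℕ}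
    {tail' : ℕ} (hq : Enumerates ord' (h + 1) tail'
      {x | x ∈ R ∧ Function.update deg (tgt j) (deg (tgt j) - 1) x < 3}) :
    ScanState H n off tgt w h R (Function.update deg (tgt j) (deg (tgt j) - 1)) ord'
      (Function.update e₀ w j) (Function.update e₁ w (e₀ w)) tail' (j + 1) := by
  have hd := hS.deg_target hj hu
  have hF : ((Finset.Ico (off w) (j + 1)).filter fun i => tgt i ∈ R) =
      insert j ((Finset.Ico (off w) j).filter fun i => tgt i ∈ R) := by
    rw [← Finset.insert_Ico_right_eq_Ico_add_one hS.le, Finset.filter_insert, if_pos hu]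
  refine ⟨hS.le.trans (Nat.le_succ j), ?_, ?_, hq, ?_⟩
  · intro x hx
    by_cases hxu : x = tgt j
    · subst hxu
      rw [Function.update_self, hd, if_neg]
      · rfl
      · rintro ⟨i, h1, h2, h3⟩
        have hle := hS.le
        have := L.inj w hw (⟨by omega, h2⟩ : i ∈ Set.Ico _ _)
          (⟨by omega, hj⟩ : j ∈ Set.Ico _ _) h3
        omega
    · rw [Function.update_of_ne hxu, hS.deg_mem x hx]
      congr 2
      apply propext
      constructor
      · rintro ⟨i, h1, h2, h3⟩
        refine ⟨i, ?_, h2, h3⟩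
        by_contra h4
        have : i = j := by omega
        subst this
        exact hxu h3.symm
      · rintro ⟨i, h1, h2, h3⟩
        exact ⟨i, by omega, h2, h3⟩
  · intro x hx hxR
    rw [Function.update_of_ne (by rintro rfl; exact hxR hu)]
    exact hS.deg_notMem x hx hxR
  · rw [hF, Function.update_self, Function.update_self]
    rcases hS.found with h1 | h1 | ⟨h1, h2, h3⟩
    · right; left
      rw [h1]; rfl
    · right; right
      rw [h1]
      have h2 : e₀ w ∈ (Finset.Ico (off w) j).filter fun i => tgt i ∈ R := by
        rw [h1]; simp
      have h3 := (Finset.mem_Ico.1 (Finset.mem_filter.1 h2).1).2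
      exact ⟨by omega, by simp, by simp⟩
    · right; right
      have h4 := (Finset.mem_Ico.1 (Finset.mem_filter.1 h2).1).2
      exact ⟨by omega, Finset.mem_insert_self _ _, Finset.mem_insert_of_mem h2⟩

/-- A vertex joins the queue when its degree drops from three to two; it was not in the queue
before, so nothing is queued twice. In any other case the decrement does not affect whether the
degree is below three (`ScanState.step_keep`). -/
theorem ScanState.step_push (hS : ScanState H n off tgt w h R deg ord e₀ e₁ tail j)
    (L : ListsFor n H off tgt) (hw : w < n) (hj : j < off (w + 1)) (hu : tgt j ∈ R)
    (h2 : deg (tgt j) - 1 = 2) :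
    ScanState H n off tgt w h R (Function.update deg (tgt j) (deg (tgt j) - 1))
      (Function.update ord tail (tgt j)) (Function.update e₀ w j) (Function.update e₁ w (e₀ w))
      (tail + 1) (j + 1) := by
  refine hS.step L hw hj hu ?_
  have h3 : deg (tgt j) = 3 := by omega
  convert hS.queue.push (u := tgt j) (by rintro ⟨-, h⟩; omega) using 1
  ext x
  by_cases hx : x = tgt j
  · subst hx
    simp [hu, h2]
  · simp [hx]

theorem ScanState.step_keep (hS : ScanState H n off tgt w h R deg ord e₀ e₁ tail j)
    (L : ListsFor n H off tgt) (hw : w < n) (hj : j < off (w + 1)) (hu : tgt j ∈ R)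
    (h2 : deg (tgt j) - 1 ≠ 2) :
    ScanState H n off tgt w h R (Function.update deg (tgt j) (deg (tgt j) - 1))
      ord (Function.update e₀ w j) (Function.update e₁ w (e₀ w)) tail (j + 1) := by
  refine hS.step L hw hj hu ?_
  have hd := hS.deg_target hj hu
  convert hS.queue using 1
  ext x
  by_cases hx : x = tgt j
  · subst hx
    simp only [Set.mem_ofPred_eq, Function.update_self, hu, true_and]
    omega
  · simp [hx]

/-- What is recorded about the vertex `ord i`: the positions, in its list, of its neighbours among
the vertices that come later in `ord`. -/
structure RecordsParents (H : SimpleGraph ℕ) (n : ℕ) (off tgt ord e₀ e₁ : ℕ → ℕ) (i : ℕ) :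
    Prop where
  mem : ord i ∈ rest ord n i
  le₀ : off (ord i) ≤ e₀ (ord i)
  lt₀ : e₀ (ord i) < off (ord i + 1)
  mem₀ : tgt (e₀ (ord i)) ∈ rest ord n (i + 1)
  le₁ : i + 2 < n → off (ord i) ≤ e₁ (ord i)
  lt₁ : i + 2 < n → e₁ (ord i) < off (ord i + 1)
  mem₁ : i + 2 < n → tgt (e₁ (ord i)) ∈ rest ord n (i + 1)
  ne : i + 2 < n → e₀ (ord i) ≠ e₁ (ord i)
  adj : i + 2 < n → H.Adj (tgt (e₀ (ord i))) (tgt (e₁ (ord i)))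
  only : i + 2 < n → ∀ x ∈ rest ord n (i + 1), H.Adj (ord i) x →
    x = tgt (e₀ (ord i)) ∨ x = tgt (e₁ (ord i))

theorem RecordsParents.congr {ord' e₀' e₁' : ℕ → ℕ} {i : ℕ}
    (hP : RecordsParents H n off tgt ord e₀ e₁ i) (ho : ∀ k ≤ i, ord' k = ord k)
    (h₀ : e₀' (ord i) = e₀ (ord i)) (h₁ : e₁' (ord i) = e₁ (ord i)) :
    RecordsParents H n off tgt ord' e₀' e₁' i := by
  have r1 : rest ord' n i = rest ord n i := rest_congr fun k hk => ho k hk.le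
  have r2 : rest ord' n (i + 1) = rest ord n (i + 1) := rest_congr fun k hk => ho k (by omega)
  have r3 := ho i le_rfl
  obtain ⟨a1, a2, a3, a4, a5, a6, a7, a8, a9, a10⟩ := hP
  constructor <;> simp only [r1, r2, r3, h₀, h₁] <;> assumption

/-- The state after the removal of the first `h` vertices of `ord`. -/
structure ElimState (H : SimpleGraph ℕ) (n : ℕ) (off tgt : ℕ → ℕ) (deg ord e₀ e₁ rk : ℕ → ℕ)
    (tail h : ℕ) : Prop where
  lt : h < n
  queue : Enumerates ord h tail {x | x ∈ rest ord n h ∧ deg x < 3}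
  deg_mem : ∀ x ∈ rest ord n h, deg x = (nbrsIn H (rest ord n h) x).card
  deg_notMem : ∀ x < n, x ∉ rest ord n h → deg x = 0
  tree : h + 2 ≤ n → InducesTwoTree H (rest ord n h)
  parents : ∀ i < h, RecordsParents H n off tgt ord e₀ e₁ i
  rank : ∀ i < h, rk (ord i) = i

variable {rk : ℕ → ℕ}

theorem ElimState.card_rest (hE : ElimState H n off tgt deg ord e₀ e₁ rk tail h) :
    (rest ord n h).card + h = n :=
  RealRAM.card_rest fun k hk => (hE.parents k hk).mem

/-- The queue is not empty. -/
theorem ElimState.head_mem (hE : ElimState H n off tgt deg ord e₀ e₁ rk tail h) :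
    ord h ∈ rest ord n h ∧ deg (ord h) < 3 := by
  have hc := hE.card_rest
  have hlt := hE.lt
  have hex : ∃ x ∈ rest ord n h, deg x < 3 := by
    -- A 2-tree with at least three vertices has a vertex of degree two; with at most two vertices
    -- all degrees are small anyway.
    by_cases h3 : 3 ≤ (rest ord n h).card
    · obtain ⟨v, hv, hv2⟩ := (hE.tree (by omega)).exists_card_nbrsIn_eq_two h3
      exact ⟨v, hv, by rw [hE.deg_mem v hv, hv2]; omega⟩
    · obtain ⟨v, hv⟩ : (rest ord n h).Nonempty := Finset.card_pos.1 (by omega)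
      refine ⟨v, hv, ?_⟩
      rw [hE.deg_mem v hv]
      have := Finset.card_le_card (show nbrsIn H (rest ord n h) v ⊆ rest ord n h from
        fun x hx => (mem_nbrsIn.1 hx).1)
      omega
  obtain ⟨x, hx⟩ := hex
  obtain ⟨k, hk, -⟩ := hE.queue.2.surjOn hx
  exact hE.queue.2.mapsTo (⟨le_rfl, lt_of_le_of_lt hk.1 hk.2⟩ : h ∈ Set.Ico h tail)

open Classical in
theorem card_nbrsIn_erase {R : Finset ℕ} {w x : ℕ} (hw : w ∈ R) :
    (nbrsIn H R x).card = (nbrsIn H (R.erase w) x).card + if H.Adj x w then 1 else 0 := by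
  have h1 : nbrsIn H (R.erase w) x = (nbrsIn H R x).erase w := by
    ext y; simp [mem_nbrsIn, and_assoc]
  rw [h1]
  split_ifs with h
  · have : w ∈ nbrsIn H R x := mem_nbrsIn.2 ⟨hw, h⟩
    rw [Finset.card_erase_of_mem this]
    have : 0 < (nbrsIn H R x).card := Finset.card_pos.2 ⟨_, this⟩
    omega
  · rw [Finset.erase_eq_of_notMem]
    · rfl
    · exact fun hm => h (mem_nbrsIn.1 hm).2

theorem Enumerates.pop {ord : ℕ → ℕ} {h tail : ℕ} {S : Set ℕ} (hq : Enumerates ord h tail S)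
    (hS : ord h ∈ S) : Enumerates ord (h + 1) tail (S \ {ord h}) := by
  obtain ⟨h0, h1, h2, h3⟩ := hq
  have hlt : h < tail := by
    obtain ⟨k, hk, -⟩ := h3 hS
    exact lt_of_le_of_lt hk.1 hk.2
  have hh : h ∈ Set.Ico h tail := ⟨le_rfl, hlt⟩
  have hsub : ∀ k ∈ Set.Ico (h + 1) tail, k ∈ Set.Ico h tail := fun k hk =>
    ⟨(Nat.le_succ h).trans hk.1, hk.2⟩
  refine ⟨hlt, ?_, ?_, ?_⟩
  · intro k hk
    refine ⟨h1 (hsub k hk), fun h4 => ?_⟩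
    have h5 := h2 (hsub k hk) hh h4
    have h6 := hk.1
    omega
  · exact fun k hk l hl hkl => h2 (hsub k hk) (hsub l hl) hkl
  · rintro x ⟨hx, hxw⟩
    obtain ⟨k, hk, rfl⟩ := h3 hx
    refine ⟨k, ⟨?_, hk.2⟩, rfl⟩
    have : k ≠ h := by rintro rfl; exact hxw rfl
    have := hk.1
    omega

/-- A zero degree marks the head of the queue as removed. The degrees of its remaining neighbours
are now one too large, which is what the invariant of the scan permits at its start. -/
theorem ElimState.scan_start (hE : ElimState H n off tgt deg ord e₀ e₁ rk tail h)
    (L : ListsFor n H off tgt) :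
    ScanState H n off tgt (ord h) h (rest ord n (h + 1)) (Function.update deg (ord h) 0) ord e₀ e₁
      tail (off (ord h)) := by
  obtain ⟨hw, hd⟩ := hE.head_mem
  have hwn := (mem_rest.1 hw).1
  rw [rest_succ]
  refine ⟨le_rfl, ?_, ?_, ?_, by simp⟩
  · intro x hx
    obtain ⟨h1, h2⟩ := Finset.mem_erase.1 hx
    rw [Function.update_of_ne h1, hE.deg_mem x h2, card_nbrsIn_erase hw]
    congr 2
    rw [H.adj_comm, L.adj _ hwn]
  · intro x hx hxR
    by_cases h1 : x = ord h
    · subst h1; simp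
    · rw [Function.update_of_ne h1]
      exact hE.deg_notMem x hx fun h2 => hxR (Finset.mem_erase.2 ⟨h1, h2⟩)
  · convert hE.queue.pop ⟨hw, hd⟩ using 1
    ext x
    by_cases hx : x = ord h <;> simp [hx]

theorem InducesTwoTree.adj_of_card_two {V : Type*} [DecidableEq V] {G : SimpleGraph V}
    {s : Finset V} (hs : InducesTwoTree G s) (hc : s.card ≤ 2) {x y : V} (hx : x ∈ s) (hy : y ∈ s)
    (hxy : x ≠ y) : G.Adj x y := by
  cases hs with
  | edge u v h =>
    simp only [Finset.mem_insert, Finset.mem_singleton] at hx hy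
    rcases hx with rfl | rfl <;> rcases hy with rfl | rfl
    · exact absurd rfl hxy
    · exact h
    · exact h.symm
    · exact absurd rfl hxy
  | simplicial t a b w ht ha hb hab hw hN =>
    rw [Finset.card_insert_of_notMem hw] at hc
    have := ht.two_le_card
    omega

/-- After the scan all degrees are corrected. A vertex from the queue has at most two remaining
neighbours, and exactly two if at least three vertices were left, so the recorded positions are all
of them. When only two vertices were left there is one neighbour, and `e₁` is meaningless; hence the
conditions `h + 2 < n`. -/
theorem ElimState.scan_end (hE : ElimState H n off tgt deg ord e₀ e₁ rk tail h) (hn : h + 1 < n)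
    (L : ListsFor n H off tgt) {deg' ord' e₀' e₁' rk' : ℕ → ℕ} {tail' : ℕ}
    (hS : ScanState H n off tgt (ord h) h (rest ord n (h + 1)) deg' ord' e₀' e₁' tail'
      (off (ord h + 1)))
    (ho : ∀ k ≤ h, ord' k = ord k) (he : ∀ x, x ≠ ord h → e₀' x = e₀ x ∧ e₁' x = e₁ x)
    (hr : rk' = Function.update rk (ord h) h) :
    ElimState H n off tgt deg' ord' e₀' e₁' rk' tail' (h + 1) := by
  obtain ⟨hw, hd⟩ := hE.head_mem
  have hwn := (mem_rest.1 hw).1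
  have hc := hE.card_rest
  have htree := hE.tree (by omega)
  have hrest : rest ord' n (h + 1) = rest ord n (h + 1) := rest_congr fun k hk => ho k (by omega)
  have hrest' : rest ord' n h = rest ord n h := rest_congr fun k hk => ho k (by omega)
  have hwo := ho h le_rfl
  have hne : ∀ i < h, ord i ≠ ord h := fun i hi => (mem_rest.1 hw).2 i hi
  have hcard := L.card_filter hwn (rest ord n (h + 1))
  have hnb : (nbrsIn H (rest ord n h) (ord h)).card =
      (nbrsIn H (rest ord n (h + 1)) (ord h)).card := by
    rw [card_nbrsIn_erase hw, rest_succ, if_neg H.irrefl]; rfl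
  have hF := hS.found
  have hdeg := hE.deg_mem _ hw
  set F := (Finset.Ico (off (ord h)) (off (ord h + 1))).filter
    fun i => tgt i ∈ rest ord n (h + 1) with hFdef
  have hmemF : ∀ i, i ∈ F ↔ (off (ord h) ≤ i ∧ i < off (ord h + 1)) ∧
      tgt i ∈ rest ord n (h + 1) := by
    intro i; rw [hFdef, Finset.mem_filter, Finset.mem_Ico]
  -- Some neighbour was found: with three or more vertices left the degree is at least two, and the
  -- last two vertices are adjacent.
  have hmem₀ : e₀' (ord h) ∈ F := by
    rcases hF with h1 | h1 | h1
    · exfalso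
      rw [h1, Finset.card_empty] at hcard
      by_cases h3 : 3 ≤ (rest ord n h).card
      · have := htree.two_le_card_nbrsIn h3 _ hw
        omega
      · obtain ⟨x, hx⟩ : (rest ord n (h + 1)).Nonempty := by
          rw [rest_succ, ← Finset.card_pos, Finset.card_erase_of_mem hw]; omega
        have hx' := hx
        rw [rest_succ, Finset.mem_erase] at hx'
        have hadj := InducesTwoTree.adj_of_card_two htree (by omega) hw hx'.2 hx'.1.symm
        have : 0 < (nbrsIn H (rest ord n (h + 1)) (ord h)).card :=
          Finset.card_pos.2 ⟨x, mem_nbrsIn.2 ⟨hx, hadj⟩⟩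
        omega
    · rw [h1]; simp
    · exact h1.2.1
  have hbig : h + 2 < n → (nbrsIn H (rest ord n h) (ord h)).card = 2 := by
    intro h3
    have := htree.two_le_card_nbrsIn (by omega) _ hw
    omega
  have hboth : h + 2 < n → e₀' (ord h) ≠ e₁' (ord h) ∧ e₁' (ord h) ∈ F ∧
      nbrsIn H (rest ord n (h + 1)) (ord h) = {tgt (e₀' (ord h)), tgt (e₁' (ord h))} := by
    intro h3
    have hb := hbig h3
    rcases hF with h1 | h1 | ⟨h1, h2, h4⟩
    · rw [h1, Finset.card_empty] at hcard; omega
    · rw [h1, Finset.card_singleton] at hcard; omega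
    · refine ⟨h1, h4, ?_⟩
      rw [hmemF] at h2 h4
      refine eq_pair_of_card_two (by omega)
        (mem_nbrsIn.2 ⟨h2.2, (L.target_lt hwn h2.1.1 h2.1.2).1⟩)
        (mem_nbrsIn.2 ⟨h4.2, (L.target_lt hwn h4.1.1 h4.1.2).1⟩) ?_
      exact fun h5 => h1 (L.inj _ hwn h2.1 h4.1 h5)
  have hmem₁ : h + 2 < n → e₁' (ord h) ∈ F := fun h3 => (hboth h3).2.1
  refine ⟨hn, ?_, ?_, ?_, ?_, ?_, ?_⟩
  · rw [hrest]; exact hS.queue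
  · rw [hrest]
    intro x hx
    rw [hS.deg_mem x hx, if_neg]
    · rfl
    · rintro ⟨i, h1, h2, -⟩; omega
  · rw [hrest]; exact hS.deg_notMem
  · intro h3
    rw [hrest, rest_succ]
    exact (htree.erase_of_card_nbrsIn (by omega) _ hw (hbig (by omega))).1
  · intro i hi
    rcases Nat.lt_succ_iff_lt_or_eq.1 hi with hi | rfl
    · exact (hE.parents i hi).congr (fun k hk => ho k (by omega)) (he _ (hne i hi)).1
        (he _ (hne i hi)).2
    · rw [hmemF] at hmem₀
      constructor <;> simp only [hwo, hrest, hrest']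
      · exact hw
      · exact hmem₀.1.1
      · exact hmem₀.1.2
      · exact hmem₀.2
      · exact fun h3 => ((hmemF _).1 (hmem₁ h3)).1.1
      · exact fun h3 => ((hmemF _).1 (hmem₁ h3)).1.2
      · exact fun h3 => ((hmemF _).1 (hmem₁ h3)).2
      · exact fun h3 => (hboth h3).1
      · intro h3
        obtain ⟨-, a, b, hab, hnab⟩ := htree.erase_of_card_nbrsIn (by omega) _ hw (hbig h3)
        have h4 : nbrsIn H (rest ord n (i + 1)) (ord i) = nbrsIn H (rest ord n i) (ord i) := by
          refine Finset.eq_of_subset_of_card_le ?_ hnb.le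
          intro x hx
          rw [mem_nbrsIn, rest_succ, Finset.mem_erase] at hx
          exact mem_nbrsIn.2 ⟨hx.1.2, hx.2⟩
        have hp := (hboth h3).2.2
        rw [h4, hnab] at hp
        -- The recorded neighbours are the adjacent pair supplied by the 2-tree structure, possibly
        -- in the other order.
        have h5 : s(a, b) = s(tgt (e₀' (ord i)), tgt (e₁' (ord i))) := by
          have hne' : tgt (e₀' (ord i)) ≠ tgt (e₁' (ord i)) := by
            intro h6
            have := congrArg Finset.card hp
            rw [h6, Finset.card_pair hab.ne] at this
            simp at this
          have ha : a = tgt (e₀' (ord i)) ∨ a = tgt (e₁' (ord i)) := by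
            have : a ∈ ({a, b} : Finset ℕ) := by simp
            rw [hp] at this; simpa using this
          have hb : b = tgt (e₀' (ord i)) ∨ b = tgt (e₁' (ord i)) := by
            have : b ∈ ({a, b} : Finset ℕ) := by simp
            rw [hp] at this; simpa using this
          have := hab.ne
          rw [Sym2.eq_iff]
          rcases ha with ha | ha <;> rcases hb with hb | hb
          · exact absurd (ha.trans hb.symm) this
          · exact Or.inl ⟨ha, hb⟩
          · exact Or.inr ⟨ha, hb⟩
          · exact absurd (ha.trans hb.symm) this
        rw [← SimpleGraph.mem_edgeSet, ← h5]
        exact hab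
      · intro h3 x hx hadj
        have : x ∈ nbrsIn H (rest ord n (i + 1)) (ord i) := mem_nbrsIn.2 ⟨hx, hadj⟩
        rw [(hboth h3).2.2] at this
        simpa using this
  · intro i hi
    rcases Nat.lt_succ_iff_lt_or_eq.1 hi with hi | rfl
    · rw [ho i (by omega), hr, Function.update_of_ne (hne i hi)]
      exact hE.rank i hi
    · rw [hwo, hr, Function.update_self]

end Elimination

end RealRAM

namespace RealRAM

/-! ### The elimination program: correctness and time. -/

section EliminationProgram

/-- Treat the position `ireg 2` of the list of `ireg 5`. -/
def scanBody : Program :=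
  .seq (block [.intLoad 11 1 2, .intLoad 12 2 11])
  (.seq (.cond (.intLt 10 12)
      (.seq (block [.intPred 12, .intStore 2 11 12, .intLoad 13 4 5, .intStore 5 5 13,
          .intStore 4 5 2])
        (.cond (.intEq 12 9) (block [.intStore 3 3 11, .intSucc 3]) (block [])))
      (block []))
    (block [.intSucc 2]))

/-- Remove the next vertex of the queue. -/
def elimBody : Program :=
  .seq (block [.intLoad 5 3 1, .intStore 6 5 1, .intLoad 2 0 5, .intCopy 7 5, .intSucc 7,
    .intLoad 4 0 7, .intStore 2 5 10])
  (.seq (.loop (.intLt 2 4) scanBody) (block [.intSucc 1]))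

/-- Remove all vertices but one; array `3` is a queue of the vertices of degree at most two. -/
def elimPhase : Program :=
  .seq (block [.intConst 1 0, .intConst 9 2, .intConst 10 0, .intCopy 8 0, .intPred 8])
  (.seq (.loop (.intLt 1 8) elimBody) (block [.intLoad 5 3 1, .intStore 6 5 1]))

variable {n : ℕ} {H : SimpleGraph ℕ} {off tgt : ℕ → ℕ} {ε : ℝ}

/-- The loop invariant of the scan. -/
def ScanInv (n : ℕ) (H : SimpleGraph ℕ) (off tgt : ℕ → ℕ) (ε : ℝ) (w h : ℕ) (R : Finset ℕ)
    (ord e₀ e₁ rk : ℕ → ℕ) (j : ℕ) (s : Store) : Prop :=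
  HoldsInput n off tgt ε s ∧ s.ireg 1 = h ∧ s.ireg 2 = j ∧ s.ireg 4 = off (w + 1) ∧
  s.ireg 5 = w ∧ s.ireg 8 = n - 1 ∧ s.ireg 9 = 2 ∧ s.ireg 10 = 0 ∧ s.iarr 6 = rk ∧
  (∀ k ≤ h, s.iarr 3 k = ord k) ∧ (∀ x, x ≠ w → s.iarr 4 x = e₀ x ∧ s.iarr 5 x = e₁ x) ∧
  j ≤ off (w + 1) ∧
  ScanState H n off tgt w h R (s.iarr 2) (s.iarr 3) (s.iarr 4) (s.iarr 5) (s.ireg 3) j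

theorem scanBody_ensures (L : ListsFor n H off tgt) {w h : ℕ} (hw : w < n) {R : Finset ℕ}
    {ord e₀ e₁ rk : ℕ → ℕ} {j : ℕ} {s : Store} (hj : j < off (w + 1))
    (hI : ScanInv n H off tgt ε w h R ord e₀ e₁ rk j s) :
    Ensures scanBody s 16 (ScanInv n H off tgt ε w h R ord e₀ e₁ rk (j + 1)) := by
  obtain ⟨⟨h0, h1, h2, h3⟩, h4, h5, h6, h7, h8, h9, h10, h11, h12, h13, h14, hS⟩ := hI
  -- The queue ends beyond position `h`, so a push leaves the order of the vertices removed so far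
  -- intact.
  have htail : h < s.ireg 3 := hS.queue.1
  refine Ensures.mono (B := 3 + (1 + (6 + (1 + 3)) + 2)) ?_ (by norm_num) fun _ h => h
  refine Ensures.block_seq ?_
  set s₁ := exec [.intLoad 11 1 2, .intLoad 12 2 11] s with hs₁
  have a0 : s₁.iarr = s.iarr := by simp [hs₁, exec, Instr.apply, Store.setI]
  have a1 : s₁.rreg = s.rreg := by simp [hs₁, exec, Instr.apply, Store.setI]
  have a2 : s₁.ireg 11 = tgt j ∧ s₁.ireg 12 = s.iarr 2 (tgt j) := by
    simp [hs₁, exec, Instr.apply, Store.setI, h2, h5]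
  have a3 : ∀ r < 11, s₁.ireg r = s.ireg r := by
    intro r hr
    simp [hs₁, exec, Instr.apply, Store.setI, show r ≠ 11 by omega,
      show r ≠ 12 by omega]
  obtain ⟨a2, a4⟩ := a2
  clear_value s₁
  have r0 := a3 0 (by omega)
  have r1 := a3 1 (by omega)
  have r2 := a3 2 (by omega)
  have r3 := a3 3 (by omega)
  have r4 := a3 4 (by omega)
  have r5 := a3 5 (by omega)
  have r8 := a3 8 (by omega)
  have r9 := a3 9 (by omega)
  have r10 := a3 10 (by omega)
  rw [h0] at r0
  rw [h4] at r1
  rw [h5] at r2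
  rw [h6] at r4
  rw [h7] at r5
  rw [h8] at r8
  rw [h9] at r9
  rw [h10] at r10
  refine Ensures.seq (Q := fun s₂ => HoldsInput n off tgt ε s₂ ∧ s₂.ireg 1 = h ∧ s₂.ireg 2 = j ∧
    s₂.ireg 4 = off (w + 1) ∧ s₂.ireg 5 = w ∧ s₂.ireg 8 = n - 1 ∧ s₂.ireg 9 = 2 ∧
    s₂.ireg 10 = 0 ∧ s₂.iarr 6 = rk ∧ (∀ k ≤ h, s₂.iarr 3 k = ord k) ∧
    (∀ x, x ≠ w → s₂.iarr 4 x = e₀ x ∧ s₂.iarr 5 x = e₁ x) ∧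
    ScanState H n off tgt w h R (s₂.iarr 2) (s₂.iarr 3) (s₂.iarr 4) (s₂.iarr 5) (s₂.ireg 3)
      (j + 1)) (Ensures.cond ?_ ?_) ?_
  · intro hT
    simp only [Test.Holds, r10, a4] at hT
    have hu : tgt j ∈ R := by
      by_contra hu
      rw [hS.deg_notMem _ (L.target_lt hw hS.le hj).2 hu] at hT
      omega
    refine Ensures.block_seq ?_
    set s₂ := exec [.intPred 12, .intStore 2 11 12, .intLoad 13 4 5, .intStore 5 5 13,
      .intStore 4 5 2] s₁ with hs₂
    have b0 : ∀ r < 11, s₂.ireg r = s₁.ireg r := by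
      intro r hr
      simp [hs₂, exec, Instr.apply, Store.setI, show r ≠ 12 by omega,
        show r ≠ 13 by omega]
    have b1 : s₂.ireg 11 = tgt j ∧ s₂.ireg 12 = s.iarr 2 (tgt j) - 1 := by
      simp [hs₂, exec, Instr.apply, Store.setI, a2, a4]
    have b2 : s₂.rreg = s.rreg := by simp [hs₂, exec, Instr.apply, Store.setI, a1]
    have b3 : s₂.iarr 0 = off ∧ s₂.iarr 1 = tgt ∧ s₂.iarr 6 = rk ∧ s₂.iarr 3 = s.iarr 3 := by
      simp [hs₂, exec, Instr.apply, Store.setI, a0, h1, h2, h11]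
    have b4 : s₂.iarr 2 = Function.update (s.iarr 2) (tgt j) (s.iarr 2 (tgt j) - 1) := by
      simp [hs₂, exec, Instr.apply, Store.setI, a0, a2, a4]
    have b5 : s₂.iarr 4 = Function.update (s.iarr 4) w j := by
      simp [hs₂, exec, Instr.apply, Store.setI, a0, r5, r2]
    have b6 : s₂.iarr 5 = Function.update (s.iarr 5) w (s.iarr 4 w) := by
      simp [hs₂, exec, Instr.apply, Store.setI, a0, r5]
    obtain ⟨b1, b7⟩ := b1
    obtain ⟨b8, b9, b10, b11⟩ := b3
    clear_value s₂
    have c0 := b0 0 (by omega)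
    have c1 := b0 1 (by omega)
    have c2 := b0 2 (by omega)
    have c3 := b0 3 (by omega)
    have c4 := b0 4 (by omega)
    have c5 := b0 5 (by omega)
    have c8 := b0 8 (by omega)
    have c9 := b0 9 (by omega)
    have c10 := b0 10 (by omega)
    rw [r0] at c0
    rw [r1] at c1
    rw [r2] at c2
    rw [r3] at c3
    rw [r4] at c4
    rw [r5] at c5
    rw [r8] at c8
    rw [r9] at c9
    rw [r10] at c10
    have hothers : ∀ x, x ≠ w → s₂.iarr 4 x = e₀ x ∧ s₂.iarr 5 x = e₁ x := by
      intro x hx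
      rw [b5, b6, Function.update_of_ne hx, Function.update_of_ne hx]
      exact h13 x hx
    refine Ensures.cond ?_ ?_
    · intro hT2
      simp only [Test.Holds, b7, c9] at hT2
      refine Ensures.block ?_
      have hstep := hS.step_push L hw hj hu hT2
      have d0 : ∀ r, r ≠ 3 → (exec [.intStore 3 3 11, .intSucc 3] s₂).ireg r = s₂.ireg r := by
        intro r hr
        simp [exec, Instr.apply, Store.setI, hr]
      have d1 : (exec [.intStore 3 3 11, .intSucc 3] s₂).ireg 3 = s.ireg 3 + 1 := by
        simp [exec, Instr.apply, Store.setI, c3]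
      have d2 : (exec [.intStore 3 3 11, .intSucc 3] s₂).rreg = s.rreg := by
        simp [exec, Instr.apply, Store.setI, b2]
      have d3 : ∀ k, k ≠ 3 → (exec [.intStore 3 3 11, .intSucc 3] s₂).iarr k = s₂.iarr k := by
        intro k hk
        simp [exec, Instr.apply, Store.setI, hk]
      have d4 : (exec [.intStore 3 3 11, .intSucc 3] s₂).iarr 3 =
          Function.update (s.iarr 3) (s.ireg 3) (tgt j) := by
        simp [exec, Instr.apply, Store.setI, b11, c3, b1]
      rw [HoldsInput, d0 0 (by norm_num), d0 1 (by norm_num), d0 2 (by norm_num),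
        d0 4 (by norm_num), d0 5 (by norm_num), d0 8 (by norm_num), d0 9 (by norm_num),
        d0 10 (by norm_num), d1, d2, d3 0 (by norm_num), d3 1 (by norm_num), d3 2 (by norm_num),
        d3 4 (by norm_num), d3 5 (by norm_num), d3 6 (by norm_num), d4]
      refine ⟨⟨c0, b8, b9, h3⟩, c1, c2, c4, c5, c8, c9, c10, b10, ?_, hothers, ?_⟩
      · intro k hk
        rw [Function.update_of_ne (by omega)]
        exact h12 k hk
      · rw [b4, b5, b6]; exact hstep
    · intro hT2
      simp only [Test.Holds, b7, c9] at hT2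
      refine (Ensures.block (l := []) (Q := _) ?_).mono (by simp) fun _ h => h
      have hstep := hS.step_keep L hw hj hu hT2
      simp only [exec]
      refine ⟨⟨c0, b8, b9, by rw [b2, h3]⟩, c1, c2, c4, c5, c8, c9, c10, b10, ?_, hothers, ?_⟩
      · rw [b11]; exact h12
      · rw [b4, b5, b6, b11, c3]; exact hstep
  · intro hT
    simp only [Test.Holds, r10, a4] at hT
    have hu : tgt j ∉ R := by
      intro hu
      rw [hS.deg_target hj hu] at hT
      omega
    refine (Ensures.block (l := []) (Q := _) ?_).mono (by simp) fun _ h => h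
    simp only [exec]
    refine ⟨⟨r0, by rw [a0, h1], by rw [a0, h2], by rw [a1, h3]⟩, r1, r2, r4, r5, r8, r9, r10,
      by rw [a0, h11], by rw [a0]; exact h12, by rw [a0]; exact h13, ?_⟩
    rw [a0, r3]
    exact hS.skip hu
  · rintro s₂ ⟨⟨g0, g1, g2, g3⟩, g4, g5, g6, g7, g8, g9, g10, g11, g12, g13, g14⟩
    refine Ensures.block ?_
    simp only [exec, Instr.apply, Store.setI]
    refine ⟨⟨?_, g1, g2, g3⟩, ?_, ?_, ?_, ?_, ?_, ?_, ?_, g11, g12, g13, hj, ?_⟩ <;>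
      simp [*]

/-- The loop invariant of the elimination. -/
def ElimInv (n : ℕ) (H : SimpleGraph ℕ) (off tgt : ℕ → ℕ) (ε : ℝ) (a : ℕ × Finset ℕ)
    (s : Store) : Prop :=
  HoldsInput n off tgt ε s ∧ s.ireg 1 = a.1 ∧ s.ireg 8 = n - 1 ∧ s.ireg 9 = 2 ∧ s.ireg 10 = 0 ∧
  a.2 = rest (s.iarr 3) n a.1 ∧
  ElimState H n off tgt (s.iarr 2) (s.iarr 3) (s.iarr 4) (s.iarr 5) (s.iarr 6) (s.ireg 3) a.1

/-- The cost is linear in the whole list of the removed vertex, entries of vertices removed earlier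
included; each list is charged once. -/
theorem elimBody_ensures (L : ListsFor n H off tgt) {h : ℕ} (hn : h + 1 < n) {s : Store}
    (hI : ElimInv n H off tgt ε (h, rest (s.iarr 3) n h) s) :
    Ensures elimBody s (17 * (off (s.iarr 3 h + 1) - off (s.iarr 3 h)) + 11)
      (ElimInv n H off tgt ε (h + 1, rest (s.iarr 3) n (h + 1))) := by
  obtain ⟨⟨h0, h1, h2, h3⟩, h4, h5, h6, h7, -, hE⟩ := hI
  dsimp only at h4 hE
  obtain ⟨hw, hd⟩ := hE.head_mem
  have hwn := (mem_rest.1 hw).1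
  have hS := hE.scan_start L
  set w := s.iarr 3 h with hwdef
  have hle := L.off_le w hwn
  refine Ensures.mono (B := 8 + (17 * (off (w + 1) - off w) + 1 + 2)) ?_ (by omega) fun _ h => h
  refine Ensures.block_seq ?_
  set s₁ := exec [.intLoad 5 3 1, .intStore 6 5 1, .intLoad 2 0 5, .intCopy 7 5, .intSucc 7,
    .intLoad 4 0 7, .intStore 2 5 10] s with hs₁
  have b0 : s₁.ireg 0 = n ∧ s₁.ireg 1 = h ∧ s₁.ireg 2 = off w ∧ s₁.ireg 3 = s.ireg 3 ∧
      s₁.ireg 4 = off (w + 1) ∧ s₁.ireg 5 = w ∧ s₁.ireg 8 = n - 1 ∧ s₁.ireg 9 = 2 ∧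
      s₁.ireg 10 = 0 := by
    simp [hs₁, exec, Instr.apply, Store.setI, h0, h1, h4, h5, h6, h7, ← hwdef]
  have b1 : s₁.rreg = s.rreg := by simp [hs₁, exec, Instr.apply, Store.setI]
  have b2 : s₁.iarr 0 = off ∧ s₁.iarr 1 = tgt ∧ s₁.iarr 2 = Function.update (s.iarr 2) w 0 ∧
      s₁.iarr 3 = s.iarr 3 ∧ s₁.iarr 4 = s.iarr 4 ∧ s₁.iarr 5 = s.iarr 5 ∧
      s₁.iarr 6 = Function.update (s.iarr 6) w h := by
    simp [hs₁, exec, Instr.apply, Store.setI, h1, h2, h4, h7, ← hwdef]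
  obtain ⟨c0, c1, c2, c3, c4, c5, c8, c9, c10⟩ := b0
  obtain ⟨d0, d1, d2, d3, d4, d5, d6⟩ := b2
  clear_value s₁
  have hloop := Ensures.loop (T := .intLt 2 4) (p := scanBody)
    (ScanInv n H off tgt ε w h (rest (s.iarr 3) n (h + 1)) (s.iarr 3) (s.iarr 4) (s.iarr 5)
      (Function.update (s.iarr 6) w h)) (fun j => 17 * (off (w + 1) - j)) (by
    intro j s' hI' hT
    have hj : j < off (w + 1) := by
      simp only [Test.Holds] at hT
      rwa [hI'.2.2.1, hI'.2.2.2.1] at hT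
    exact ⟨j + 1, 16, by omega, scanBody_ensures L hwn hj hI'⟩) (off w) s₁
    (by
      refine ⟨⟨c0, d0, d1, by rw [b1, h3]⟩, c1, c2, c4, c5, c8, c9, c10, d6, ?_, ?_, hle, ?_⟩
      · rw [d3]; exact fun k _ => rfl
      · rw [d4, d5]; exact fun x _ => ⟨rfl, rfl⟩
      · rw [d2, d3, d4, d5, c3]; exact hS)
  refine hloop.seq ?_
  rintro s₂ ⟨j, ⟨⟨g0, g1, g2, g3⟩, g4, g5, g6, g7, g8, g9, g10, g11, g12, g13, g14, hS'⟩, hT⟩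
  simp only [Test.Holds, g5, g6] at hT
  have hj : j = off (w + 1) := by omega
  subst hj
  have hE' := hE.scan_end hn L hS' g12 g13 g11
  have hrest : rest (s₂.iarr 3) n (h + 1) = rest (s.iarr 3) n (h + 1) :=
    rest_congr fun k hk => g12 k (by omega)
  refine Ensures.block ?_
  simp only [exec, Instr.apply, Store.setI]
  refine ⟨⟨?_, g1, g2, g3⟩, ?_, ?_, ?_, ?_, hrest.symm, ?_⟩
  · simp [g0]
  · simp [g4]
  · simp [g8]
  · simp [g9]
  · simp [g10]
  · simpa using hE'

/-- The result of the elimination: an order `ord` of the vertices in which each vertex has at most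
two later neighbours, which are adjacent and recorded in `e₀` and `e₁`. -/
structure Eliminated (H : SimpleGraph ℕ) (n : ℕ) (off tgt ord e₀ e₁ rk : ℕ → ℕ) : Prop where
  mem : ∀ i < n, ord i ∈ rest ord n i
  parents : ∀ i, i + 1 < n → RecordsParents H n off tgt ord e₀ e₁ i
  rank : ∀ i < n, rk (ord i) = i

/-- The loop stops when one vertex is left. This vertex is already the head of the queue, so only
its rank remains to be stored. -/
theorem elimPhase_ensures (L : ListsFor n H off tgt) (hH : InducesTwoTree H (Finset.range n))
    {s : Store} (hs : HoldsInput n off tgt ε s)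
    (hdeg : ∀ x < n, s.iarr 2 x = off (x + 1) - off x)
    (hq : Enumerates (s.iarr 3) 0 (s.ireg 3) {x | x < n ∧ off (x + 1) - off x < 3}) :
    Ensures elimPhase s (17 * off n + 12 * n + 10) fun s' => HoldsInput n off tgt ε s' ∧
      s'.ireg 1 = n - 1 ∧
      Eliminated H n off tgt (s'.iarr 3) (s'.iarr 4) (s'.iarr 5) (s'.iarr 6) := by
  have hn : 2 ≤ n := by simpa using hH.two_le_card
  obtain ⟨h0, h1, h2, h3⟩ := hs
  refine Ensures.mono (B := 6 + ((17 * off n + 12 * n + 1) + 3)) ?_ (by omega) fun _ h => h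
  refine Ensures.block_seq ?_
  set s₁ := exec [.intConst 1 0, .intConst 9 2, .intConst 10 0, .intCopy 8 0, .intPred 8] s
    with hs₁
  have a0 : s₁.iarr = s.iarr := by simp [hs₁, exec, Instr.apply, Store.setI]
  have a1 : s₁.rreg = s.rreg := by simp [hs₁, exec, Instr.apply, Store.setI]
  have a2 : s₁.ireg 0 = n ∧ s₁.ireg 1 = 0 ∧ s₁.ireg 3 = s.ireg 3 ∧ s₁.ireg 8 = n - 1 ∧
      s₁.ireg 9 = 2 ∧ s₁.ireg 10 = 0 := by
    simp [hs₁, exec, Instr.apply, Store.setI, h0]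
  obtain ⟨b0, b1, b3, b8, b9, b10⟩ := a2
  clear_value s₁
  -- The set of remaining vertices is part of the loop state because the potential sums their list
  -- lengths, while the order of removal only emerges during the run.
  have hloop := Ensures.loop (T := .intLt 1 8) (p := elimBody) (ElimInv n H off tgt ε)
    (fun a => 17 * ∑ x ∈ a.2, (off (x + 1) - off x) + 12 * a.2.card) (by
    rintro ⟨h, R⟩ s' hI hT
    have hR : R = rest (s'.iarr 3) n h := hI.2.2.2.2.2.1
    subst hR
    have hlt : h + 1 < n := by
      simp only [Test.Holds] at hT
      rw [hI.2.1, hI.2.2.1] at hT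
      dsimp only at hT
      omega
    have hw := hI.2.2.2.2.2.2.head_mem.1
    dsimp only at hw
    refine ⟨_, _, ?_, elimBody_ensures L hlt hI⟩
    dsimp only
    rw [rest_succ, Finset.card_erase_of_mem hw,
      ← Finset.add_sum_erase _ (fun x => off (x + 1) - off x) hw]
    have : 0 < (rest (s'.iarr 3) n h).card := Finset.card_pos.2 ⟨_, hw⟩
    omega) (0, Finset.range n) s₁
    (by
      refine ⟨⟨b0, by rw [a0, h1], by rw [a0, h2], by rw [a1, h3]⟩, b1, b8, b9, b10,
        (rest_zero _ _).symm, ?_⟩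
      rw [a0, b3]
      refine ⟨by omega, ?_, ?_, ?_, ?_, by simp, by simp⟩
      · convert hq using 1
        ext x
        simp only [rest_zero, Finset.mem_range, Set.mem_ofPred_eq]
        exact and_congr_right fun hx => by rw [hdeg x hx]
      · intro x hx
        rw [rest_zero, Finset.mem_range] at hx
        rw [rest_zero, L.card_nbrsIn_range hx, hdeg x hx]
      · intro x hx hxR
        rw [rest_zero, Finset.mem_range] at hxR
        exact absurd hx hxR
      · intro _
        rw [rest_zero]; exact hH)
  refine Ensures.seq (hloop.mono ?_ fun _ h => h) ?_
  · simp [L.sum_len]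
  rintro s₂ ⟨⟨h, R⟩, ⟨⟨g0, g1, g2, g3⟩, g4, g5, g6, g7, -, hE⟩, hT⟩
  dsimp only at g4 hE
  simp only [Test.Holds, g4, g5] at hT
  have hlt := hE.lt
  have hh : h = n - 1 := by omega
  subst hh
  have hw := hE.head_mem.1
  refine Ensures.block ?_
  simp only [exec, Instr.apply, Store.setI]
  refine ⟨⟨?_, ?_, ?_, g3⟩, ?_, ?_, ?_, ?_⟩
  · simp [g0]
  · simp [g1]
  · simp [g2]
  · simp [g4]
  · simp only [ne_eq, Nat.reduceEqDiff, not_false_eq_true, Function.update_of_ne]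
    intro i hi
    by_cases h5 : i = n - 1
    · subst h5; exact hw
    · exact (hE.parents i (by omega)).mem
  · intro i hi
    simpa using hE.parents i (by omega)
  · intro i hi
    simp only [ne_eq, Nat.reduceEqDiff, not_false_eq_true, Function.update_of_ne,
      Function.update_self, g4, OfNat.one_ne_ofNat]
    by_cases h5 : i = n - 1
    · subst h5; simp
    · rw [Function.update_of_ne ((mem_rest.1 hw).2 i (by omega))]
      exact hE.rank i (by omega)

end EliminationProgram

end RealRAM

namespace RealRAM

/-! ### Computation of the new points and edge data. -/

section Coordinates

/-- The coordinate `K` of the new vertex `ireg 5` and of the three new apices, for an edge whose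
region is confined (`ext = false`) or extended (`ext = true`). -/
def coordBlock (ext : Bool) (K : ℕ) : List Instr :=
  [.realLoad 3 K 24, .realLoad 4 K 25, .realLoad 5 (K + 2) 22, .realAdd 6 3 4, .realMul 6 2 6,
    .realSub 7 5 6, .realMul 7 (bif ext then 10 else 1) 7, .realAdd 6 6 7,
    .realSub 7 6 4, .realMul 7 (bif ext then 11 else 1) 7, .realAdd 7 4 7,
    .realCopy 8 (bif ext then 4 else 6), .realSub 9 5 8, .realMul 9 1 9, .realAdd 8 8 9,
    .realStore K 5 6, .realStore (K + 2) 22 7, .realStore (K + 2) 27 5, .realStore (K + 2) 28 8]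

/-- The registers that hold the numbers the program computes with. -/
def HoldsConstants (τ : ℝ) (s : Store) : Prop :=
  s.rreg 1 = τ ∧ s.rreg 2 = 1 / 2 ∧ s.rreg 10 = 1 - τ ∧ s.rreg 11 = 1

theorem exec_append (l l' : List Instr) (s : Store) : exec (l ++ l') s = exec l' (exec l s) := by
  induction l generalizing s with
  | nil => rfl
  | cons i l ih => exact ih _

/-- The old apex is read before its cell is overwritten, so all new values are expressed by the
store before the block. -/
theorem coordBlock_spec (ext : Bool) (K : ℕ) {τ : ℝ} {s : Store} (hc : HoldsConstants τ s)
    {W : ℝ} (hW : W = 1 / 2 * (s.rarr K (s.ireg 24) + s.rarr K (s.ireg 25)) +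
      insertWeight τ ext * (s.rarr (K + 2) (s.ireg 22) -
        1 / 2 * (s.rarr K (s.ireg 24) + s.rarr K (s.ireg 25)))) :
    (exec (coordBlock ext K) s).ireg = s.ireg ∧ (exec (coordBlock ext K) s).iarr = s.iarr ∧
    (exec (coordBlock ext K) s).rreg 0 = s.rreg 0 ∧
    HoldsConstants τ (exec (coordBlock ext K) s) ∧
    (∀ M, M ≠ K → M ≠ K + 2 → (exec (coordBlock ext K) s).rarr M = s.rarr M) ∧
    (exec (coordBlock ext K) s).rarr K = Function.update (s.rarr K) (s.ireg 5) W ∧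
    (exec (coordBlock ext K) s).rarr (K + 2) =
      Function.update (Function.update (Function.update (s.rarr (K + 2)) (s.ireg 22)
        (s.rarr K (s.ireg 25) + (bif ext then 1 else τ) * (W - s.rarr K (s.ireg 25))))
        (s.ireg 27) (s.rarr (K + 2) (s.ireg 22)))
        (s.ireg 28) ((bif ext then s.rarr K (s.ireg 25) else W) +
          τ * (s.rarr (K + 2) (s.ireg 22) - bif ext then s.rarr K (s.ireg 25) else W)) := by
  obtain ⟨h1, h2, h3, h4⟩ := hc
  subst hW
  cases ext
  · refine ⟨?_, ?_, ?_, ?_, ?_, ?_, ?_⟩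
    · simp [coordBlock, exec, Instr.apply, Store.setR]
    · simp [coordBlock, exec, Instr.apply, Store.setR]
    · simp [coordBlock, exec, Instr.apply, Store.setR]
    · simp [HoldsConstants, coordBlock, exec, Instr.apply, Store.setR, h1, h2, h3, h4]
    · intro M hM hM'
      simp [coordBlock, exec, Instr.apply, Store.setR, hM, hM']
    · simp [coordBlock, exec, Instr.apply, Store.setR, h1, h2, insertWeight]
    · simp [coordBlock, exec, Instr.apply, Store.setR, h1, h2, insertWeight]
  · refine ⟨?_, ?_, ?_, ?_, ?_, ?_, ?_⟩
    · simp [coordBlock, exec, Instr.apply, Store.setR]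
    · simp [coordBlock, exec, Instr.apply, Store.setR]
    · simp [coordBlock, exec, Instr.apply, Store.setR]
    · simp [HoldsConstants, coordBlock, exec, Instr.apply, Store.setR, h1, h2, h3, h4]
    · intro M hM hM'
      simp [coordBlock, exec, Instr.apply, Store.setR, hM, hM']
    · simp [coordBlock, exec, Instr.apply, Store.setR, h2, h3, insertWeight]
    · simp [coordBlock, exec, Instr.apply, Store.setR, h1, h2, h3, h4, insertWeight]

/-- The combinatorial part of the data of the new edges. -/
def linkBlock (ext : Bool) : List Instr :=
  [.intStore 7 27 24, .intStore 8 27 5, .intStore 9 27 (bif ext then 30 else 29),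
    .intStore 7 28 (bif ext then 5 else 25), .intStore 8 28 (bif ext then 25 else 5),
    .intStore 9 28 30]

/-- Insertion of the vertex `ireg 5` in the region of the edge number `ireg 22`; the new edges get
the numbers `ireg 27` and `ireg 28`. -/
def insertBlock (ext : Bool) : List Instr := coordBlock ext 0 ++ (coordBlock ext 1 ++ linkBlock ext)

/-- The point stored for a vertex. -/
noncomputable def point (s : Store) (x : ℕ) : Plane := !₂[s.rarr 0 x, s.rarr 1 x]

/-- The data stored for an edge. -/
noncomputable def edgeData (s : Store) (j : ℕ) : EdgeData ℕ :=
  ⟨s.iarr 7 j, s.iarr 8 j, decide (s.iarr 9 j ≠ 0), !₂[s.rarr 2 j, s.rarr 3 j]⟩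

/-- The link between machine and geometry: the stores have the effect of the updates in
`Extensible.insert_update`. The two coordinates live in separate arrays, so the second pass still
sees its original data. -/
theorem insertBlock_spec {ext : Bool} {τ : ℝ} {s : Store} (hc : HoldsConstants τ s)
    (h29 : s.ireg 29 = 1) (h30 : s.ireg 30 = 0) {r : EdgeData ℕ}
    (hr : edgeData s (s.ireg 22) = r) (hext : r.ext = ext) (hu : s.ireg 24 = r.u)
    (hv : s.ireg 25 = r.v) {P : Plane}
    (hP : P = insertPoint (insertWeight τ r.ext) (point s r.u) (point s r.v) r.q) :
    (exec (insertBlock ext) s).ireg = s.ireg ∧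
    (∀ k < 7, (exec (insertBlock ext) s).iarr k = s.iarr k) ∧
    (exec (insertBlock ext) s).rreg 0 = s.rreg 0 ∧ HoldsConstants τ (exec (insertBlock ext) s) ∧
    point (exec (insertBlock ext) s) = Function.update (point s) (s.ireg 5) P ∧
    edgeData (exec (insertBlock ext) s) = Function.update (Function.update (Function.update
      (edgeData s) (s.ireg 22) (r.base τ (point s r.v) P)) (s.ireg 27) (r.left (s.ireg 5)))
      (s.ireg 28) (r.right τ (point s r.v) P (s.ireg 5)) := by
  have hq : r.q = !₂[s.rarr 2 (s.ireg 22), s.rarr 3 (s.ireg 22)] := by rw [← hr]; rfl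
  have hru : s.iarr 7 (s.ireg 22) = r.u := by rw [← hr]; rfl
  have hrv : s.iarr 8 (s.ireg 22) = r.v := by rw [← hr]; rfl
  have hre : decide (s.iarr 9 (s.ireg 22) ≠ 0) = ext := by rw [← hext, ← hr]; rfl
  have hP0 : P 0 = 1 / 2 * (s.rarr 0 (s.ireg 24) + s.rarr 0 (s.ireg 25)) +
      insertWeight τ ext * (s.rarr 2 (s.ireg 22) -
        1 / 2 * (s.rarr 0 (s.ireg 24) + s.rarr 0 (s.ireg 25))) := by
    rw [hP, hq, hext, hu, hv]; simp [insertPoint, point]; ring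
  have hP1 : P 1 = 1 / 2 * (s.rarr 1 (s.ireg 24) + s.rarr 1 (s.ireg 25)) +
      insertWeight τ ext * (s.rarr 3 (s.ireg 22) -
        1 / 2 * (s.rarr 1 (s.ireg 24) + s.rarr 1 (s.ireg 25))) := by
    rw [hP, hq, hext, hu, hv]; simp [insertPoint, point]; ring
  have hPP : P = !₂[P 0, P 1] := by
    ext i; fin_cases i <;> rfl
  rw [insertBlock, exec_append, exec_append]
  obtain ⟨a1, a2, a3, a4, a5, a6, a7⟩ := coordBlock_spec ext 0 hc hP0
  set s₁ := exec (coordBlock ext 0) s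
  obtain ⟨b1, b2, b3, b4, b5, b6, b7⟩ := coordBlock_spec ext 1 (s := s₁) a4 (W := P 1) (by
    rw [a1, a5 1 (by norm_num) (by norm_num), a5 3 (by norm_num) (by norm_num)]; exact hP1)
  set s₂ := exec (coordBlock ext 1) s₁
  have c0 : s₂.rarr 0 = Function.update (s.rarr 0) (s.ireg 5) (P 0) := by
    rw [b5 0 (by norm_num) (by norm_num), a6]
  have c1 : s₂.rarr 1 = Function.update (s.rarr 1) (s.ireg 5) (P 1) := by
    rw [b6, a1, a5 1 (by norm_num) (by norm_num)]
  have c2 := b5 2 (by norm_num) (by norm_num)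
  simp only [zero_add] at a7
  simp only [Nat.reduceAdd, a1, a5 1 (by norm_num) (by norm_num),
    a5 3 (by norm_num) (by norm_num)] at b7
  rw [a7] at c2
  have d1 : s₂.ireg = s.ireg := b1.trans a1
  have d2 : s₂.iarr = s.iarr := b2.trans a2
  have d3 : s₂.rreg 0 = s.rreg 0 := b3.trans a3
  clear_value s₁ s₂
  have e1 : (exec (linkBlock ext) s₂).ireg = s₂.ireg := by
    simp [linkBlock, exec, Instr.apply]
  have e2 : (exec (linkBlock ext) s₂).rreg = s₂.rreg := by
    simp [linkBlock, exec, Instr.apply]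
  have e3 : (exec (linkBlock ext) s₂).rarr = s₂.rarr := by
    simp [linkBlock, exec, Instr.apply]
  have e4 : ∀ k < 7, (exec (linkBlock ext) s₂).iarr k = s₂.iarr k := by
    intro k hk
    simp [linkBlock, exec, Instr.apply, show k ≠ 7 by omega, show k ≠ 8 by omega,
      show k ≠ 9 by omega]
  have e5 : (exec (linkBlock ext) s₂).iarr 7 = Function.update (Function.update (s.iarr 7)
      (s.ireg 27) r.u) (s.ireg 28) (bif ext then s.ireg 5 else r.v) := by
    cases ext <;> simp [linkBlock, exec, Instr.apply, d1, d2, hu, hv]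
  have e6 : (exec (linkBlock ext) s₂).iarr 8 = Function.update (Function.update (s.iarr 8)
      (s.ireg 27) (s.ireg 5)) (s.ireg 28) (bif ext then r.v else s.ireg 5) := by
    cases ext <;> simp [linkBlock, exec, Instr.apply, d1, d2, hv]
  have e7 : (exec (linkBlock ext) s₂).iarr 9 = Function.update (Function.update (s.iarr 9)
      (s.ireg 27) (bif ext then 0 else 1)) (s.ireg 28) 0 := by
    cases ext <;> simp [linkBlock, exec, Instr.apply, d1, d2, h29, h30]
  refine ⟨e1.trans d1, fun k hk => (e4 k hk).trans (by rw [d2]), by rw [e2, d3], ?_, ?_, ?_⟩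
  · rw [HoldsConstants, e2]; exact b4
  · funext x
    rw [point, e3, c0, c1]
    by_cases hx : x = s.ireg 5
    · subst hx; simp only [Function.update_self]; exact hPP.symm
    · simp only [Function.update_of_ne hx]; rfl
  · funext j
    rw [edgeData, e3, c2, b7, e5, e6, e7]
    by_cases hj3 : j = s.ireg 28
    · subst hj3
      simp only [Function.update_self]
      cases ext
      · simp only [EdgeData.right, hext, cond_false, hq]
        congr 1
        ext i; fin_cases i <;> simp
      · simp only [EdgeData.right, hext, cond_true, hq, hv, point]
        congr 1
        ext i; fin_cases i <;> simp
    · simp only [Function.update_of_ne hj3]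
      by_cases hj2 : j = s.ireg 27
      · subst hj2
        simp only [Function.update_self, EdgeData.left, hext, hq]
        cases ext <;> simp
      · simp only [Function.update_of_ne hj2]
        by_cases hj1 : j = s.ireg 22
        · subst hj1
          simp only [Function.update_self, EdgeData.base, hru, hrv, hre, hext, hv, point]
          congr 1
          cases ext
          · ext i; fin_cases i <;> simp
          · ext i; fin_cases i <;> simp
        · simp only [Function.update_of_ne hj1]; rfl

end Coordinates

end RealRAM

namespace RealRAM

/-! ### Reinsertion in reverse order, and the complete algorithm. -/

section InsertionProgram

variable {n : ℕ} {H : SimpleGraph ℕ} {off tgt ord e₀ e₁ rk : ℕ → ℕ}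

/-- Each of the `n` entries of the order was still present when removed, so together they exhaust
the vertices. -/
theorem Eliminated.exists_index (hE : Eliminated H n off tgt ord e₀ e₁ rk) {h x : ℕ}
    (hx : x ∈ rest ord n h) : ∃ i, h ≤ i ∧ i < n ∧ ord i = x := by
  have hc := card_rest (h := n) hE.mem
  have hx' : x ∉ rest ord n n := by
    rw [Finset.card_eq_zero.1 (show (rest ord n n).card = 0 by omega)]; simp
  rw [mem_rest] at hx hx'
  push Not at hx'
  obtain ⟨k, hk, rfl⟩ := hx' hx.1
  refine ⟨k, ?_, hk, rfl⟩
  by_contra h1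
  exact hx.2 k (by omega) rfl

theorem Eliminated.mem_rest_iff (hE : Eliminated H n off tgt ord e₀ e₁ rk) {h x : ℕ} :
    x ∈ rest ord n h ↔ x < n ∧ h ≤ rk x := by
  constructor
  · intro hx
    obtain ⟨i, h1, h2, rfl⟩ := hE.exists_index hx
    exact ⟨(mem_rest.1 hx).1, by rwa [hE.rank i h2]⟩
  · rintro ⟨h1, h2⟩
    refine mem_rest.2 ⟨h1, ?_⟩
    rintro k hk rfl
    obtain ⟨i, -, h3, h4⟩ := hE.exists_index (h := 0) (x := ord k) (mem_rest.2 ⟨h1, by simp⟩)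
    rw [← h4, hE.rank i h3] at h2
    exact (mem_rest.1 (hE.mem i h3)).2 k (by omega) h4.symm

theorem Eliminated.ord_rank (hE : Eliminated H n off tgt ord e₀ e₁ rk) {x : ℕ} (hx : x < n) :
    ord (rk x) = x ∧ rk x < n := by
  obtain ⟨i, -, h3, rfl⟩ := hE.exists_index (h := 0) (x := x) (mem_rest.2 ⟨hx, by simp⟩)
  rw [hE.rank i h3]
  exact ⟨rfl, h3⟩

/-- Later neighbours are among the recorded ones. If fewer than two vertices follow `c`, only `e₀`
counts, and `o` and its target are both the last vertex. -/
theorem Eliminated.tgt_eq (hE : Eliminated H n off tgt ord e₀ e₁ rk) {c o : ℕ} (hc : c < n)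
    (ho : o < n) (hco : H.Adj c o) (hr : rk c < rk o) : tgt (e₀ c) = o ∨
      (rk c + 2 < n ∧ tgt (e₁ c) = o) := by
  obtain ⟨h1, h2⟩ := hE.ord_rank hc
  obtain ⟨h3, h4⟩ := hE.ord_rank ho
  have hp := hE.parents (rk c) (by omega)
  have ho' : o ∈ rest ord n (rk c + 1) := hE.mem_rest_iff.2 ⟨ho, hr⟩
  by_cases h5 : rk c + 2 < n
  · rcases hp.only h5 o ho' (by rwa [h1]) with h | h
    · left; rw [h, h1]
    · right; exact ⟨h5, by rw [h, h1]⟩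
  · left
    have h6 := hp.mem₀
    rw [h1] at h6
    obtain ⟨h7, h8⟩ := hE.mem_rest_iff.1 h6
    obtain ⟨h9, h10⟩ := hE.ord_rank h7
    rw [← h9, ← h3]
    congr 1
    omega

/-- The number of the edge between `c` and a later neighbour `o`. -/
theorem Eliminated.position (hE : Eliminated H n off tgt ord e₀ e₁ rk) {c o : ℕ} (hc : c < n)
    (ho : o < n) (hco : H.Adj c o) (hr : rk c < rk o) {i : ℕ}
    (hi : i = if tgt (e₀ c) = o then e₀ c else e₁ c) :
    off c ≤ i ∧ i < off (c + 1) ∧ tgt i = o := by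
  obtain ⟨h1, h2⟩ := hE.ord_rank hc
  obtain ⟨h3, h4⟩ := hE.ord_rank ho
  have hp := hE.parents (rk c) (by omega)
  have h5 := hE.tgt_eq hc ho hco hr
  split_ifs at hi with h6
  · subst hi
    have h7 := hp.le₀
    have h8 := hp.lt₀
    rw [h1] at h7 h8
    exact ⟨h7, h8, h6⟩
  · subst hi
    rcases h5 with h5 | ⟨h5, h5'⟩
    · exact absurd h5 h6
    · have h7 := hp.le₁ h5
      have h8 := hp.lt₁ h5
      rw [h1] at h7 h8
      exact ⟨h7, h8, h5'⟩

/-- The data of the edges within `S` are stored at their positions. -/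
def Stores (off tgt rk : ℕ → ℕ) (S : Finset ℕ) (d : ℕ → EdgeData ℕ) (D : Sym2 ℕ → EdgeData ℕ) :
    Prop :=
  ∀ c ∈ S, ∀ j, off c ≤ j → j < off (c + 1) → tgt j ∈ S → rk c < rk (tgt j) → d j = D s(c, tgt j)

/-- An edge is kept at one position only, in the list of its end of lower rank. Lists neither
overlap nor repeat entries, so positions and edges correspond one to one, and updating the three
numbers amounts to updating the three edges. -/
theorem Stores.insert (L : ListsFor n H off tgt) (hE : Eliminated H n off tgt ord e₀ e₁ rk)
    {h : ℕ} (hn : h + 2 < n) {d : ℕ → EdgeData ℕ} {D : Sym2 ℕ → EdgeData ℕ}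
    (hS : Stores off tgt rk (rest ord n (h + 1)) d D) {c o i iu iv : ℕ}
    (hc : c ∈ rest ord n (h + 1)) (ho : o ∈ rest ord n (h + 1)) (hco : rk c < rk o)
    (hi : off c ≤ i ∧ i < off (c + 1) ∧ tgt i = o)
    (hj : iu = e₀ (ord h) ∧ iv = e₁ (ord h) ∨ iu = e₁ (ord h) ∧ iv = e₀ (ord h))
    {r₀ r₁ r₂ : EdgeData ℕ} :
    Stores off tgt rk (rest ord n h)
      (Function.update (Function.update (Function.update d i r₀) iu r₁) iv r₂)
      (Function.update (Function.update (Function.update D s(c, o) r₀) s(tgt iu, ord h) r₁)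
        s(tgt iv, ord h) r₂) := by
  have hp := hE.parents h (by omega)
  have hw := hE.mem h (by omega)
  have hwn := (mem_rest.1 hw).1
  have hrw := hE.rank h (by omega)
  have hiu : off (ord h) ≤ iu ∧ iu < off (ord h + 1) := by
    rcases hj with ⟨rfl, -⟩ | ⟨rfl, -⟩
    · exact ⟨hp.le₀, hp.lt₀⟩
    · exact ⟨hp.le₁ hn, hp.lt₁ hn⟩
  have hiv : off (ord h) ≤ iv ∧ iv < off (ord h + 1) := by
    rcases hj with ⟨-, rfl⟩ | ⟨-, rfl⟩
    · exact ⟨hp.le₁ hn, hp.lt₁ hn⟩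
    · exact ⟨hp.le₀, hp.lt₀⟩
  have hne : iu ≠ iv := by
    rcases hj with ⟨rfl, rfl⟩ | ⟨rfl, rfl⟩
    · exact hp.ne hn
    · exact (hp.ne hn).symm
  have hnt : tgt iu ≠ tgt iv := fun h1 => hne (L.inj _ hwn hiu hiv h1)
  have hwc : c ≠ ord h := by
    rintro rfl
    have := (hE.mem_rest_iff.1 hc).2
    omega
  have hwo : o ≠ ord h := by
    rintro rfl
    have := (hE.mem_rest_iff.1 ho).2
    omega
  obtain ⟨hcn, hch⟩ := hE.mem_rest_iff.1 hc
  intro c' hc' j hj1 hj2 hjS hjr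
  obtain ⟨hcn', hch'⟩ := hE.mem_rest_iff.1 hc'
  obtain ⟨hjn, hjh⟩ := hE.mem_rest_iff.1 hjS
  by_cases hcw : c' = ord h
  · subst hcw
    have hadj := (L.target_lt hwn hj1 hj2).1
    have hjR : tgt j ∈ rest ord n (h + 1) := hE.mem_rest_iff.2 ⟨hjn, by omega⟩
    have hji : j = iu ∨ j = iv := by
      have h1 : tgt j = tgt iu ∨ tgt j = tgt iv := by
        rcases hj with ⟨rfl, rfl⟩ | ⟨rfl, rfl⟩
        · exact hp.only hn _ hjR hadj
        · exact (hp.only hn _ hjR hadj).symm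
      rcases h1 with h1 | h1
      · exact Or.inl (L.inj _ hwn ⟨hj1, hj2⟩ hiu h1)
      · exact Or.inr (L.inj _ hwn ⟨hj1, hj2⟩ hiv h1)
    rcases hji with rfl | rfl
    · have e : s(ord h, tgt j) = s(tgt j, ord h) := Sym2.eq_swap
      have hq : s(tgt j, ord h) ≠ s(tgt iv, ord h) := by
        simp only [ne_eq, Sym2.eq_iff]
        have := hadj.ne
        tauto
      rw [e, Function.update_of_ne hne, Function.update_self, Function.update_of_ne hq,
        Function.update_self]
    · have e : s(ord h, tgt j) = s(tgt j, ord h) := Sym2.eq_swap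
      rw [e, Function.update_self, Function.update_self]
  · have hclt : h + 1 ≤ rk c' := by
      rcases hch'.eq_or_lt with h1 | h1
      · exact absurd (by rw [h1]; exact (hE.ord_rank hcn').1.symm) hcw
      · exact h1
    have hju : j ≠ iu := by
      rintro rfl
      exact hcw (L.owner_unique hcn' hwn hj1 hj2 hiu.1 hiu.2)
    have hjv : j ≠ iv := by
      rintro rfl
      exact hcw (L.owner_unique hcn' hwn hj1 hj2 hiv.1 hiv.2)
    have hjw : tgt j ≠ ord h := by
      intro h1
      rw [h1] at hjr
      omega
    have hqu : s(c', tgt j) ≠ s(tgt iu, ord h) := by simp only [ne_eq, Sym2.eq_iff]; tauto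
    have hqv : s(c', tgt j) ≠ s(tgt iv, ord h) := by simp only [ne_eq, Sym2.eq_iff]; tauto
    rw [Function.update_of_ne hjv, Function.update_of_ne hju, Function.update_of_ne hqv,
      Function.update_of_ne hqu]
    by_cases hji : j = i
    · subst hji
      have hcc : c' = c := L.owner_unique hcn' hcn hj1 hj2 hi.1 hi.2.1
      rw [Function.update_self, hcc, hi.2.2, Function.update_self]
    · have hq : s(c', tgt j) ≠ s(c, o) := by
        intro h1
        rcases Sym2.eq_iff.1 h1 with ⟨rfl, h2⟩ | ⟨rfl, h2⟩
        · exact hji (L.inj _ hcn' ⟨hj1, hj2⟩ ⟨hi.1, hi.2.1⟩ (h2.trans hi.2.2.symm))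
        · rw [h2] at hjr
          omega
      rw [Function.update_of_ne hji, Function.update_of_ne hq]
      exact hS c' (hE.mem_rest_iff.2 ⟨hcn', hclt⟩) j hj1 hj2
        (hE.mem_rest_iff.2 ⟨hjn, by omega⟩) hjr

/-- Reinsert the vertex before the current one in the order of elimination. -/
def insertBody : Program :=
  .seq (block [.intPred 1, .intLoad 5 3 1, .intLoad 14 4 5, .intLoad 15 5 5, .intLoad 16 1 14,
    .intLoad 17 1 15, .intLoad 18 6 16, .intLoad 19 6 17])
  (.seq (.cond (.intLt 18 19) (block [.intCopy 20 16, .intCopy 21 17])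
    (block [.intCopy 20 17, .intCopy 21 16]))
  (.seq (block [.intLoad 22 4 20, .intLoad 23 1 22])
  (.seq (.cond (.intEq 23 21) (block []) (block [.intLoad 22 5 20]))
  (.seq (block [.intLoad 24 7 22, .intLoad 25 8 22, .intLoad 26 9 22])
  (.seq (.cond (.intEq 24 16) (block [.intCopy 27 14, .intCopy 28 15])
    (block [.intCopy 27 15, .intCopy 28 14]))
  (.cond (.intEq 26 30) (block (insertBlock false)) (block (insertBlock true))))))))

/-- Draw the last two vertices of the order of elimination. -/
def baseBlock : List Instr :=
  [.realOfInt 1 0, .realConst 2 8, .realAdd 2 2 0, .realConst 3 12, .realMul 2 2 3,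
    .realMul 2 2 1, .realDiv 1 0 2, .realConst 11 1, .realConst 2 2, .realDiv 2 11 2,
    .realSub 10 11 1, .intConst 29 1, .intConst 30 0, .intLoad 5 3 1, .intPred 1, .intLoad 20 3 1,
    .intLoad 22 4 20, .intStore 7 22 20, .intStore 8 22 5, .intStore 9 22 30, .realConst 3 0,
    .realStore 0 20 3, .realStore 1 20 3, .realStore 0 5 11, .realStore 1 5 3, .realStore 2 22 11,
    .realStore 3 22 1]

def insertPhase : Program :=
  .seq (block baseBlock) (.loop (.intLt 30 1) insertBody)

/-- The loop invariant of the insertion phase. -/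
def InsertInv (H : SimpleGraph ℕ) (n : ℕ) (off tgt ord e₀ e₁ rk : ℕ → ℕ) (ε τ : ℝ) (h : ℕ)
    (s : Store) : Prop :=
  HoldsInput n off tgt ε s ∧ s.ireg 1 = h ∧ s.ireg 29 = 1 ∧ s.ireg 30 = 0 ∧
  HoldsConstants τ s ∧ (s.iarr 3 = ord ∧ s.iarr 4 = e₀ ∧ s.iarr 5 = e₁ ∧ s.iarr 6 = rk) ∧
  h + 2 ≤ n ∧ ∃ lam D, Extensible H τ (12 * τ * (n - 2 - h)) (rest ord n h) (point s) lam D ∧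
    Stores off tgt rk (rest ord n h) (edgeData s) D

theorem insertBlock_length (ext : Bool) : (insertBlock ext).length = 44 := rfl

/-- The parent edge is found in constant time: of its two ends, the one of lower rank has the other
among its at most two recorded neighbours, and that position is the number of the edge. -/
theorem insertBody_ensures (L : ListsFor n H off tgt)
    (hE : Eliminated H n off tgt ord e₀ e₁ rk) {ε τ : ℝ} (hτ : 0 < τ) (hτn : 12 * τ * n ≤ 1)
    {h : ℕ} {s : Store} (hI : InsertInv H n off tgt ord e₀ e₁ rk ε τ (h + 1) s) :
    Ensures insertBody s 80 (InsertInv H n off tgt ord e₀ e₁ rk ε τ h) := by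
  obtain ⟨⟨i0, i1, i2, i3⟩, r1, r29, r30, hc, ⟨k3, k4, k5, k6⟩, hn, lam, D, hX, hS⟩ := hI
  have hw := hE.mem h (by omega)
  have hwn := (mem_rest.1 hw).1
  have hp := hE.parents h (by omega)
  have hn' : h + 2 < n := by omega
  set w := ord h with hwdef
  set a := tgt (e₀ w) with ha
  set b := tgt (e₁ w) with hb
  have hamem : a ∈ rest ord n (h + 1) := hp.mem₀
  have hbmem : b ∈ rest ord n (h + 1) := hp.mem₁ hn'
  obtain ⟨han, har⟩ := hE.mem_rest_iff.1 hamem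
  obtain ⟨hbn, hbr⟩ := hE.mem_rest_iff.1 hbmem
  have hab : H.Adj a b := hp.adj hn'
  have hwa := (L.target_lt hwn hp.le₀ hp.lt₀).1
  have hwb := (L.target_lt hwn (hp.le₁ hn') (hp.lt₁ hn')).1
  have hrab : rk a ≠ rk b := by
    intro h1
    apply hab.ne
    rw [← (hE.ord_rank han).1, ← (hE.ord_rank hbn).1, h1]
  have hwS : w ∉ rest ord n (h + 1) := by rw [rest_succ]; simp [← hwdef]
  have hins : rest ord n h = insert w (rest ord n (h + 1)) := by
    rw [rest_succ, Finset.insert_erase hw]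
  refine Ensures.mono (B := 9 + ((1 + 3) + (3 + ((1 + 2) + (4 + ((1 + 3) + (1 + 45)))))))
    ?_ (by norm_num) fun _ h => h
  refine Ensures.block_seq ?_
  set s₁ := exec [.intPred 1, .intLoad 5 3 1, .intLoad 14 4 5, .intLoad 15 5 5, .intLoad 16 1 14,
    .intLoad 17 1 15, .intLoad 18 6 16, .intLoad 19 6 17] s with hs₁
  have a0 : s₁.iarr = s.iarr ∧ s₁.rreg = s.rreg ∧ s₁.rarr = s.rarr := by
    simp [hs₁, exec, Instr.apply, Store.setI]
  have a1 : s₁.ireg 0 = n ∧ s₁.ireg 1 = h ∧ s₁.ireg 5 = w ∧ s₁.ireg 14 = e₀ w ∧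
      s₁.ireg 15 = e₁ w ∧ s₁.ireg 16 = a ∧ s₁.ireg 17 = b ∧ s₁.ireg 18 = rk a ∧
      s₁.ireg 19 = rk b ∧ s₁.ireg 29 = 1 ∧ s₁.ireg 30 = 0 := by
    simp [hs₁, exec, Instr.apply, Store.setI, i0, i2, r1, r29, r30, k3, k4, k5, k6, ← hwdef, ← ha,
      ← hb]
  obtain ⟨a2, a3, a4⟩ := a0
  obtain ⟨b0, b1, b5, b14, b15, b16, b17, b18, b19, b29, b30⟩ := a1
  clear_value s₁
  -- the older and the younger end of the parent edge
  refine Ensures.seq (Q := fun s₂ => ∃ c o, (c = a ∧ o = b ∨ c = b ∧ o = a) ∧ rk c < rk o ∧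
    (s₂.iarr = s.iarr ∧ s₂.rreg = s.rreg ∧ s₂.rarr = s.rarr) ∧ s₂.ireg 20 = c ∧ s₂.ireg 21 = o ∧
    ∀ k < 20, s₂.ireg k = s₁.ireg k ∧ s₂.ireg (k + 22) = s₁.ireg (k + 22)) (Ensures.cond ?_ ?_) ?_
  · intro hT
    simp only [Test.Holds, b18, b19] at hT
    refine Ensures.block ⟨a, b, Or.inl ⟨rfl, rfl⟩, hT, ?_, ?_, ?_, ?_⟩
    · simp [exec, Instr.apply, Store.setI, a2, a3, a4]
    · simp [exec, Instr.apply, Store.setI, b16]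
    · simp [exec, Instr.apply, Store.setI, b17]
    · intro k hk
      simp [exec, Instr.apply, Store.setI, show k ≠ 20 by omega, show k ≠ 21 by omega]
  · intro hT
    simp only [Test.Holds, b18, b19] at hT
    refine Ensures.block ⟨b, a, Or.inr ⟨rfl, rfl⟩, by omega, ?_, ?_, ?_, ?_⟩
    · simp [exec, Instr.apply, Store.setI, a2, a3, a4]
    · simp [exec, Instr.apply, Store.setI, b17]
    · simp [exec, Instr.apply, Store.setI, b16]
    · intro k hk
      simp [exec, Instr.apply, Store.setI, show k ≠ 20 by omega, show k ≠ 21 by omega]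
  rintro s₂ ⟨c, o, hcoab, hrco, ⟨c1, c2, c3⟩, c20, c21, cc⟩
  have hcm : c ∈ rest ord n (h + 1) := by rcases hcoab with ⟨rfl, rfl⟩ | ⟨rfl, rfl⟩ <;> assumption
  have hom : o ∈ rest ord n (h + 1) := by rcases hcoab with ⟨rfl, rfl⟩ | ⟨rfl, rfl⟩ <;> assumption
  have hco : H.Adj c o := by
    rcases hcoab with ⟨rfl, rfl⟩ | ⟨rfl, rfl⟩
    · exact hab
    · exact hab.symm
  have hcn := (mem_rest.1 hcm).1
  have hon := (mem_rest.1 hom).1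
  -- the position of the parent edge
  refine Ensures.block_seq ?_
  set s₃ := exec [.intLoad 22 4 20, .intLoad 23 1 22] s₂ with hs₃
  have d0 : s₃.iarr = s.iarr ∧ s₃.rreg = s.rreg ∧ s₃.rarr = s.rarr := by
    simp [hs₃, exec, Instr.apply, Store.setI, c1, c2, c3]
  have d1 : s₃.ireg 22 = e₀ c ∧ s₃.ireg 23 = tgt (e₀ c) ∧ s₃.ireg 20 = c ∧ s₃.ireg 21 = o := by
    simp [hs₃, exec, Instr.apply, Store.setI, c1, c20, c21, k4, i2]
  have d2 : ∀ k, k < 20 → s₃.ireg k = s₁.ireg k ∧ (2 ≤ k → s₃.ireg (k + 22) = s₁.ireg (k + 22)) := by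
    intro k hk
    rw [← (cc k hk).1, ← (cc k hk).2]
    constructor
    · simp [hs₃, exec, Instr.apply, Store.setI, show k ≠ 22 by omega, show k ≠ 23 by omega]
    · intro hk2
      simp [hs₃, exec, Instr.apply, Store.setI, show k ≠ 0 by omega, show k ≠ 1 by omega]
  obtain ⟨d3, d4, d5⟩ := d0
  obtain ⟨d22, d23, d20, d21⟩ := d1
  clear_value s₃
  refine Ensures.seq (Q := fun s₄ => (s₄.iarr = s.iarr ∧ s₄.rreg = s.rreg ∧ s₄.rarr = s.rarr) ∧
    s₄.ireg 22 = (if tgt (e₀ c) = o then e₀ c else e₁ c) ∧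
    ∀ k < 20, s₄.ireg k = s₁.ireg k ∧ (2 ≤ k → s₄.ireg (k + 22) = s₁.ireg (k + 22)))
    (Ensures.cond ?_ ?_) ?_
  · intro hT
    simp only [Test.Holds, d23, d21] at hT
    refine (Ensures.block (l := []) (Q := _) ?_).mono (by simp) fun _ h => h
    exact ⟨⟨d3, d4, d5⟩, by rw [if_pos hT]; exact d22, d2⟩
  · intro hT
    simp only [Test.Holds, d23, d21] at hT
    refine Ensures.block ⟨?_, ?_, ?_⟩
    · simp [exec, Instr.apply, Store.setI, d3, d4, d5]
    · simp [exec, Instr.apply, Store.setI, d3, d20, hT, k5]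
    · intro k hk
      rw [← (d2 k hk).1]
      refine ⟨?_, fun hk2 => ?_⟩
      · simp [exec, Instr.apply, Store.setI, show k ≠ 22 by omega]
      · rw [← (d2 k hk).2 hk2]
        simp [exec, Instr.apply, Store.setI, show k ≠ 0 by omega]
  rintro s₄ ⟨⟨f1, f2, f3⟩, f22, ff⟩
  have hpos := hE.position hcn hon hco hrco f22
  set i := s₄.ireg 22 with hi
  clear f22
  have hdat : edgeData s i = D s(c, o) := by
    have h1 := hS c hcm i hpos.1 hpos.2.1 (by rw [hpos.2.2]; exact hom)
      (by rw [hpos.2.2]; exact hrco)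
    rwa [hpos.2.2] at h1
  obtain ⟨-, -, huv⟩ := hX.of_agree (mk_mem_edgesIn.2 ⟨hco, hcm, hom⟩)
  set r := edgeData s i with hr
  rw [← hdat] at huv
  have hruv : r.u = a ∧ r.v = b ∨ r.u = b ∧ r.v = a := by
    rcases hcoab with ⟨rfl, rfl⟩ | ⟨rfl, rfl⟩ <;> tauto
  -- load the data of the parent edge
  refine Ensures.block_seq ?_
  set s₅ := exec [.intLoad 24 7 22, .intLoad 25 8 22, .intLoad 26 9 22] s₄ with hs₅
  have g0 : s₅.iarr = s.iarr ∧ s₅.rreg = s.rreg ∧ s₅.rarr = s.rarr := by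
    simp [hs₅, exec, Instr.apply, Store.setI, f1, f2, f3]
  have g1 : s₅.ireg 22 = i ∧ s₅.ireg 24 = r.u ∧ s₅.ireg 25 = r.v ∧
      s₅.ireg 26 = s.iarr 9 i := by
    simp [hs₅, exec, Instr.apply, Store.setI, f1, hr, edgeData, ← hi]
  have g2 : ∀ k < 20, s₅.ireg k = s₁.ireg k ∧ (5 ≤ k → s₅.ireg (k + 22) = s₁.ireg (k + 22)) := by
    intro k hk
    rw [← (ff k hk).1]
    refine ⟨?_, fun hk2 => ?_⟩
    · simp [hs₅, exec, Instr.apply, Store.setI, show k ≠ 24 by omega, show k ≠ 25 by omega,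
        show k ≠ 26 by omega]
    · rw [← (ff k hk).2 (by omega)]
      simp [hs₅, exec, Instr.apply, Store.setI, show k ≠ 2 by omega, show k ≠ 3 by omega,
        show k ≠ 4 by omega]
  obtain ⟨g3, g4, g5⟩ := g0
  obtain ⟨g22, g24, g25, g26⟩ := g1
  clear_value s₅
  have p0 := (g2 0 (by omega)).1.trans b0
  have p1 := (g2 1 (by omega)).1.trans b1
  have p5 := (g2 5 (by omega)).1.trans b5
  have p14 := (g2 14 (by omega)).1.trans b14
  have p15 := (g2 15 (by omega)).1.trans b15
  have p16 := (g2 16 (by omega)).1.trans b16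
  have p29 := ((g2 7 (by omega)).2 (by omega)).trans b29
  have p30 := ((g2 8 (by omega)).2 (by omega)).trans b30
  -- The roles of the two ends of the parent edge are not symmetric, and either may be `a`. The
  -- numbers of the new edges are swapped if necessary, so that register 27 belongs to the end
  -- `r.u`.
  refine Ensures.seq (Q := fun s₆ => (s₆.iarr = s.iarr ∧ s₆.rreg = s.rreg ∧ s₆.rarr = s.rarr) ∧
    (s₆.ireg 0 = n ∧ s₆.ireg 1 = h ∧ s₆.ireg 5 = w ∧ s₆.ireg 22 = i ∧ s₆.ireg 24 = r.u ∧
      s₆.ireg 25 = r.v ∧ s₆.ireg 26 = s.iarr 9 i ∧ s₆.ireg 29 = 1 ∧ s₆.ireg 30 = 0) ∧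
    (s₆.ireg 27 = e₀ w ∧ s₆.ireg 28 = e₁ w ∨ s₆.ireg 27 = e₁ w ∧ s₆.ireg 28 = e₀ w) ∧
    tgt (s₆.ireg 27) = r.u ∧ tgt (s₆.ireg 28) = r.v) (Ensures.cond ?_ ?_) ?_
  · intro hT
    simp only [Test.Holds, g24, p16] at hT
    have hrv : r.v = b := by
      rcases hruv with h1 | h1
      · exact h1.2
      · exact absurd (hT.symm.trans h1.1) hab.ne
    refine Ensures.block ⟨?_, ?_, Or.inl ?_, ?_⟩
    · simp [exec, Instr.apply, Store.setI, g3, g4, g5]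
    · simp [exec, Instr.apply, Store.setI, p0, p1, p5, p29, p30, g22, g24, g25, g26]
    · simp [exec, Instr.apply, Store.setI, p14, p15]
    · simp [exec, Instr.apply, Store.setI, p14, p15, hrv, hT, ← ha, ← hb]
  · intro hT
    simp only [Test.Holds, g24, p16] at hT
    have hrv : r.u = b ∧ r.v = a := by
      rcases hruv with h1 | h1
      · exact absurd h1.1 hT
      · exact h1
    refine Ensures.block ⟨?_, ?_, Or.inr ?_, ?_⟩
    · simp [exec, Instr.apply, Store.setI, g3, g4, g5]
    · simp [exec, Instr.apply, Store.setI, p0, p1, p5, p29, p30, g22, g24, g25, g26]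
    · simp [exec, Instr.apply, Store.setI, p14, p15]
    · simp [exec, Instr.apply, Store.setI, p14, p15, hrv, ← ha, ← hb]
  rintro s₆ ⟨⟨q1, q2, q3⟩, ⟨t0, t1, t5, t22, t24, t25, t26, t29, t30⟩, hj, tu, tv⟩
  have hpoint : point s₆ = point s := by funext x; simp [point, q3]
  have hedge : edgeData s₆ = edgeData s := by funext x; simp [edgeData, q1, q3]
  have hconst : HoldsConstants τ s₆ := by rw [HoldsConstants, q2]; exact hc
  have hN : ∀ x ∈ rest ord n (h + 1), H.Adj w x ↔ x = c ∨ x = o := by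
    intro x hx
    have h1 : H.Adj w x ↔ x = a ∨ x = b := by
      constructor
      · exact hp.only hn' x hx
      · rintro (rfl | rfl) <;> assumption
    rw [h1]
    rcases hcoab with ⟨rfl, rfl⟩ | ⟨rfl, rfl⟩
    · rfl
    · exact or_comm
  have hhn : (h : ℝ) + 1 + 2 ≤ n := by exact_mod_cast hn
  -- With all vertices of rank at least `h` drawn, `n - 2 - h` of them have been inserted, each at
  -- the price of `12τ`.
  have hσ : 0 ≤ 12 * τ * ((n : ℝ) - 2 - (h + 1 : ℕ)) := by
    push_cast
    exact mul_nonneg (by linarith) (by linarith)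
  have hσ' : 12 * τ * ((n : ℝ) - 2 - (h + 1 : ℕ)) + 12 * τ = 12 * τ * ((n : ℝ) - 2 - h) := by
    push_cast; ring
  have hσ1 : 12 * τ * ((n : ℝ) - 2 - h) ≤ 1 := by
    have : 0 ≤ τ * h := by positivity
    nlinarith
  set P := insertPoint (insertWeight τ r.ext) (point s r.u) (point s r.v) r.q with hP
  obtain ⟨lam', hX'⟩ := hX.insert_update hτ hσ (hσ'.le.trans hσ1) hcm hom hco hwS hN hdat.symm hP
  rw [hσ', ← hins] at hX'
  have hS' := Stores.insert L hE hn' hS hcm hom hrco hpos hj (r₀ := r.base τ (point s r.v) P)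
    (r₁ := r.left w) (r₂ := r.right τ (point s r.v) P w)
  rw [tu, tv, ← hwdef] at hS'
  have hfinal : ∀ ext, r.ext = ext → Ensures (block (insertBlock ext)) s₆ 45
      (InsertInv H n off tgt ord e₀ e₁ rk ε τ h) := by
    intro ext hext
    refine (Ensures.block (Q := InsertInv H n off tgt ord e₀ e₁ rk ε τ h) ?_).mono
      (by rw [insertBlock_length]) fun _ h => h
    obtain ⟨u1, u2, u3, u4, u5, u6⟩ := insertBlock_spec hconst t29 t30 (r := r)
      (by rw [hedge, t22]) hext t24 t25 (P := P) (by rw [hpoint])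
    rw [hpoint, t5] at u5
    rw [hpoint, hedge, t5, t22] at u6
    have u2' : ∀ k < 7, (exec (insertBlock ext) s₆).iarr k = s.iarr k := fun k hk => by
      rw [u2 k hk, q1]
    refine ⟨⟨by rw [u1, t0], by rw [u2' 0 (by norm_num), i1], by rw [u2' 1 (by norm_num), i2],
      by rw [u3, q2, i3]⟩, by rw [u1, t1], by rw [u1, t29], by rw [u1, t30], u4,
      ⟨by rw [u2' 3 (by norm_num), k3], by rw [u2' 4 (by norm_num), k4],
        by rw [u2' 5 (by norm_num), k5], by rw [u2' 6 (by norm_num), k6]⟩, hn'.le, lam', _, u5.symm ▸ hX',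
      u6.symm ▸ hS'⟩
  have hrext : r.ext = decide (s.iarr 9 i ≠ 0) := rfl
  refine Ensures.cond (fun hT => hfinal false ?_) fun hT => hfinal true ?_
  · simp only [Test.Holds, t26, t30] at hT
    rw [hrext]; simp [hT]
  · simp only [Test.Holds, t26, t30] at hT
    rw [hrext]; simp [hT]

/-- The last two vertices of the order are adjacent, and their edge has the number recorded in `e₀`
for the first of them. The thinness `τ` is rational in `ε` and `n`, so the machine computes it
exactly. -/
theorem baseBlock_spec (L : ListsFor n H off tgt)
    (hE : Eliminated H n off tgt ord e₀ e₁ rk) (hn : 2 ≤ n) {ε τ : ℝ} (hτ : 0 < τ)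
    (hτε : τ = ε / ((8 + ε) * 12 * n)) {s : Store} (hs : HoldsInput n off tgt ε s)
    (h1 : s.ireg 1 = n - 1) (h3 : s.iarr 3 = ord) (h4 : s.iarr 4 = e₀) (h5 : s.iarr 5 = e₁)
    (h6 : s.iarr 6 = rk) :
    InsertInv H n off tgt ord e₀ e₁ rk ε τ (n - 2) (exec baseBlock s) := by
  obtain ⟨i0, i1, i2, i3⟩ := hs
  set z := ord (n - 1) with hz
  set y := ord (n - 2) with hy
  have hn21 : n - 2 + 1 = n - 1 := by omega
  have hp := hE.parents (n - 2) (by omega)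
  have hym := hE.mem (n - 2) (by omega)
  have hzm := hE.mem (n - 1) (by omega)
  have hyn := (mem_rest.1 hym).1
  have hzn := (mem_rest.1 hzm).1
  have hry := hE.rank (n - 2) (by omega)
  have hrz := hE.rank (n - 1) (by omega)
  have hyz : y ≠ z := by
    intro h7
    have : rk y = rk z := by rw [h7]
    rw [hy, hz, hry, hrz] at this
    omega
  have huniq : ∀ x, x ∈ rest ord n (n - 1) → x = z := by
    intro x hx
    obtain ⟨i, a1, a2, rfl⟩ := hE.exists_index hx
    rw [hz]; congr 1; omega
  have htz : tgt (e₀ y) = z := huniq _ (by rw [← hn21]; exact hp.mem₀)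
  have hadj : H.Adj y z := by
    rw [← htz]; exact (L.target_lt hyn hp.le₀ hp.lt₀).1
  have hset : rest ord n (n - 2) = {y, z} := by
    ext x
    simp only [Finset.mem_insert, Finset.mem_singleton]
    constructor
    · intro hx
      by_cases hxy : x = y
      · exact Or.inl hxy
      · refine Or.inr (huniq x ?_)
        rw [← hn21, rest_succ]
        exact Finset.mem_erase.2 ⟨hxy, hx⟩
    · rintro (rfl | rfl)
      · exact hym
      · exact hE.mem_rest_iff.2 ⟨hzn, by rw [hz, hrz]; omega⟩
  have hn2 : n - 1 - 1 = n - 2 := by omega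
  set s' := exec baseBlock s with hs'
  have hτε' : ε / ((8 + ε) * 12 * n) = τ := hτε.symm
  have b0 : HoldsInput n off tgt ε s' ∧ s'.ireg 1 = n - 2 ∧ s'.ireg 29 = 1 ∧ s'.ireg 30 = 0 := by
    simp [hs', HoldsInput, baseBlock, exec, Instr.apply, Store.setI, Store.setR, i0, i1, i2, i3,
      h1, hn2]
  have b1 : HoldsConstants τ s' := by
    simp [hs', HoldsConstants, baseBlock, exec, Instr.apply, Store.setI, Store.setR, i0, i3,
      hτε']
  have b2 : s'.iarr 3 = ord ∧ s'.iarr 4 = e₀ ∧ s'.iarr 5 = e₁ ∧ s'.iarr 6 = rk := by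
    simp [hs', baseBlock, exec, Instr.apply, Store.setI, Store.setR, h3, h4, h5, h6]
  have b3 : point s' y = !₂[0, 0] ∧ point s' z = !₂[1, 0] := by
    simp [point, hs', baseBlock, exec, Instr.apply, Store.setI, Store.setR, h1, h3, hn2, ← hy,
      ← hz, hyz]
  have b4 : edgeData s' (e₀ y) = ⟨y, z, false, !₂[1, τ]⟩ := by
    simp [edgeData, hs', baseBlock, exec, Instr.apply, Store.setI, Store.setR, h1, h3, h4, hn2,
      ← hy, ← hz, i0, i3, hτε']
  obtain ⟨b0, b5, b6, b7⟩ := b0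
  obtain ⟨lam, hX⟩ := Extensible.base hτ hadj b3.1 b3.2
    (D := fun _ => ⟨y, z, false, !₂[1, τ]⟩) rfl
  refine ⟨b0, b5, b6, b7, b1, b2, by omega, lam, fun _ => ⟨y, z, false, !₂[1, τ]⟩, ?_, ?_⟩
  · rw [hset]
    have : 12 * τ * ((n : ℝ) - 2 - (n - 2 : ℕ)) = 0 := by
      rw [Nat.cast_sub hn]; simp
    rw [this]
    exact hX
  · rw [hset]
    intro c hc j hj1 hj2 hjm hjr
    simp only [Finset.mem_insert, Finset.mem_singleton] at hc hjm
    have hry' : rk y = n - 2 := hry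
    have hrz' : rk z = n - 1 := hrz
    rcases hc with rfl | rfl <;> rcases hjm with h7 | h7
    · rw [h7] at hjr; omega
    · have : j = e₀ y := L.inj _ hyn ⟨hj1, hj2⟩ ⟨hp.le₀, hp.lt₀⟩ (h7.trans htz.symm)
      rw [this]
      exact b4
    · rw [h7] at hjr; omega
    · rw [h7] at hjr; omega

theorem insertPhase_ensures (L : ListsFor n H off tgt)
    (hE : Eliminated H n off tgt ord e₀ e₁ rk) (hn : 2 ≤ n) {ε τ : ℝ} (hτ : 0 < τ)
    (hτn : 12 * τ * n ≤ 1) (hτε : τ = ε / ((8 + ε) * 12 * n)) {s : Store}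
    (hs : HoldsInput n off tgt ε s) (h1 : s.ireg 1 = n - 1) (h3 : s.iarr 3 = ord)
    (h4 : s.iarr 4 = e₀) (h5 : s.iarr 5 = e₁) (h6 : s.iarr 6 = rk) :
    Ensures insertPhase s (81 * n + 29) fun s' => ∃ lam D,
      Extensible H τ (12 * τ * (n - 2)) (Finset.range n) (point s') lam D := by
  refine Ensures.mono (B := 28 + (81 * (n - 2) + 1)) ?_ (by omega) fun _ h => h
  refine Ensures.block_seq (l := baseBlock) ?_
  have hloop := Ensures.loop (T := .intLt 30 1) (p := insertBody)
    (InsertInv H n off tgt ord e₀ e₁ rk ε τ) (fun h => 81 * h) (by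
    intro h s' hI hT
    simp only [Test.Holds] at hT
    rw [hI.2.2.2.1, hI.2.1] at hT
    obtain ⟨h, rfl⟩ : ∃ k, h = k + 1 := ⟨h - 1, by omega⟩
    exact ⟨h, 80, by omega, insertBody_ensures L hE hτ hτn hI⟩) (n - 2) _
    (baseBlock_spec L hE hn hτ hτε hs h1 h3 h4 h5 h6)
  refine hloop.mono le_rfl ?_
  rintro s' ⟨h, hI, hT⟩
  simp only [Test.Holds] at hT
  rw [hI.2.2.2.1, hI.2.1] at hT
  obtain rfl : h = 0 := by omega
  obtain ⟨-, -, -, -, -, -, -, lam, D, hX, -⟩ := hI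
  rw [rest_zero] at hX
  refine ⟨lam, D, ?_⟩
  simpa using hX

/-- The drawing algorithm. -/
def drawTwoTree : Program := .seq degreePhase (.seq elimPhase insertPhase)

theorem drawTwoTree_ensures {n : ℕ} {G : SimpleGraph (Fin n)} (hG : IsTwoTree G)
    (A : AdjacencyLists G) {ε : ℝ} (hε : 0 < ε) :
    Ensures drawTwoTree (inputStore A ε) (300 * n) fun s =>
      IsPlanarDrawing G (outputDrawing n s) ∧
      drawingLocalRatio G (outputDrawing n s) ≤ ENNReal.ofReal (4 + ε) := by
  have L := A.listsFor
  have hH : InducesTwoTree (G.map Fin.valEmbedding) (Finset.range n) := by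
    have h := InducesTwoTree.map Fin.valEmbedding hG
    rwa [Fin.map_valEmbedding_univ, Nat.Iio_eq_range] at h
  have hn : 2 ≤ n := by simpa using hH.two_le_card
  have hoff := L.off_le_four_mul hH
  have hn' : (2 : ℝ) ≤ n := by exact_mod_cast hn
  set τ := ε / ((8 + ε) * 12 * n) with hτ
  have hτ0 : 0 < τ := by positivity
  have hτ1 : 12 * τ * n * (8 + ε) = ε := by rw [hτ]; field_simp
  have hτn : 12 * τ * n ≤ 1 := by
    have : 0 < 12 * τ * n := by positivity
    nlinarith
  have hin : HoldsInput n A.offset A.target ε (inputStore A ε) := by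
    simp [HoldsInput, inputStore]
  -- As the lists have total length at most `4n`, the sum is at most `197n + 45`, which is below
  -- `300n` because `n ≥ 2`. The bound does not involve `ε`.
  refine Ensures.mono (B := (20 * n + 4 * A.offset n + 6) + ((17 * A.offset n + 12 * n + 10) +
    (81 * n + 29))) ?_ (by omega) fun _ h => h
  refine (degreePhase_ensures L hin).seq ?_
  rintro s₁ ⟨h1, h2, h3⟩
  refine (elimPhase_ensures L hH h1 h2 h3).seq ?_
  rintro s₂ ⟨h4, h5, h6⟩
  refine (insertPhase_ensures L h6 hn hτ0 hτn hτ h4 h5 rfl rfl rfl rfl).mono le_rfl ?_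
  rintro s₃ ⟨lam, D, hX⟩
  have hmem : ∀ x : Fin n, Fin.valEmbedding x ∈ Finset.range n := fun x => by simp
  have hadj : ∀ x y, G.Adj x y → (G.map Fin.valEmbedding).Adj (Fin.valEmbedding x)
      (Fin.valEmbedding y) := fun x y h => by
    rw [SimpleGraph.map_adj]; exact ⟨x, y, h, rfl, rfl⟩
  refine ⟨hX.isPlanarDrawing Fin.valEmbedding hmem hadj,
    hX.drawingLocalRatio_le Fin.valEmbedding hmem hadj hε ?_ ?_⟩
  · exact mul_nonneg (by linarith) (by linarith)
  · calc _ ≤ 12 * τ * n * (8 + ε) := by gcongr; linarith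
      _ ≤ _ := hτ1.le

end InsertionProgram

end RealRAM

theorem theorem2 :
    (∀ (V : Type*) [Fintype V] [DecidableEq V] (G : SimpleGraph V),
      IsTwoTree G → localEdgeLengthRatio G ≤ 4) ∧
    (∃ P : RealRAM.Program, ∀ ε : ℝ, 0 < ε → ∃ C : ℕ,
      ∀ (n : ℕ) (G : SimpleGraph (Fin n)), IsTwoTree G →
        ∀ A : RealRAM.AdjacencyLists G,
          ∃ (t : ℕ) (s : RealRAM.Store),
            RealRAM.Runs P (RealRAM.inputStore A ε) t s ∧
            t ≤ C * n ∧
            IsPlanarDrawing G (RealRAM.outputDrawing n s) ∧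
            drawingLocalRatio G (RealRAM.outputDrawing n s) ≤ ENNReal.ofReal (4 + ε)) := by
  refine ⟨fun V _ _ G hG => hG.localEdgeLengthRatio_le, RealRAM.drawTwoTree, fun ε hε => ⟨300, ?_⟩⟩
  intro n G hG A
  exact RealRAM.drawTwoTree_ensures hG A hε
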